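/- Notation. For a C*-algebra $A$ acting on a Hilbert space $\mathcal H$ (that is, a norm closed $*$-subalgebra $A\subseteq\mathcal B(\mathcal H)$, not assumed unital, separable or nondegenerate), let $A\otimes\mathcal K$ denote its stabilisation, acting on $\mathcal H\otimes\ell^2(\mathbb N)$; here $\mathcal K$ is the algebra of compact operators on $\ell^2(\mathbb N)$. For positive $a,b\in A\otimes\mathcal K$ write $a\precsim b$ if $v_nbv_n^*\to a$ in norm for some sequence $(v_n)$ in $A\otimes\mathcal K$, and $a\sim b$ if $a\precsim b\precsim a$. The Cuntz semigroup $\mathrm{Cu}(A)=(A\otimes\mathcal K)^+/\!\sim$, with classes $\langle a\rangle$, is ordered by $\langle a\rangle\le\langle b\rangle\iff a\precsim b$, and has addition $\langle a\rangle+\langle b\rangle=\langle a'+b'\rangle$ for orthogonal $a'\sim a$, $b'\sim b$. For $x,y$ in an ordered set, $x\ll y$ means that whenever an increasing sequence $(y_n)$ has supremum $y$, there is $n$ with $x\le y_n$. The scale $\Sigma(\mathrm{Cu}(A))\subseteq\mathrm{Cu}(A)$ is the set of suprema in $\mathrm{Cu}(A)$ of increasing sequences $\langle a_1\rangle\le\langle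 a_2\rangle\le\cdots$ with $a_n\in A^+$, where $A$ is identified with a corner $A\otimes e\subseteq A\otimes\mathcal K$, $e$ a rank one matrix unit. A sequence $(a_n)$ of positive contractions in $A\otimes\mathcal K$ is *very rapidly increasing* if $\langle a_n\rangle\ll\langle a_{n+1}\rangle$ for all $n$ and, for every $\varepsilon>0$ and every $n$, there is $m_0$ such that for each $m\ge m_0$ there is $v\in A\otimes\mathcal K$ with $\|v\|\le1$ and $\|(va_mv^*)a_n-a_n\|<\varepsilon$. For $b\ge0$ and $\varepsilon\geq 0$, $(b-\varepsilon)_+$ denotes $h_\varepsilon(b)$ with $h_\varepsilon(t)=\max(0,t-\varepsilon)$. The inequality $d_{\mathrm{cb}}(A,B)<\alpha$ means that each element of the unit ball of either of $A\otimes\mathcal K$, $B\otimes\mathcal K$ is at distance less than $\alpha$ from some element of the unit ball of the other. Theorem. Let $A$ and $B$ be C*-algebras acting on the same Hilbert space with $d_{\mathrm{cb}}(A,B)<\alpha<1/42$. Then $(\mathrm{Cu}(A),\Sigma(\mathrm{Cu}(A)))\cong(\mathrm{Cu}(B),\Sigma(\mathrm{Cu}(B)))$: there is a bijection $\Phi:\mathrm{Cu}(A)\to\mathrm{Cu}(B)$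 such that $\Phi$ and $\Phi^{-1}$ preserve order, addition, zero, suprema of increasing sequences and the relation $\ll$, and $\Phi(\Sigma(\mathrm{Cu}(A)))=\Sigma(\mathrm{Cu}(B))$. Moreover, $\Phi$ can be chosen so that $$\Phi\Bigl(\sup_n\langle a_n\rangle\Bigr)=\sup_n\langle(b_n-18\alpha)_+\rangle$$ (both suprema existing) whenever $(a_n)$ is a very rapidly increasing sequence of positive contractions in $A\otimes\mathcal K$ and $(b_n)$ is a sequence of positive contractions in $B\otimes\mathcal K$ with $\|a_n-b_n\|<2\alpha$ for all $n$. This determines $\Phi$: every element of $\mathrm{Cu}(A)$ is $\sup_n\langle a_n\rangle$ for some very rapidly increasing sequence $(a_n)$ in $A\otimes\mathcal K$, and for every such $(a_n)$ a sequence $(b_n)$ as above exists. -/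

import Mathlib

open Filter Topology

noncomputable section

namespace CuntzStab

section Stabilisation

variable {H : Type*} [NormedAddCommGroup H] [InnerProductSpace ℂ H] [CompleteSpace H]

/-- The Hilbert space `ℓ²(ℕ, H)`, that is `H ⊗ ℓ²(ℕ)`. -/
def EllTwo (H : Type*) [NormedAddCommGroup H] : Type _ := lp (fun _ : ℕ => H) 2

instance : NormedAddCommGroup (EllTwo H) :=
  inferInstanceAs (NormedAddCommGroup (lp (fun _ : ℕ => H) 2))

instance : InnerProductSpace ℂ (EllTwo H) :=
  inferInstanceAs (InnerProductSpace ℂ (lp (fun _ : ℕ => H) 2))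

instance : CompleteSpace (EllTwo H) :=
  inferInstanceAs (CompleteSpace (lp (fun _ : ℕ => H) 2))

/-- The isometry `h ↦ h ⊗ δ_i` of `H` onto the `i`-th coordinate of `ℓ²(ℕ, H)`. -/
def coord (i : ℕ) : H →ₗᵢ[ℂ] EllTwo H where
  toLinearMap := lp.lsingle (𝕜 := ℂ) (E := fun _ : ℕ => H) 2 i
  norm_map' x := lp.norm_single (E := fun _ : ℕ => H) (by norm_num) i x

/-- The elementary tensor `a ⊗ e_{ij}` on `ℓ²(ℕ, H) = H ⊗ ℓ²(ℕ)`, where the `e_{ij}` are the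
standard matrix units: it sends `h ⊗ δ_j` to `a h ⊗ δ_i` and kills `h ⊗ δ_k` for `k ≠ j`. -/
def tensorUnit (i j : ℕ) (a : H →L[ℂ] H) : EllTwo H →L[ℂ] EllTwo H :=
  (coord i).toContinuousLinearMap ∘L a ∘L
    ContinuousLinearMap.adjoint (coord j).toContinuousLinearMap

/-- The stabilisation `A ⊗ 𝒦` of a C⋆-subalgebra `A` of `B(H)`, acting on `H ⊗ ℓ²(ℕ)`:
the C⋆-algebra generated by the elementary tensors `a ⊗ e_{ij}`, `a ∈ A`. -/
def stab (A : NonUnitalStarSubalgebra ℂ (H →L[ℂ] H)) :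
    NonUnitalStarSubalgebra ℂ (EllTwo H →L[ℂ] EllTwo H) :=
  (NonUnitalStarAlgebra.adjoin ℂ
    {x | ∃ i j : ℕ, ∃ a ∈ A, x = tensorUnit i j a}).topologicalClosure

/-- `CloseLT A B γ` is the assertion `d(A, B) < γ` for the Kadison–Kastler metric:
each element of the unit ball of either algebra is within distance less than `γ` of
the unit ball of the other. -/
def CloseLT {C : Type*} [NormedRing C] [StarRing C] [NormedAlgebra ℂ C]
    (A B : NonUnitalStarSubalgebra ℂ C) (γ : ℝ) : Prop :=
  (∀ x ∈ A, ‖x‖ ≤ 1 → ∃ y ∈ B, ‖y‖ ≤ 1 ∧ ‖x - y‖ < γ) ∧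
  (∀ x ∈ B, ‖x‖ ≤ 1 → ∃ y ∈ A, ‖y‖ ≤ 1 ∧ ‖x - y‖ < γ)

/-- The assertion `d_cb(A, B) < γ`, that is `d(A ⊗ 𝒦, B ⊗ 𝒦) < γ`. -/
def CBCloseLT (A B : NonUnitalStarSubalgebra ℂ (H →L[ℂ] H)) (γ : ℝ) : Prop :=
  CloseLT (stab A) (stab B) γ

variable (A : NonUnitalStarSubalgebra ℂ (H →L[ℂ] H))

/-- The positive cone `(A ⊗ 𝒦)⁺`. -/
structure PosStab where
  /-- the underlying operator -/
  val : EllTwo H →L[ℂ] EllTwo H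
  mem : val ∈ stab A
  nonneg : 0 ≤ val

variable {A}

/-- Cuntz subequivalence in `A ⊗ 𝒦`: `a ≾ b` if `v_n b v_n⋆ → a` for some sequence `(v_n)`
in `A ⊗ 𝒦`. -/
def CuntzLE (a b : PosStab A) : Prop :=
  ∃ v : ℕ → EllTwo H →L[ℂ] EllTwo H, (∀ n, v n ∈ stab A) ∧
    Tendsto (fun n => v n * b.val * star (v n)) atTop (𝓝 a.val)

/-- The element `(b - ε)_+` of `(A ⊗ 𝒦)⁺`, for `b ∈ (A ⊗ 𝒦)⁺` and `0 ≤ ε`, by continuous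
functional calculus. -/
def PosStab.cutDown (b : PosStab A) (ε : ℝ) : PosStab A where
  val := cfcₙ (fun t : ℝ => max 0 (t - ε)) b.val
  mem := cfcₙ_mem (hs := NonUnitalStarSubalgebra.isClosed_topologicalClosure _) _ b.mem
  nonneg := cfcₙ_nonneg fun _ _ => le_max_left _ _

/-! ### Cuntz subequivalence is a preorder -/

theorem isClosed_stab : IsClosed (stab A : Set (EllTwo H →L[ℂ] EllTwo H)) :=
  NonUnitalStarSubalgebra.isClosed_topologicalClosure _

theorem mul_mem_stab {x y : EllTwo H →L[ℂ] EllTwo H} (hx : x ∈ stab A) (hy : y ∈ stab A) :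
    x * y ∈ stab A := mul_mem hx hy

theorem cuntzLE_iff {a b : PosStab A} :
    CuntzLE a b ↔ ∀ ε > 0, ∃ v ∈ stab A, ‖v * b.val * star v - a.val‖ < ε := by
  constructor
  · rintro ⟨v, hv, h⟩ ε hε
    obtain ⟨N, hN⟩ := (Metric.tendsto_atTop.1 h) ε hε
    exact ⟨v N, hv N, by simpa [dist_eq_norm] using hN N le_rfl⟩
  · intro h
    choose v hv hb using fun n : ℕ => h (1 / ((n : ℝ) + 1)) Nat.one_div_pos_of_nat
    refine ⟨v, hv, ?_⟩
    rw [tendsto_iff_norm_sub_tendsto_zero]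
    exact squeeze_zero (fun _ => norm_nonneg _) (fun n => (hb n).le)
      tendsto_one_div_add_atTop_nhds_zero_nat

/-- For positive `a` and `ε > 0`, there is `u = u⋆ = g a` with `u a u` within `ε` of `a`. -/
theorem exists_unit (a : PosStab A) {ε : ℝ} (hε : 0 < ε) :
    ∃ u ∈ stab A, star u = u ∧ (∃ g, u = g * a.val ∧ u = a.val * g) ∧
      ‖u * a.val * u - a.val‖ ≤ ε := by
  have ha : IsSelfAdjoint a.val := IsSelfAdjoint.of_nonneg a.nonneg
  have hcg : Continuous fun t : ℝ => (max t ε)⁻¹ :=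
    (continuous_id.max continuous_const).inv₀ fun t => (lt_max_of_lt_right hε).ne'
  have hcu : Continuous fun t : ℝ => (max t ε)⁻¹ * t := hcg.mul continuous_id
  set u := cfc (fun t : ℝ => (max t ε)⁻¹ * t) a.val with hu
  have hu1 : u = cfc (fun t : ℝ => (max t ε)⁻¹) a.val * a.val := by
    rw [hu, cfc_mul _ _ a.val hcg.continuousOn (by fun_prop), cfc_id' ℝ a.val]
  have hus : star u = u := by
    have : IsSelfAdjoint u := cfc_predicate _ _
    exact this
  refine ⟨u, ?_, hus, ⟨cfc (fun t : ℝ => (max t ε)⁻¹) a.val, hu1, ?_⟩, ?_⟩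
  · rw [hu, ← cfcₙ_eq_cfc hcu.continuousOn (by simp)]
    exact cfcₙ_mem (hs := isClosed_stab) _ a.mem
  · have h1 : IsSelfAdjoint (cfc (fun t : ℝ => (max t ε)⁻¹) a.val) := cfc_predicate _ _
    have := congrArg star hu1
    rwa [hus, star_mul, h1.star_eq, ha.star_eq] at this
  · have h2 : u * a.val * u - a.val =
        cfc (fun t : ℝ => ((max t ε)⁻¹ * t) * t * ((max t ε)⁻¹ * t) - t) a.val := by
      rw [cfc_sub _ _ a.val (by fun_prop) (by fun_prop),
        cfc_mul _ _ a.val (by fun_prop) (by fun_prop),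
        cfc_mul _ _ a.val (by fun_prop) (by fun_prop), cfc_id' ℝ a.val]
    rw [h2]
    refine norm_cfc_le hε.le fun t ht => ?_
    have ht0 : 0 ≤ t := spectrum_nonneg_of_nonneg a.nonneg ht
    rcases le_total t ε with h | h
    · rw [max_eq_right h, Real.norm_eq_abs, abs_le]
      have h3 : 0 ≤ ε⁻¹ * t := by positivity
      have h4 : ε⁻¹ * t ≤ 1 := by
        rw [inv_mul_le_iff₀ hε]; simpa using h
      have h5 : (ε⁻¹ * t) * (ε⁻¹ * t) ≤ 1 := by nlinarith
      constructor <;> nlinarith [mul_nonneg h3 h3, mul_nonneg ht0 (mul_nonneg h3 h3)]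
    · have h3 : t ≠ 0 := (hε.trans_le h).ne'
      rw [max_eq_left h, inv_mul_cancel₀ h3]
      simpa using hε.le

theorem CuntzLE.refl (a : PosStab A) : CuntzLE a a := by
  rw [cuntzLE_iff]
  intro ε hε
  obtain ⟨u, hu, hs, -, h⟩ := exists_unit a (half_pos hε)
  exact ⟨u, hu, by rw [hs]; linarith⟩

theorem CuntzLE.trans {a b c : PosStab A} (h₁ : CuntzLE a b) (h₂ : CuntzLE b c) :
    CuntzLE a c := by
  rw [cuntzLE_iff] at *
  intro ε hε
  obtain ⟨v, hv, h1⟩ := h₁ (ε / 2) (half_pos hε)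
  have hK : 0 < ‖v‖ * ‖v‖ + 1 := by positivity
  obtain ⟨w, hw, h2⟩ := h₂ (ε / 2 / (‖v‖ * ‖v‖ + 1)) (by positivity)
  refine ⟨v * w, mul_mem hv hw, ?_⟩
  have e : v * w * c.val * star (v * w) - a.val =
      v * (w * c.val * star w - b.val) * star v + (v * b.val * star v - a.val) := by
    rw [star_mul]; noncomm_ring
  rw [e]
  have h3 : ‖v * (w * c.val * star w - b.val) * star v‖ ≤ ε / 2 := by
    calc _ ≤ ‖v‖ * ‖w * c.val * star w - b.val‖ * ‖star v‖ :=
          (norm_mul_le _ _).trans (by gcongr; exact norm_mul_le _ _)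
      _ = (‖v‖ * ‖v‖) * ‖w * c.val * star w - b.val‖ := by rw [norm_star]; ring
      _ ≤ (‖v‖ * ‖v‖ + 1) * (ε / 2 / (‖v‖ * ‖v‖ + 1)) := by gcongr; linarith
      _ = ε / 2 := by field_simp
  linarith [norm_add_le (v * (w * c.val * star w - b.val) * star v)
    (v * b.val * star v - a.val)]

instance : Preorder (PosStab A) where
  le := CuntzLE
  le_refl := CuntzLE.refl
  le_trans _ _ _ := CuntzLE.trans

theorem posStab_le_def {a b : PosStab A} : a ≤ b ↔ CuntzLE a b := Iff.rfl

variable (A)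

/-- The Cuntz semigroup `Cu(A)`: Cuntz equivalence classes of positive elements of `A ⊗ 𝒦`,
ordered by Cuntz subequivalence of representatives. -/
def Cu : Type _ := Antisymmetrization (PosStab A) (· ≤ ·)

instance : PartialOrder (Cu A) :=
  inferInstanceAs (PartialOrder (Antisymmetrization (PosStab A) (· ≤ ·)))

variable {A}

/-- The Cuntz class `⟨a⟩` of `a ∈ (A ⊗ 𝒦)⁺`. -/
def Cu.mk (a : PosStab A) : Cu A := toAntisymmetrization (· ≤ ·) a

theorem Cu.mk_le_mk {a b : PosStab A} : Cu.mk a ≤ Cu.mk b ↔ CuntzLE a b := Iff.rfl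

theorem Cu.ind {p : Cu A → Prop} (h : ∀ a, p (Cu.mk a)) (x : Cu A) : p x :=
  Antisymmetrization.ind (· ≤ ·) h x

/-! ### Addition -/

set_option linter.unusedSectionVars false in
theorem orthogonalFamily_coord (f : ℕ → ℕ) (hf : Function.Injective f) :
    OrthogonalFamily ℂ (fun _ : ℕ => H) fun n => (coord (f n) : H →ₗᵢ[ℂ] EllTwo H) := by
  intro i j hij x y
  have h : (lp.single 2 (f j) y : EllTwo H) (f i) = 0 :=
    lp.single_apply_ne (E := fun _ : ℕ => H) 2 (f j) y (hf.ne hij)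
  have := lp.inner_single_left (𝕜 := ℂ) (G := fun _ : ℕ => H) (f i) x (lp.single 2 (f j) y)
  rw [h, inner_zero_right] at this
  exact this

/-- The isometry `1 ⊗ s` of `ℓ²(ℕ, H) = H ⊗ ℓ²(ℕ)`, where `s δ_n = δ_{f n}`. -/
def spread (f : ℕ → ℕ) (hf : Function.Injective f) : EllTwo H →L[ℂ] EllTwo H :=
  (orthogonalFamily_coord (H := H) f hf).linearIsometry.toContinuousLinearMap

theorem spread_coord (f : ℕ → ℕ) (hf : Function.Injective f) (i : ℕ) (x : H) :
    spread f hf (coord i x) = coord (f i) x :=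
  (orthogonalFamily_coord (H := H) f hf).linearIsometry_apply_single x

theorem star_spread_mul_self (f : ℕ → ℕ) (hf : Function.Injective f) :
    star (spread (H := H) f hf) * spread f hf = 1 := by
  rw [ContinuousLinearMap.star_eq_adjoint]
  refine ContinuousLinearMap.ext fun x => ext_inner_left ℂ fun y => ?_
  change inner ℂ y (ContinuousLinearMap.adjoint (spread f hf) (spread f hf x)) = inner ℂ y x
  rw [ContinuousLinearMap.adjoint_inner_right]
  exact (orthogonalFamily_coord (H := H) f hf).linearIsometry.inner_map_map y x

theorem star_spread_mul_spread {f g : ℕ → ℕ} (hf : Function.Injective f)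
    (hg : Function.Injective g) (hfg : ∀ m n, f m ≠ g n) :
    star (spread (H := H) f hf) * spread g hg = 0 := by
  rw [ContinuousLinearMap.star_eq_adjoint]
  refine ContinuousLinearMap.ext fun x => ext_inner_left ℂ fun y => ?_
  change inner ℂ y (ContinuousLinearMap.adjoint (spread f hf) (spread g hg x)) = inner ℂ y 0
  rw [ContinuousLinearMap.adjoint_inner_right, inner_zero_right]
  have hx := (orthogonalFamily_coord (H := H) g hg).hasSum_linearIsometry x
  have hy := (orthogonalFamily_coord (H := H) f hf).hasSum_linearIsometry y
  have key : ∀ (n : ℕ) (h : H), inner ℂ (spread f hf y) (coord (g n) h) = 0 := by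
    intro n h
    have h0 : ∀ (m : ℕ) (k : H), inner ℂ (coord (g n) h : EllTwo H) (coord (f m) k) = 0 :=
      fun m k => orthogonalFamily_coord (H := H) id Function.injective_id (hfg m n).symm h k
    have h1 : inner ℂ (coord (g n) h : EllTwo H) (spread f hf y) = 0 :=
      (hy.mapL (innerSL ℂ (coord (g n) h : EllTwo H))).unique
        (by simp only [innerSL_apply_apply, h0]; exact hasSum_zero)
    rw [← inner_conj_symm, h1, map_zero]
  exact (hx.mapL (innerSL ℂ (spread f hf y))).unique
    (by simp only [innerSL_apply_apply, key]; exact hasSum_zero)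

theorem spread_mem (f : ℕ → ℕ) (hf : Function.Injective f)
    {x : EllTwo H →L[ℂ] EllTwo H} (hx : x ∈ stab A) :
    spread f hf * x ∈ stab A ∧ x * star (spread f hf) ∈ stab A := by
  have hgen : ∀ i j : ℕ, ∀ a ∈ A, tensorUnit i j a ∈ stab A := fun i j a ha =>
    NonUnitalStarSubalgebra.le_topologicalClosure _
      (NonUnitalStarAlgebra.subset_adjoin ℂ _ ⟨i, j, a, ha, rfl⟩)
  have h1 : ∀ i j : ℕ, ∀ a : H →L[ℂ] H,
      spread f hf * tensorUnit i j a = tensorUnit (f i) j a := by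
    intro i j a
    ext1 y
    exact spread_coord f hf i _
  have h2 : ∀ i j : ℕ, ∀ a : H →L[ℂ] H,
      tensorUnit i j a * star (spread f hf) = tensorUnit i (f j) a := by
    intro i j a
    have : spread f hf ∘L (coord j).toContinuousLinearMap =
        (coord (f j) : H →ₗᵢ[ℂ] EllTwo H).toContinuousLinearMap := by
      ext1 y
      exact spread_coord f hf j y
    rw [ContinuousLinearMap.star_eq_adjoint, tensorUnit, tensorUnit, ← this,
      ContinuousLinearMap.adjoint_comp]
    rfl
  have hclosed : IsClosed {x : EllTwo H →L[ℂ] EllTwo H |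
      spread f hf * x ∈ stab A ∧ x * star (spread f hf) ∈ stab A} :=
    (isClosed_stab.preimage (continuous_const_mul _)).inter
      (isClosed_stab.preimage (continuous_mul_const _))
  refine closure_minimal (fun x hx => ?_) hclosed hx
  suffices x ∈ stab A ∧ (spread f hf * x ∈ stab A ∧ x * star (spread f hf) ∈ stab A) from this.2
  induction hx using NonUnitalStarAlgebra.adjoin_induction with
  | mem x hx =>
    obtain ⟨i, j, a, ha, rfl⟩ := hx
    rw [h1, h2]
    exact ⟨hgen _ _ _ ha, hgen _ _ _ ha, hgen _ _ _ ha⟩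
  | add x y _ _ hx hy =>
    rw [mul_add, add_mul]
    exact ⟨add_mem hx.1 hy.1, add_mem hx.2.1 hy.2.1, add_mem hx.2.2 hy.2.2⟩
  | zero => simp
  | mul x y _ _ hx hy =>
    refine ⟨mul_mem hx.1 hy.1, ?_, ?_⟩
    · rw [← mul_assoc]; exact mul_mem hx.2.1 hy.1
    · rw [mul_assoc]; exact mul_mem hx.1 hy.2.2
  | smul r x _ hx =>
    rw [mul_smul_comm, smul_mul_assoc]
    exact ⟨SMulMemClass.smul_mem r hx.1, SMulMemClass.smul_mem r hx.2.1,
      SMulMemClass.smul_mem r hx.2.2⟩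
  | star x _ hx =>
    refine ⟨star_mem hx.1, ?_, ?_⟩
    · simpa using star_mem hx.2.2
    · simpa using star_mem hx.2.1

variable (H) in
/-- The isometry of `H ⊗ ℓ²(ℕ)` onto the even coordinates. -/
def evenIso : EllTwo H →L[ℂ] EllTwo H :=
  spread (fun n => 2 * n) fun _ _ h => by simpa using h

variable (H) in
/-- The isometry of `H ⊗ ℓ²(ℕ)` onto the odd coordinates. -/
def oddIso : EllTwo H →L[ℂ] EllTwo H :=
  spread (fun n => 2 * n + 1) fun _ _ h => by simpa using h

theorem even_even : star (evenIso H) * evenIso H = 1 := star_spread_mul_self _ _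
theorem odd_odd : star (oddIso H) * oddIso H = 1 := star_spread_mul_self _ _
theorem even_odd : star (evenIso H) * oddIso H = 0 :=
  star_spread_mul_spread _ _ fun m n => by omega
theorem odd_even : star (oddIso H) * evenIso H = 0 :=
  star_spread_mul_spread _ _ fun m n => by omega

theorem even_mem {x : EllTwo H →L[ℂ] EllTwo H} (hx : x ∈ stab A) :
    evenIso H * x ∈ stab A ∧ x * star (evenIso H) ∈ stab A := spread_mem _ _ hx
theorem odd_mem {x : EllTwo H →L[ℂ] EllTwo H} (hx : x ∈ stab A) :
    oddIso H * x ∈ stab A ∧ x * star (oddIso H) ∈ stab A := spread_mem _ _ hx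

/-- The sum of two elements of `(A ⊗ 𝒦)⁺`. -/
def PosStab.sum (a b : PosStab A) : PosStab A where
  val := a.val + b.val
  mem := add_mem a.mem b.mem
  nonneg := add_nonneg a.nonneg b.nonneg

/-- The copy `s a s⋆` of `a` on the even coordinates. -/
def PosStab.even (a : PosStab A) : PosStab A where
  val := evenIso H * a.val * star (evenIso H)
  mem := (even_mem (even_mem a.mem).1).2
  nonneg := star_right_conjugate_nonneg a.nonneg (evenIso H)

/-- The copy `s a s⋆` of `a` on the odd coordinates. -/
def PosStab.odd (a : PosStab A) : PosStab A where
  val := oddIso H * a.val * star (oddIso H)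
  mem := (odd_mem (odd_mem a.mem).1).2
  nonneg := star_right_conjugate_nonneg a.nonneg (oddIso H)

/-- The orthogonal sum `a ⊕ b`: `a` and `b` are moved to the even and the odd coordinates of
`H ⊗ ℓ²(ℕ)` respectively, and added. -/
def PosStab.oplus (a b : PosStab A) : PosStab A := a.even.sum b.odd

theorem mul_even_odd (x y z w : EllTwo H →L[ℂ] EllTwo H) :
    (x * star (evenIso H) + y * star (oddIso H)) * (evenIso H * z + oddIso H * w) =
      x * z + y * w := by
  have h1 := even_even (H := H)
  have h2 := odd_odd (H := H)
  have h3 := even_odd (H := H)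
  have h4 := odd_even (H := H)
  calc _ = x * (star (evenIso H) * evenIso H) * z + x * (star (evenIso H) * oddIso H) * w
        + y * (star (oddIso H) * evenIso H) * z + y * (star (oddIso H) * oddIso H) * w := by noncomm_ring
    _ = _ := by rw [h1, h2, h3, h4]; simp

theorem oplus_mono {a a' b b' : PosStab A} (h : CuntzLE a a') (h' : CuntzLE b b') :
    CuntzLE (a.oplus b) (a'.oplus b') := by
  obtain ⟨v, hv, hva⟩ := h
  obtain ⟨w, hw, hwb⟩ := h'
  refine ⟨fun n => evenIso H * v n * star (evenIso H) + oddIso H * w n * star (oddIso H), fun n => ?_, ?_⟩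
  · exact add_mem (even_mem (even_mem (hv n)).1).2
      (odd_mem (odd_mem (hw n)).1).2
  · have e : ∀ n, (evenIso H * v n * star (evenIso H) + oddIso H * w n * star (oddIso H))
        * (a'.oplus b').val
        * star (evenIso H * v n * star (evenIso H) + oddIso H * w n * star (oddIso H)) =
        evenIso H * (v n * a'.val * star (v n)) * star (evenIso H) +
          oddIso H * (w n * b'.val * star (w n)) * star (oddIso H) := by
      intro n
      have e1 : (a'.oplus b').val = evenIso H * (a'.val * star (evenIso H))
          + oddIso H * (b'.val * star (oddIso H)) := by
        simp only [PosStab.oplus, PosStab.sum, PosStab.even, PosStab.odd, mul_assoc]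
      have e2 : star (evenIso H * v n * star (evenIso H) + oddIso H * w n * star (oddIso H)) =
          evenIso H * (star (v n) * star (evenIso H)) + oddIso H * (star (w n) * star (oddIso H)) := by
        simp only [star_add, star_mul, star_star, mul_assoc]
      rw [e1, mul_even_odd, e2]
      have e3 := mul_even_odd (evenIso H * v n * a'.val) (oddIso H * w n * b'.val)
        (star (v n) * star (evenIso H)) (star (w n) * star (oddIso H))
      simp only [mul_assoc] at e3 ⊢
      exact e3
    simp only [e]
    exact ((hva.const_mul _).mul_const _).add ((hwb.const_mul _).mul_const _)

instance : Zero (Cu A) := ⟨Cu.mk ⟨0, zero_mem _, le_rfl⟩⟩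

/-- Addition on `Cu(A)`: `⟨a⟩ + ⟨b⟩ = ⟨a ⊕ b⟩`. Equivalently, `⟨a⟩ + ⟨b⟩ = ⟨a' + b'⟩` for any
orthogonal `a' ∼ a` and `b' ∼ b`: see `Cu.mk_add_mk_of_mul_eq_zero`. -/
instance : Add (Cu A) :=
  ⟨Quotient.map₂ PosStab.oplus fun _ _ h _ _ h' => ⟨oplus_mono h.1 h'.1, oplus_mono h.2 h'.2⟩⟩

theorem Cu.mk_add_mk (a b : PosStab A) : Cu.mk a + Cu.mk b = Cu.mk (a.oplus b) := rfl

theorem Cu.mk_eq_mk {a b : PosStab A} (h : CuntzLE a b) (h' : CuntzLE b a) :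
    Cu.mk a = Cu.mk b := le_antisymm h h'

/-- If `a` and `b` are orthogonal then `⟨a⟩ + ⟨b⟩ = ⟨a + b⟩`. -/
theorem Cu.mk_add_mk_of_mul_eq_zero {a b : PosStab A} (hab : a.val * b.val = 0) :
    Cu.mk a + Cu.mk b = Cu.mk (a.sum b) := by
  have hba : b.val * a.val = 0 := by
    have := congrArg star hab
    rwa [star_mul, star_zero, (IsSelfAdjoint.of_nonneg a.nonneg).star_eq,
      (IsSelfAdjoint.of_nonneg b.nonneg).star_eq] at this
  have key : ∀ ε > 0, ∃ u ∈ stab A, ∃ w ∈ stab A, star u = u ∧ star w = w ∧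
      u * b.val = 0 ∧ w * a.val = 0 ∧
      ‖u * a.val * u - a.val‖ ≤ ε ∧ ‖w * b.val * w - b.val‖ ≤ ε := by
    intro ε hε
    obtain ⟨u, hu, hus, ⟨g, hg, -⟩, hua⟩ := exists_unit a hε
    obtain ⟨w, hw, hws, ⟨k, hk, -⟩, hwb⟩ := exists_unit b hε
    exact ⟨u, hu, w, hw, hus, hws, by rw [hg, mul_assoc, hab, mul_zero],
      by rw [hk, mul_assoc, hba, mul_zero], hua, hwb⟩
  have e1 : (a.oplus b).val = evenIso H * (a.val * star (evenIso H))
      + oddIso H * (b.val * star (oddIso H)) := by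
    simp only [PosStab.oplus, PosStab.sum, PosStab.even, PosStab.odd, mul_assoc]
  rw [Cu.mk_add_mk]
  refine Cu.mk_eq_mk ?_ ?_
  · refine cuntzLE_iff.2 fun ε hε => ?_
    set N : ℝ := ‖evenIso H‖ * ‖star (evenIso H)‖ +
      ‖oddIso H‖ * ‖star (oddIso H)‖ + 1 with hN
    have hN0 : 0 < N := by positivity
    obtain ⟨u, hu, w, hw, hus, hws, hub, hwa, hua, hwb⟩ := key (ε / 2 / N) (by positivity)
    refine ⟨(evenIso H) * u + oddIso H * w,
      add_mem (even_mem hu).1 (odd_mem hw).1, ?_⟩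
    have e : (evenIso H * u + oddIso H * w) * (a.sum b).val * star (evenIso H * u + oddIso H * w)
        - (a.oplus b).val = evenIso H * (u * a.val * u - a.val) * star (evenIso H) +
          oddIso H * (w * b.val * w - b.val) * star (oddIso H) := by
      have hau : a.val * w = 0 := by
        have := congrArg star hwa
        rwa [star_mul, star_zero, (IsSelfAdjoint.of_nonneg a.nonneg).star_eq, hws] at this
      have hbu : b.val * u = 0 := by
        have := congrArg star hub
        rwa [star_mul, star_zero, (IsSelfAdjoint.of_nonneg b.nonneg).star_eq, hus] at this
      rw [e1, star_add, star_mul, star_mul, hus, hws]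
      change (evenIso H * u + oddIso H * w) * (a.val + b.val) * (u * star (evenIso H) + w * star (oddIso H))
        - _ = _
      have h1 : (evenIso H * u + oddIso H * w) * (a.val + b.val) =
          evenIso H * (u * a.val) + oddIso H * (w * b.val) := by
        calc _ = evenIso H * (u * a.val) + evenIso H * (u * b.val) + oddIso H * (w * a.val)
              + oddIso H * (w * b.val) := by noncomm_ring
          _ = _ := by rw [hub, hwa]; simp
      rw [h1]
      calc _ = evenIso H * (u * a.val * u - a.val) * star (evenIso H) +
          oddIso H * (w * b.val * w - b.val) * star (oddIso H)
          + evenIso H * u * (a.val * w) * star (oddIso H) + oddIso H * w * (b.val * u) * star (evenIso H) := by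
            noncomm_ring
        _ = _ := by rw [hau, hbu]; simp
    rw [e]
    have n1 : ‖evenIso H * (u * a.val * u - a.val) * star (evenIso H)‖ ≤
        ‖evenIso H‖ * ‖star (evenIso H)‖ * (ε / 2 / N) := by
      calc _ ≤ ‖evenIso H‖ * ‖u * a.val * u - a.val‖
            * ‖star (evenIso H)‖ :=
            (norm_mul_le _ _).trans (by gcongr; exact norm_mul_le _ _)
        _ = ‖evenIso H‖ * ‖star (evenIso H)‖
            * ‖u * a.val * u - a.val‖ := by ring
        _ ≤ _ := by gcongr
    have n2 : ‖oddIso H * (w * b.val * w - b.val) * star (oddIso H)‖ ≤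
        ‖oddIso H‖ * ‖star (oddIso H)‖ * (ε / 2 / N) := by
      calc _ ≤ ‖oddIso H‖ * ‖w * b.val * w - b.val‖
            * ‖star (oddIso H)‖ :=
            (norm_mul_le _ _).trans (by gcongr; exact norm_mul_le _ _)
        _ = ‖oddIso H‖ * ‖star (oddIso H)‖
            * ‖w * b.val * w - b.val‖ := by ring
        _ ≤ _ := by gcongr
    have n3 : N * (ε / 2 / N) = ε / 2 := by field_simp
    have n4 : 0 < ε / 2 / N := by positivity
    have n5 := norm_add_le (evenIso H * (u * a.val * u - a.val) * star (evenIso H))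
      (oddIso H * (w * b.val * w - b.val) * star (oddIso H))
    rw [hN] at n3 n1 n2 n4
    rw [add_mul, add_mul] at n3
    linarith
  · refine cuntzLE_iff.2 fun ε hε => ?_
    obtain ⟨u, hu, w, hw, hus, hws, hub, hwa, hua, hwb⟩ := key (ε / 3) (by positivity)
    refine ⟨u * star (evenIso H) + w * star (oddIso H),
      add_mem (even_mem hu).2 (odd_mem hw).2, ?_⟩
    have e : (u * star (evenIso H) + w * star (oddIso H)) * (a.oplus b).val
        * star (u * star (evenIso H) + w * star (oddIso H)) - (a.sum b).val
        = (u * a.val * u - a.val) + (w * b.val * w - b.val) := by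
      rw [e1, mul_even_odd, star_add, star_mul, star_mul, star_star, star_star, hus, hws]
      have e3 := mul_even_odd (u * a.val) (w * b.val) u w
      simp only [mul_assoc] at e3 ⊢
      rw [e3]
      change _ - (a.val + b.val) = _
      abel
    rw [e]
    linarith [norm_add_le (u * a.val * u - a.val) (w * b.val * w - b.val)]

theorem PosStab.ext {a b : PosStab A} (h : a.val = b.val) : a = b := by
  cases a; cases b; cases h; rfl

theorem even_mul_odd_val (a b : PosStab A) : a.even.val * b.odd.val = 0 := by
  calc _ = evenIso H * a.val * (star (evenIso H) * oddIso H) * b.val * star (oddIso H) := by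
        simp only [PosStab.even, PosStab.odd, mul_assoc]
    _ = 0 := by rw [even_odd]; simp

theorem odd_mul_even_val (a b : PosStab A) : a.odd.val * b.even.val = 0 := by
  calc _ = oddIso H * a.val * (star (oddIso H) * evenIso H) * b.val * star (evenIso H) := by
        simp only [PosStab.even, PosStab.odd, mul_assoc]
    _ = 0 := by rw [odd_even]; simp

theorem cuntz_conj_unit (a b : PosStab A) (s : EllTwo H →L[ℂ] EllTwo H)
    (hs : star s * s = 1) (hm : ∀ x ∈ stab A, s * x ∈ stab A ∧ x * star s ∈ stab A)
    (hb : b.val = s * a.val * star s) : CuntzLE b a ∧ CuntzLE a b := by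
  constructor
  · refine cuntzLE_iff.2 fun ε hε => ?_
    set N : ℝ := ‖s‖ * ‖star s‖ + 1 with hN
    have hN0 : 0 < N := by positivity
    obtain ⟨u, hu, hus, -, hua⟩ := exists_unit a (show 0 < ε / 2 / N by positivity)
    refine ⟨s * u, (hm u hu).1, ?_⟩
    have e : s * u * a.val * star (s * u) - b.val = s * (u * a.val * u - a.val) * star s := by
      rw [hb, star_mul, hus]; noncomm_ring
    rw [e]
    calc _ ≤ ‖s‖ * ‖u * a.val * u - a.val‖ * ‖star s‖ :=
          (norm_mul_le _ _).trans (by gcongr; exact norm_mul_le _ _)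
      _ = ‖s‖ * ‖star s‖ * ‖u * a.val * u - a.val‖ := by ring
      _ ≤ N * (ε / 2 / N) := by gcongr; linarith
      _ = ε / 2 := by field_simp
      _ < ε := by linarith
  · refine cuntzLE_iff.2 fun ε hε => ?_
    obtain ⟨u, hu, hus, -, hua⟩ := exists_unit a (half_pos hε)
    refine ⟨u * star s, (hm u hu).2, ?_⟩
    have e : u * star s * b.val * star (u * star s) - a.val = u * a.val * u - a.val := by
      rw [hb, star_mul, star_star, hus]
      calc _ = u * (star s * s) * a.val * (star s * s) * u - a.val := by noncomm_ring
        _ = _ := by rw [hs]; simp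
    rw [e]
    linarith

theorem Cu.mk_even (a : PosStab A) : Cu.mk a.even = Cu.mk a :=
  have h := cuntz_conj_unit a a.even (evenIso H) even_even (fun _ hx => even_mem hx) rfl
  Cu.mk_eq_mk h.1 h.2

theorem Cu.mk_odd (a : PosStab A) : Cu.mk a.odd = Cu.mk a :=
  have h := cuntz_conj_unit a a.odd (oddIso H) odd_odd (fun _ hx => odd_mem hx) rfl
  Cu.mk_eq_mk h.1 h.2

instance : AddCommMonoid (Cu A) where
  add_assoc x y z := by
    induction x using Cu.ind with | h a => ?_
    induction y using Cu.ind with | h b => ?_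
    induction z using Cu.ind with | h c => ?_
    have e1 : Cu.mk a + Cu.mk b + Cu.mk c =
        Cu.mk ((a.even.even.sum b.odd.even).sum c.odd) := by
      rw [Cu.mk_add_mk a b, Cu.mk_add_mk]
      congr 1
      refine PosStab.ext ?_
      simp only [PosStab.oplus, PosStab.sum, PosStab.even]
      noncomm_ring
    have o1 : (b.odd.even).val * c.odd.val = 0 := even_mul_odd_val _ _
    have o2 : a.even.even.val * (b.odd.even).val = 0 := by
      calc _ = evenIso H * a.even.val * (star (evenIso H) * evenIso H) * b.odd.val * star (evenIso H) := by
            simp only [PosStab.even, mul_assoc]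
        _ = evenIso H * (a.even.val * b.odd.val) * star (evenIso H) := by
            rw [even_even, mul_one]; simp only [mul_assoc]
        _ = 0 := by rw [even_mul_odd_val]; simp
    have o3 : a.even.even.val * c.odd.val = 0 := even_mul_odd_val _ _
    have e2 : Cu.mk a + (Cu.mk b + Cu.mk c) =
        Cu.mk (a.even.even.sum (b.odd.even.sum c.odd)) := by
      rw [← Cu.mk_add_mk_of_mul_eq_zero, ← Cu.mk_add_mk_of_mul_eq_zero o1, Cu.mk_even, Cu.mk_even,
        Cu.mk_even, Cu.mk_odd, Cu.mk_odd]
      change _ * (_ + _) = _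
      rw [mul_add, o2, o3, add_zero]
    rw [e1, e2]
    congr 1
    exact PosStab.ext (add_assoc _ _ _)
  add_comm x y := by
    induction x using Cu.ind with | h a => ?_
    induction y using Cu.ind with | h b => ?_
    rw [Cu.mk_add_mk a b, ← Cu.mk_odd b, ← Cu.mk_even a,
      Cu.mk_add_mk_of_mul_eq_zero (odd_mul_even_val b a)]
    congr 1
    exact PosStab.ext (add_comm _ _)
  zero_add x := by
    induction x using Cu.ind with | h a => ?_
    have h := Cu.mk_add_mk_of_mul_eq_zero
      (a := (⟨0, zero_mem _, le_rfl⟩ : PosStab A)) (b := a) (zero_mul _)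
    refine h.trans ?_
    congr 1
    exact PosStab.ext (zero_add _)
  add_zero x := by
    induction x using Cu.ind with | h a => ?_
    have h := Cu.mk_add_mk_of_mul_eq_zero
      (a := a) (b := (⟨0, zero_mem _, le_rfl⟩ : PosStab A)) (mul_zero _)
    refine h.trans ?_
    congr 1
    exact PosStab.ext (add_zero _)
  nsmul := nsmulRec

instance : IsOrderedAddMonoid (Cu A) where
  add_le_add_left x y h z := by
    induction x using Cu.ind with | h a => ?_
    induction y using Cu.ind with | h b => ?_
    induction z using Cu.ind with | h c => ?_
    exact oplus_mono h (CuntzLE.refl c)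

end Stabilisation

section CategoryCu

/-- Compact containment `x ≪ y`: whenever an increasing sequence has supremum `y`, some term of
the sequence is `≥ x`. -/
def WayBelow {S : Type*} [PartialOrder S] (x y : S) : Prop :=
  ∀ u : ℕ → S, Monotone u → IsLUB (Set.range u) y → ∃ n, x ≤ u n

/-- Morphisms of the category **Cu**: order preserving monoid homomorphisms that preserve suprema
of increasing sequences and compact containment. -/
structure IsCuMorphism {S T : Type*} [PartialOrder S] [AddCommMonoid S]
    [PartialOrder T] [AddCommMonoid T] (φ : S → T) : Prop where
  monotone : Monotone φ
  map_add : ∀ x y, φ (x + y) = φ x + φ y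
  map_zero : φ 0 = 0
  map_sup : ∀ (u : ℕ → S) (x : S), Monotone u → IsLUB (Set.range u) x →
    IsLUB (Set.range fun n => φ (u n)) (φ x)
  map_wayBelow : ∀ x y, WayBelow x y → WayBelow (φ x) (φ y)

end CategoryCu

section Scale

variable {H : Type*} [NormedAddCommGroup H] [InnerProductSpace ℂ H] [CompleteSpace H]

/-- The scale `Σ(Cu(A))`: suprema in `Cu(A)` of increasing sequences of classes of elements of
`A⁺`, where `A` is identified with `A ⊗ e_{00} ⊆ A ⊗ 𝒦`. -/
def scale (A : NonUnitalStarSubalgebra ℂ (H →L[ℂ] H)) : Set (Cu A) :=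
  {x | ∃ a : ℕ → PosStab A,
    (∀ n, ∃ c ∈ A, 0 ≤ c ∧ (a n).val = tensorUnit 0 0 c) ∧
    Monotone (fun n => Cu.mk (a n)) ∧ IsLUB (Set.range fun n => Cu.mk (a n)) x}

variable {A : NonUnitalStarSubalgebra ℂ (H →L[ℂ] H)}

/-- Very rapidly increasing sequences of positive contractions in `A ⊗ 𝒦`. -/
structure VeryRapidlyIncreasing (a : ℕ → PosStab A) : Prop where
  norm_le_one : ∀ n, ‖(a n).val‖ ≤ 1
  wayBelow : ∀ n, WayBelow (Cu.mk (a n)) (Cu.mk (a (n + 1)))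
  almost_unit : ∀ ε > 0, ∀ n, ∃ m₀, ∀ m ≥ m₀, ∃ v ∈ stab A, ‖v‖ ≤ 1 ∧
    ‖(v * (a m).val * star v) * (a n).val - (a n).val‖ < ε

end Scale

end CuntzStab

end

noncomputable section

namespace CuntzStab

/-! ### Factorization of positive elements. -/

section Generic

variable {C : Type*} [CStarAlgebra C]

/-! Norm closeness of the algebras does not carry Cuntz subequivalence across directly, since the
implementing elements have no bounded norm. One relation does cross: for some contraction `v`, the
element `v c v⋆` acts as a unit on `a` up to an error θ (`UnitWithin`). Replacing `a`, `c` and `v`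
by nearby elements of the other algebra adds a fixed multiple of α to the error
(`UnitWithin.transfer`). Inside one algebra the relation yields `(a - t)_+ ≾ (c - s)_+` as soon as
`θ ≤ t (1 - s)` (`UnitWithin.cutDown_cuntzLE`). A very rapidly increasing sequence provides such
relations between its terms with arbitrarily small error, so comparisons between terms pass to the
other algebra at the price of fixed cut-downs. Such cut-downs can be absorbed: for any `l < 1` and
`ε > 0`, `(a_n - ε)_+ ≾ (a_m - l)_+` once `m` is large.

The graph of Φ is `Corresponds`. It is monotone in both variables, hence single-valued
(`Corresponds.le`), and the graphs for the two directions are mutually inverse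
(`Corresponds.inverse`); the latter needs `24α < 1 - 18α`, which is the origin of 1/42. An order
isomorphism preserves zero, suprema and ≪ automatically. Addition is preserved because direct sums
respect every ingredient of the graph, and the scale because approximants of corner elements can be
compressed to the corner.

The order theory of the Cuntz semigroup underneath is built from one device. If `a ≾ b`, a
factorization of polar type (`exists_factorization`) gives a contraction that is isometric on the
range of `(a - ε)_+` and lies in the closed right ideal of `b` (`CuntzLE.exists_isometric`).
Dilating such contractions to isometries turns an increasing sequence into one with increasing right
ideals, and a weighted sum is then its supremum (`exists_sup`); the description of ≪ by cut-downs
(`Cu.wayBelow_mk_iff`) follows. The same contractions produce very rapidly increasing sequences and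
let the unit relation pass to Cuntz smaller elements (`UnitWithin.extend`). -/

theorem star_cfc_real (f : ℝ → ℝ) (a : C) : star (cfc f a) = cfc f a :=
  (cfc_predicate f a : IsSelfAdjoint (cfc f a)).star_eq

theorem cfc_mem_of_map_zero {S : NonUnitalStarSubalgebra ℂ C} (hS : IsClosed (S : Set C)) {a : C}
    (ha : a ∈ S) {f : ℝ → ℝ} (hf : Continuous f) (hf0 : f 0 = 0) : cfc f a ∈ S := by
  rw [← cfcₙ_eq_cfc hf.continuousOn hf0]
  exact cfcₙ_mem (hs := hS) _ ha

variable [PartialOrder C] [StarOrderedRing C]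

theorem cfc_sqrt_mul_cfc_sqrt {e : C} (he : 0 ≤ e) : cfc Real.sqrt e * cfc Real.sqrt e = e := by
  have h : IsSelfAdjoint e := .of_nonneg he
  rw [← cfc_mul _ _ _ (by fun_prop) (by fun_prop)]
  conv_rhs => rw [← cfc_id' ℝ e]
  exact cfc_congr fun t ht => Real.mul_self_sqrt (spectrum_nonneg_of_nonneg he ht)

/-- By the C⋆-identity the square of the norm is `‖f(y) e f(y)‖ ≤ ‖f(y) y f(y)‖`, which is a scalar
estimate on the spectrum of `y`. -/
theorem norm_cfc_mul_sqrt_le {e y : C} (he : 0 ≤ e) (hey : e ≤ y) {f : ℝ → ℝ} (hf : Continuous f)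
    {M : ℝ} (hM : 0 ≤ M) (h : ∀ t, 0 ≤ t → t * f t ^ 2 ≤ M ^ 2) :
    ‖cfc f y * cfc Real.sqrt e‖ ≤ M := by
  have hy : 0 ≤ y := he.trans hey
  have hys : IsSelfAdjoint y := .of_nonneg hy
  refine le_of_sq_le_sq ?_ hM
  have e1 : ‖cfc f y * cfc Real.sqrt e‖ ^ 2 = ‖star (cfc f y) * e * cfc f y‖ := by
    rw [sq, ← CStarRing.norm_self_mul_star]
    conv_rhs => rw [← cfc_sqrt_mul_cfc_sqrt he]
    simp only [star_mul, star_cfc_real, mul_assoc]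
  have e2 : star (cfc f y) * y * cfc f y = cfc (fun t => f t * t * f t) y := by
    rw [star_cfc_real, cfc_mul _ _ _ (by fun_prop) (by fun_prop),
      cfc_mul _ _ _ (by fun_prop) (by fun_prop), cfc_id' ℝ y]
  rw [e1]
  refine (CStarAlgebra.norm_le_norm_of_nonneg_of_le (star_left_conjugate_nonneg he _)
    (star_left_conjugate_le_conjugate hey _)).trans ?_
  rw [e2]
  refine norm_cfc_le (by positivity) fun t ht => ?_
  have ht0 : 0 ≤ t := spectrum_nonneg_of_nonneg hy ht
  rw [Real.norm_of_nonneg (by rw [mul_right_comm]; exact mul_nonneg (mul_self_nonneg _) ht0)]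
  linarith [h t ht0, (by ring : f t * t * f t = t * f t ^ 2)]

/-- If `0 ≤ e ≤ x⋆x` then `e = q⋆q` for a norm limit `q` of elements `x t`. -/
theorem exists_factorization {S : NonUnitalStarSubalgebra ℂ C} (hS : IsClosed (S : Set C))
    {e x : C} (he : 0 ≤ e) (heS : e ∈ S) (hxS : x ∈ S) (hex : e ≤ star x * x) :
    ∃ q ∈ S, star q * q = e ∧ ∃ t : ℕ → C, (∀ n, t n ∈ S) ∧
      Tendsto (fun n => x * t n) atTop (𝓝 q) := by
  set y := star x * x with hy
  have hy0 : 0 ≤ y := he.trans hex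
  have hys : IsSelfAdjoint y := .of_nonneg hy0
  set s := cfc Real.sqrt e with hs
  have hsS : s ∈ S := cfc_mem_of_map_zero hS heS Real.continuous_sqrt Real.sqrt_zero
  have hss : star s = s := star_cfc_real _ _
  let d : ℕ → ℝ := fun n => 1 / ((n : ℝ) + 1)
  have hd : ∀ n, 0 < d n := fun n => Nat.one_div_pos_of_nat
  have hd0 : Tendsto d atTop (𝓝 0) := tendsto_one_div_add_atTop_nhds_zero_nat
  -- If `x = u y^{1/2}` is the polar decomposition, then `x φ_n(y) = u · y/(y + d_n)`. This need not
  -- converge in norm, but it does after multiplication by `e^{1/2}` because `e ≤ y`; the limit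
  -- plays the role of `u e^{1/2}`.
  let φ : ℕ → ℝ → ℝ := fun n t => Real.sqrt t / (|t| + d n)
  have hφ : ∀ n, Continuous (φ n) := fun n =>
    Real.continuous_sqrt.div (continuous_abs.add continuous_const)
      fun t => (add_pos_of_nonneg_of_pos (abs_nonneg t) (hd n)).ne'
  have hsq : ∀ n t, 0 ≤ t → Real.sqrt t * φ n t = t / (t + d n) := by
    intro n t ht
    simp only [φ, abs_of_nonneg ht]
    rw [← mul_div_assoc, Real.mul_self_sqrt ht]
  let t : ℕ → C := fun n => cfc (φ n) y * s
  have htS : ∀ n, t n ∈ S := fun n => mul_mem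
    (cfc_mem_of_map_zero hS (mul_mem (star_mem hxS) hxS) (hφ n) (by simp [φ])) hsS
  have hbound : ∀ N n, N ≤ n → ∀ u, 0 ≤ u →
      u * (Real.sqrt u * (φ N u - φ n u)) ^ 2 ≤ d N := by
    intro N n hNn u hu
    have hdd : d n ≤ d N := Nat.one_div_le_one_div hNn
    have h1 : 0 < u + d n := add_pos_of_nonneg_of_pos hu (hd n)
    have h2 : 0 < u + d N := add_pos_of_nonneg_of_pos hu (hd N)
    rw [mul_sub, hsq N u hu, hsq n u hu]
    have h3 : 0 ≤ u / (u + d n) - u / (u + d N) := by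
      rw [sub_nonneg]; gcongr
    have h4 : u / (u + d n) - u / (u + d N) ≤ d N / (u + d N) := by
      have : u / (u + d n) ≤ 1 := by rw [div_le_one h1]; linarith [hd n]
      have : 1 - u / (u + d N) = d N / (u + d N) := by field_simp; ring
      linarith
    have h5 : (u / (u + d N) - u / (u + d n)) ^ 2 ≤ (d N / (u + d N)) ^ 2 := by
      rw [← neg_sq, neg_sub]
      exact pow_le_pow_left₀ h3 h4 2
    calc _ ≤ u * (d N / (u + d N)) ^ 2 := by gcongr
      _ = d N * ((u / (u + d N)) * (d N / (u + d N))) := by ring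
      _ ≤ d N * (1 * 1) := by
          have := hd N
          gcongr
          · rw [div_le_one h2]; linarith
          · rw [div_le_one h2]; linarith
      _ = d N := by ring
  have hcauchy : CauchySeq fun n => x * t n := by
    refine cauchySeq_of_le_tendsto_0' (fun n => Real.sqrt (d n)) (fun N n hNn => ?_)
      (by simpa [Function.comp_def] using (Real.continuous_sqrt.tendsto 0).comp hd0)
    rw [dist_eq_norm]
    have e1 : x * t N - x * t n = x * (cfc (fun u => φ N u - φ n u) y * s) := by
      rw [cfc_sub _ _ _ (hφ N).continuousOn (hφ n).continuousOn]
      simp only [t]; noncomm_ring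
    -- Since `x⋆x = y`, the factor `x` may be replaced by `y^{1/2}` inside a norm, which leaves a
    -- function of `y` times `e^{1/2}`.
    have e2 : ‖x * (cfc (fun u => φ N u - φ n u) y * s)‖ =
        ‖cfc (fun u => Real.sqrt u * (φ N u - φ n u)) y * s‖ := by
      have h1 : star (x * (cfc (fun u => φ N u - φ n u) y * s)) *
          (x * (cfc (fun u => φ N u - φ n u) y * s)) =
          star (cfc (fun u => Real.sqrt u * (φ N u - φ n u)) y * s) *
          (cfc (fun u => Real.sqrt u * (φ N u - φ n u)) y * s) := by
        rw [cfc_mul Real.sqrt (fun u => φ N u - φ n u) y (by fun_prop)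
          ((hφ N).sub (hφ n)).continuousOn]
        simp only [star_mul, star_cfc_real]
        have h2 : star x * x = cfc Real.sqrt y * cfc Real.sqrt y :=
          (cfc_sqrt_mul_cfc_sqrt hy0).symm
        simp only [mul_assoc]
        rw [← mul_assoc (star x), h2]
        simp only [mul_assoc]
      have h3 := congrArg norm h1
      rw [CStarRing.norm_star_mul_self, CStarRing.norm_star_mul_self] at h3
      exact (mul_self_inj (norm_nonneg _) (norm_nonneg _)).1 h3
    rw [e1, e2]
    refine norm_cfc_mul_sqrt_le he hex (Real.continuous_sqrt.mul ((hφ N).sub (hφ n)))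
      (Real.sqrt_nonneg _) fun u hu => ?_
    rw [Real.sq_sqrt (hd N).le]
    exact hbound N n hNn u hu
  obtain ⟨q, hq⟩ := cauchySeq_tendsto_of_complete hcauchy
  refine ⟨q, hS.mem_of_tendsto hq (.of_forall fun n => mul_mem hxS (htS n)), ?_, t, htS, hq⟩
  have h1 : Tendsto (fun n => star (x * t n) * (x * t n)) atTop (𝓝 (star q * q)) :=
    hq.star.mul hq
  refine tendsto_nhds_unique h1 ?_
  rw [tendsto_iff_norm_sub_tendsto_zero]
  have h2 : Tendsto (fun n => ‖s‖ * Real.sqrt (2 * d n)) atTop (𝓝 0) := by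
    have := ((Real.continuous_sqrt.tendsto _).comp (hd0.const_mul 2)).const_mul ‖s‖
    simpa using this
  refine squeeze_zero (fun _ => norm_nonneg _) (fun n => ?_) h2
  have hχ : Continuous fun u => Real.sqrt u * φ n u * (Real.sqrt u * φ n u) - 1 := by
    have := hφ n
    fun_prop
  have e1 : star (x * t n) * (x * t n) - e =
      s * (cfc (fun u => Real.sqrt u * φ n u * (Real.sqrt u * φ n u) - 1) y * s) := by
    have hc : Continuous fun u => Real.sqrt u * φ n u := Real.continuous_sqrt.mul (hφ n)
    rw [cfc_sub (fun u => Real.sqrt u * φ n u * (Real.sqrt u * φ n u)) (fun _ => 1) y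
      (hc.mul hc).continuousOn (by fun_prop), cfc_const_one ℝ y,
      cfc_mul (fun u => Real.sqrt u * φ n u) (fun u => Real.sqrt u * φ n u) y
      hc.continuousOn hc.continuousOn]
    have hcomm : cfc (fun u => Real.sqrt u * φ n u) y * cfc (fun u => Real.sqrt u * φ n u) y
        = cfc (φ n) y * y * cfc (φ n) y := by
      rw [← cfc_mul (fun u => Real.sqrt u * φ n u) (fun u => Real.sqrt u * φ n u) y
        hc.continuousOn hc.continuousOn]
      conv_rhs => enter [1, 2]; rw [← cfc_id' ℝ y]
      rw [← cfc_mul (φ n) (fun u => u) y (hφ n).continuousOn (by fun_prop),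
        ← cfc_mul (fun u => φ n u * u) (φ n) y ((hφ n).mul continuous_id).continuousOn
          (hφ n).continuousOn]
      refine cfc_congr fun u hu => ?_
      have := Real.mul_self_sqrt (spectrum_nonneg_of_nonneg hy0 hu)
      change _ = φ n u * u * φ n u
      linear_combination φ n u * φ n u * this
    rw [hcomm]
    conv_lhs => enter [2]; rw [← cfc_sqrt_mul_cfc_sqrt he]
    simp only [t, star_mul, hss, star_cfc_real]
    rw [← hs, hy]
    noncomm_ring
  rw [e1]
  refine (norm_mul_le _ _).trans ?_
  gcongr
  refine norm_cfc_mul_sqrt_le he hex hχ (Real.sqrt_nonneg _) fun u hu => ?_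
  rw [Real.sq_sqrt (by have := hd n; positivity), hsq n u hu]
  have h1 : 0 < u + d n := add_pos_of_nonneg_of_pos hu (hd n)
  have := hd n
  have h3 : u / (u + d n) * (u / (u + d n)) - 1 =
      - (d n / (u + d n) * (1 + u / (u + d n))) := by field_simp; ring
  have h4 : 0 ≤ u / (u + d n) := by positivity
  have h5 : u / (u + d n) ≤ 1 := by rw [div_le_one h1]; linarith
  have h6 : 0 ≤ d n / (u + d n) := by positivity
  have h7 : d n / (u + d n) = 1 - u / (u + d n) := by field_simp; ring
  have h8 : u * (d n / (u + d n)) ≤ d n := by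
    calc u * (d n / (u + d n)) = d n * (u / (u + d n)) := by ring
      _ ≤ d n * 1 := by gcongr
      _ = d n := mul_one _
  rw [h3, neg_sq]
  set r := u / (u + d n)
  set w := d n / (u + d n)
  have h9 : w * (1 + r) ^ 2 ≤ 2 := by rw [h7]; nlinarith [mul_nonneg h4 h4]
  calc u * (w * (1 + r)) ^ 2 = (u * w) * (w * (1 + r) ^ 2) := by ring
    _ ≤ d n * 2 := by gcongr
    _ = 2 * d n := by ring

end Generic

/-! ### Closed right ideals. -/

section RightIdeal

variable {C : Type*} [CStarAlgebra C]

/-- The closed right ideal generated by `b`. -/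
def rightIdeal (b : C) : Set C := closure (Set.range (b * ·))

theorem isClosed_rightIdeal (b : C) : IsClosed (rightIdeal b) := isClosed_closure

theorem mul_mem_rightIdeal (b t : C) : b * t ∈ rightIdeal b := subset_closure ⟨t, rfl⟩

theorem self_mem_rightIdeal (b : C) : b ∈ rightIdeal b := by
  simpa using mul_mem_rightIdeal b 1

/-- A continuous linear map carrying `b C` into the closed right ideal of `c` carries the closed
right ideal of `b` there. -/
theorem map_mem_rightIdeal {b c : C} {f : C → C} (hf : Continuous f)
    (h : ∀ t, f (b * t) ∈ rightIdeal c) {p : C} (hp : p ∈ rightIdeal b) : f p ∈ rightIdeal c :=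
  closure_minimal (s := Set.range (b * ·)) (t := f ⁻¹' rightIdeal c)
    (by rintro _ ⟨t, rfl⟩; exact h t) ((isClosed_rightIdeal c).preimage hf) hp

/-- The ideal lives in the ambient unital algebra, so `t` may be any operator, for instance an
isometry or a function of an element that does not vanish at 0. -/
theorem rightIdeal_mul {b p : C} (hp : p ∈ rightIdeal b) (t : C) : p * t ∈ rightIdeal b :=
  map_mem_rightIdeal (f := (· * t)) (continuous_mul_const t)
    (fun u => by rw [mul_assoc]; exact mul_mem_rightIdeal _ _) hp

theorem rightIdeal_trans {b c p : C} (hp : p ∈ rightIdeal b) (hb : b ∈ rightIdeal c) :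
    p ∈ rightIdeal c :=
  map_mem_rightIdeal (f := id) continuous_id (fun t => rightIdeal_mul hb t) hp

theorem rightIdeal_add {b p q : C} (hp : p ∈ rightIdeal b) (hq : q ∈ rightIdeal b) :
    p + q ∈ rightIdeal b := by
  have h : ∀ t, b * t + q ∈ rightIdeal b := fun t =>
    map_mem_rightIdeal (f := fun q => b * t + q) (by fun_prop)
      (fun u => by rw [← mul_add]; exact mul_mem_rightIdeal _ _) hq
  exact map_mem_rightIdeal (f := (· + q)) (by fun_prop) h hp

theorem rightIdeal_smul {b p : C} (hp : p ∈ rightIdeal b) (r : ℝ) : r • p ∈ rightIdeal b := by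
  have := rightIdeal_mul hp (r • (1 : C))
  simpa using this

/-- Used with `b` a cut-down and `w` a function equal to 1 where the cut-down does not vanish. -/
theorem rightIdeal_eq_of_mul_eq {b p w : C} (hp : p ∈ rightIdeal b) (hw : w * b = b) :
    w * p = p := by
  have hc : IsClosed {p : C | w * p = p} := isClosed_eq (by fun_prop) continuous_id
  refine closure_minimal (s := Set.range (b * ·)) ?_ hc hp
  rintro _ ⟨t, rfl⟩
  change w * (b * t) = b * t
  rw [← mul_assoc, hw]

variable [PartialOrder C] [StarOrderedRing C]

/-- Multiplying `b` by the truncated inverse `1 / max(√t, ε/2)` recovers `√t` up to `ε/2`. -/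
theorem sqrt_mem_rightIdeal {b : C} (hb : 0 ≤ b) : cfc Real.sqrt b ∈ rightIdeal b := by
  have hbs : IsSelfAdjoint b := .of_nonneg hb
  refine Metric.mem_closure_iff.2 fun ε hε => ?_
  have hg : Continuous fun t : ℝ => (max (Real.sqrt t) (ε / 2))⁻¹ :=
    (Real.continuous_sqrt.max continuous_const).inv₀
      fun t => (lt_max_of_lt_right (half_pos hε)).ne'
  refine ⟨b * cfc (fun t : ℝ => (max (Real.sqrt t) (ε / 2))⁻¹) b, ⟨_, rfl⟩, ?_⟩
  have e : cfc Real.sqrt b - b * cfc (fun t : ℝ => (max (Real.sqrt t) (ε / 2))⁻¹) b =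
      cfc (fun t : ℝ => Real.sqrt t - t * (max (Real.sqrt t) (ε / 2))⁻¹) b := by
    rw [cfc_sub Real.sqrt (fun t => t * (max (Real.sqrt t) (ε / 2))⁻¹) b (by fun_prop)
        (continuous_id.mul hg).continuousOn,
      cfc_mul (fun t => t) (fun t => (max (Real.sqrt t) (ε / 2))⁻¹) b (by fun_prop)
        hg.continuousOn, cfc_id' ℝ b]
  rw [dist_eq_norm, e]
  refine (norm_cfc_le (half_pos hε).le fun t ht => ?_).trans_lt (half_lt_self hε)
  have ht0 : 0 ≤ t := spectrum_nonneg_of_nonneg hb ht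
  have hs := Real.mul_self_sqrt ht0
  set s := Real.sqrt t
  have hs0 : 0 ≤ s := Real.sqrt_nonneg t
  have hm : 0 < max s (ε / 2) := lt_max_of_lt_right (half_pos hε)
  have h1 : s - t * (max s (ε / 2))⁻¹ = s * ((max s (ε / 2) - s) / max s (ε / 2)) := by
    rw [← hs]; field_simp
  rw [h1]
  rcases le_total s (ε / 2) with h | h
  · rw [max_eq_right h]
    rw [max_eq_right h] at hm
    rw [Real.norm_of_nonneg (by have : 0 ≤ ε / 2 - s := by linarith
                                positivity)]
    calc _ ≤ s * 1 := by gcongr; rw [div_le_one hm]; linarith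
      _ ≤ ε / 2 := by linarith
  · rw [max_eq_left h]; simpa using (half_pos hε).le

end RightIdeal

/-! ### Cuntz comparison, cut-downs and Rørdam's lemma. -/

section Comparison

variable {H : Type*} [NormedAddCommGroup H] [InnerProductSpace ℂ H] [CompleteSpace H]
variable {A : NonUnitalStarSubalgebra ℂ (H →L[ℂ] H)}

theorem PosStab.isSelfAdjoint (a : PosStab A) : IsSelfAdjoint a.val := .of_nonneg a.nonneg

theorem PosStab.star_val (a : PosStab A) : star a.val = a.val := a.isSelfAdjoint.star_eq

theorem cfc_mem_stab {x : EllTwo H →L[ℂ] EllTwo H} (hx : x ∈ stab A) {f : ℝ → ℝ}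
    (hf : Continuous f) (hf0 : f 0 = 0) : cfc f x ∈ stab A :=
  by apply cfc_mem_of_map_zero (C := EllTwo H →L[ℂ] EllTwo H) (S := stab A) isClosed_stab hx hf hf0

/-- Continuous functional calculus with a nonnegative function. -/
def PosStab.fc (a : PosStab A) (f : ℝ → ℝ) (hf : ∀ t, 0 ≤ f t) : PosStab A where
  val := cfcₙ f a.val
  mem := cfcₙ_mem (hs := isClosed_stab) _ a.mem
  nonneg := cfcₙ_nonneg fun _ _ => hf _

theorem PosStab.fc_val (a : PosStab A) {f : ℝ → ℝ} (hf : ∀ t, 0 ≤ f t) (hc : Continuous f)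
    (hf0 : f 0 = 0) : (a.fc f hf).val = cfc f a.val :=
  cfcₙ_eq_cfc hc.continuousOn hf0

theorem PosStab.cutDown_val (a : PosStab A) {ε : ℝ} (hε : 0 ≤ ε) :
    (a.cutDown ε).val = cfc (fun t : ℝ => max 0 (t - ε)) a.val :=
  cfcₙ_eq_cfc (by fun_prop) (by simpa using hε)

/-- The element `v b v⋆`. -/
def PosStab.conj (b : PosStab A) (v : EllTwo H →L[ℂ] EllTwo H) (hv : v ∈ stab A) : PosStab A where
  val := v * b.val * star v
  mem := mul_mem (mul_mem hv b.mem) (star_mem hv)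
  nonneg := star_right_conjugate_nonneg b.nonneg v

theorem CuntzLE.conj (b : PosStab A) {v : EllTwo H →L[ℂ] EllTwo H} (hv : v ∈ stab A) :
    CuntzLE (b.conj v hv) b :=
  ⟨fun _ => v, fun _ => hv, tendsto_const_nhds⟩

theorem CuntzLE.of_forall_close {a b : PosStab A}
    (h : ∀ ε > 0, ∃ a' : PosStab A, CuntzLE a' b ∧ ‖a'.val - a.val‖ < ε) : CuntzLE a b := by
  refine cuntzLE_iff.2 fun ε hε => ?_
  obtain ⟨a', ha', h1⟩ := h (ε / 2) (half_pos hε)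
  obtain ⟨v, hv, h2⟩ := cuntzLE_iff.1 ha' (ε / 2) (half_pos hε)
  refine ⟨v, hv, ?_⟩
  have := norm_add_le (v * b.val * star v - a'.val) (a'.val - a.val)
  rw [sub_add_sub_cancel] at this
  linarith

/-- Factor `a = q⋆q` with `q = lim x t_n` and `x = (K b)^{1/2}`; then `t_n⋆ (K b) t_n → a`, and the
`t_n` lie in the stabilisation. -/
theorem CuntzLE.of_le_smul {a b : PosStab A} {K : ℝ} (hK : 0 ≤ K) (h : a.val ≤ K • b.val) :
    CuntzLE a b := by
  have hxs : star (cfc (fun t => Real.sqrt K * Real.sqrt t) b.val) =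
      cfc (fun t => Real.sqrt K * Real.sqrt t) b.val := star_cfc_real _ _
  have hxm : cfc (fun t => Real.sqrt K * Real.sqrt t) b.val =
      Real.sqrt K • cfc Real.sqrt b.val := cfc_const_mul _ _ _ (by fun_prop)
  have hxx : star (cfc (fun t => Real.sqrt K * Real.sqrt t) b.val) *
      cfc (fun t => Real.sqrt K * Real.sqrt t) b.val = K • b.val := by
    rw [hxs, hxm, smul_mul_smul_comm, cfc_sqrt_mul_cfc_sqrt b.nonneg, Real.mul_self_sqrt hK]
  obtain ⟨q, -, hq, t, ht, hqt⟩ := exists_factorization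
    (C := EllTwo H →L[ℂ] EllTwo H) (S := stab A) isClosed_stab a.nonneg a.mem
    (cfc_mem_stab b.mem (f := fun t => Real.sqrt K * Real.sqrt t) (by fun_prop) (by simp))
    (h.trans_eq hxx.symm)
  refine ⟨fun n => ((Real.sqrt K : ℝ) : ℂ) • star (t n),
    fun n => SMulMemClass.smul_mem _ (star_mem (ht n)), ?_⟩
  rw [← hq]
  refine (hqt.star.mul hqt).congr fun n => ?_
  have e : ((Real.sqrt K : ℝ) : ℂ) * ((Real.sqrt K : ℝ) : ℂ) = ((K : ℝ) : ℂ) := by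
    rw [← Complex.ofReal_mul, Real.mul_self_sqrt hK]
  have e1 : ((Real.sqrt K : ℝ) : ℂ) • star (t n) * b.val * star (((Real.sqrt K : ℝ) : ℂ) • star (t n))
      = ((K : ℝ) : ℂ) • (star (t n) * b.val * t n) := by
    rw [star_smul, star_star, Complex.star_def, Complex.conj_ofReal, smul_mul_assoc,
      smul_mul_smul_comm, e]
  change _ = ((Real.sqrt K : ℝ) : ℂ) • star (t n) * b.val * star (((Real.sqrt K : ℝ) : ℂ) • star (t n))
  rw [e1, star_mul, mul_assoc, ← mul_assoc (star (cfc _ _)), hxx, smul_mul_assoc, mul_smul_comm,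
    Complex.coe_smul, mul_assoc]

theorem CuntzLE.of_le {a b : PosStab A} (h : a.val ≤ b.val) : CuntzLE a b :=
  CuntzLE.of_le_smul zero_le_one (by rwa [one_smul])

theorem PosStab.le_norm_of_mem_spectrum (a : PosStab A) {t : ℝ} (ht : t ∈ spectrum ℝ a.val) :
    t ≤ ‖a.val‖ := by
  refine (Real.le_norm_self t).trans ((spectrum.norm_le_norm_mul_of_mem ht).trans ?_)
  calc _ ≤ ‖a.val‖ * 1 := by gcongr; exact ContinuousLinearMap.norm_id_le
    _ = _ := mul_one _

/-- Comparison of functions of one element reduces to a scalar inequality. Restricting it to `[0,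
‖a‖]` allows an unbounded `f` to be dominated by a bounded `g`. -/
theorem PosStab.fc_cuntzLE_fc_of_le_norm (a : PosStab A) {f g : ℝ → ℝ} (hf : ∀ t, 0 ≤ f t)
    (hg : ∀ t, 0 ≤ g t) (hfc : Continuous f) (hgc : Continuous g) (hf0 : f 0 = 0) (hg0 : g 0 = 0)
    {K : ℝ} (hK : 0 ≤ K) (h : ∀ t, 0 ≤ t → t ≤ ‖a.val‖ → f t ≤ K * g t) :
    CuntzLE (a.fc f hf) (a.fc g hg) := by
  refine CuntzLE.of_le_smul hK ?_
  rw [a.fc_val hf hfc hf0, a.fc_val hg hgc hg0, ← cfc_const_mul K g _ hgc.continuousOn]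
  exact cfc_mono (fun t ht => h t (spectrum_nonneg_of_nonneg a.nonneg ht)
    (a.le_norm_of_mem_spectrum ht)) hfc.continuousOn (by fun_prop)

theorem PosStab.fc_cuntzLE_fc (a : PosStab A) {f g : ℝ → ℝ} (hf : ∀ t, 0 ≤ f t)
    (hg : ∀ t, 0 ≤ g t) (hfc : Continuous f) (hgc : Continuous g) (hf0 : f 0 = 0) (hg0 : g 0 = 0)
    {K : ℝ} (hK : 0 ≤ K) (h : ∀ t, 0 ≤ t → f t ≤ K * g t) :
    CuntzLE (a.fc f hf) (a.fc g hg) :=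
  a.fc_cuntzLE_fc_of_le_norm hf hg hfc hgc hf0 hg0 hK fun t ht _ => h t ht

theorem PosStab.fc_id (a : PosStab A) : a.fc (fun t => |t|) abs_nonneg = a := by
  refine PosStab.ext ?_
  rw [a.fc_val _ continuous_abs abs_zero]
  have := a.isSelfAdjoint
  conv_rhs => rw [← cfc_id' ℝ a.val]
  exact cfc_congr fun t ht => abs_of_nonneg (spectrum_nonneg_of_nonneg a.nonneg ht)

theorem PosStab.cutDown_anti (a : PosStab A) {s t : ℝ} (hs : 0 ≤ s) (hst : s ≤ t) :
    CuntzLE (a.cutDown t) (a.cutDown s) := by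
  refine a.fc_cuntzLE_fc (fun _ => le_max_left _ _) (fun _ => le_max_left _ _) (by fun_prop) (by fun_prop) (by simpa using hs.trans hst)
    (by simpa using hs) zero_le_one fun u _ => ?_
  rw [one_mul]
  gcongr

theorem PosStab.fc_cuntzLE (a : PosStab A) {f : ℝ → ℝ} (hf : ∀ t, 0 ≤ f t) (hfc : Continuous f)
    (hf0 : f 0 = 0) {K : ℝ} (hK : 0 ≤ K) (h : ∀ t, 0 ≤ t → f t ≤ K * t) :
    CuntzLE (a.fc f hf) a := by
  have := a.fc_cuntzLE_fc hf abs_nonneg hfc continuous_abs hf0 abs_zero hK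
    fun t ht => by rw [abs_of_nonneg ht]; exact h t ht
  rwa [a.fc_id] at this

theorem PosStab.cutDown_cuntzLE (a : PosStab A) {t : ℝ} (ht : 0 ≤ t) :
    CuntzLE (a.cutDown t) a := by
  refine a.fc_cuntzLE (fun _ => le_max_left _ _) (by fun_prop) (by simpa using ht) zero_le_one fun u hu => ?_
  rw [one_mul]
  exact max_le hu (by linarith)

theorem PosStab.norm_cutDown_sub_le (a : PosStab A) {t : ℝ} (ht : 0 ≤ t) :
    ‖(a.cutDown t).val - a.val‖ ≤ t := by
  have := a.isSelfAdjoint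
  have e : (a.cutDown t).val - a.val = cfc (fun u => max 0 (u - t) - u) a.val := by
    rw [cfc_sub _ _ _ (by fun_prop) (by fun_prop), cfc_id' ℝ a.val, a.cutDown_val ht]
  rw [e]
  refine norm_cfc_le ht fun u hu => ?_
  have hu0 : 0 ≤ u := spectrum_nonneg_of_nonneg a.nonneg hu
  rw [Real.norm_eq_abs, abs_le]
  rcases le_total 0 (u - t) with h | h
  · rw [max_eq_right h]; constructor <;> linarith
  · rw [max_eq_left h]; constructor <;> linarith

theorem PosStab.norm_cutDown_le (a : PosStab A) {t : ℝ} (ht : 0 ≤ t) :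
    ‖(a.cutDown t).val‖ ≤ ‖a.val‖ := by
  refine CStarAlgebra.norm_le_norm_of_nonneg_of_le (a.cutDown t).nonneg ?_
  have := a.isSelfAdjoint
  conv_rhs => rw [← cfc_id' ℝ a.val]
  rw [a.cutDown_val ht]
  refine cfc_mono (fun u hu => ?_) (by fun_prop) (by fun_prop)
  exact max_le (spectrum_nonneg_of_nonneg a.nonneg hu) (by linarith)

theorem PosStab.cutDown_cutDown (a : PosStab A) {s t : ℝ} (hs : 0 ≤ s) (ht : 0 ≤ t) :
    (a.cutDown s).cutDown t = a.cutDown (s + t) := by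
  refine PosStab.ext ?_
  have := a.isSelfAdjoint
  rw [(a.cutDown s).cutDown_val ht, a.cutDown_val hs, a.cutDown_val (add_nonneg hs ht),
    ← cfc_comp' (fun u => max 0 (u - t)) (fun u => max 0 (u - s)) a.val]
  refine cfc_congr fun u _ => ?_
  change max 0 (max 0 (u - s) - t) = max 0 (u - (s + t))
  rcases le_total 0 (u - s) with h | h
  · rw [max_eq_right h, sub_sub]
  · rw [max_eq_left h, max_eq_left (by linarith), max_eq_left (by linarith)]

theorem PosStab.cutDown_zero (a : PosStab A) : a.cutDown 0 = a := by
  refine PosStab.ext (sub_eq_zero.1 (norm_le_zero_iff.1 ?_))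
  exact a.norm_cutDown_sub_le le_rfl

theorem CuntzLE.of_forall_cutDown {a b : PosStab A} (h : ∀ ε > 0, CuntzLE (a.cutDown ε) b) :
    CuntzLE a b :=
  CuntzLE.of_forall_close fun ε hε => ⟨a.cutDown (ε / 2), h _ (half_pos hε),
    (a.norm_cutDown_sub_le (half_pos hε).le).trans_lt (half_lt_self hε)⟩

/-- The ramp function `0` up to `s`, `1` from `s + d` on. -/
def ramp (s d t : ℝ) : ℝ := min 1 (max 0 (t - s) / d)

theorem continuous_ramp (s d : ℝ) : Continuous (ramp s d) := by
  unfold ramp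
  fun_prop

theorem ramp_nonneg (s : ℝ) {d : ℝ} (hd : 0 < d) (t : ℝ) : 0 ≤ ramp s d t :=
  le_min zero_le_one (div_nonneg (le_max_left _ _) hd.le)

theorem ramp_le_one (s d t : ℝ) : ramp s d t ≤ 1 := min_le_left _ _

theorem ramp_of_le {s t : ℝ} (d : ℝ) (h : t ≤ s) : ramp s d t = 0 := by
  unfold ramp
  rw [max_eq_left (by linarith)]; simp

theorem ramp_of_ge {s d t : ℝ} (hd : 0 < d) (h : s + d ≤ t) : ramp s d t = 1 := by
  unfold ramp
  rw [max_eq_right (by linarith), min_eq_left]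
  rw [one_le_div hd]; linarith

theorem ramp_mul_nonneg (s : ℝ) {d : ℝ} (hd : 0 < d) (t : ℝ) :
    0 ≤ ramp s d t * (t - s) * ramp s d t := by
  rcases le_total t s with h | h
  · rw [ramp_of_le d h]; simp
  · have := ramp_nonneg s hd t
    have : 0 ≤ t - s := by linarith
    positivity

/-- Compressing `x ≤ y + s` by the ramp function of `x`. -/
theorem fc_ramp_le {C : Type*} [CStarAlgebra C] [PartialOrder C] [StarOrderedRing C] {x y : C}
    (hx : IsSelfAdjoint x) {s : ℝ} (d : ℝ) (h : x ≤ y + algebraMap ℝ C s) :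
    cfc (fun t => ramp s d t * (t - s) * ramp s d t) x ≤
      cfc (ramp s d) x * y * cfc (ramp s d) x := by
  have hr := continuous_ramp s d
  have h1 := star_left_conjugate_le_conjugate (sub_le_iff_le_add.2 h) (cfc (ramp s d) x)
  rw [star_cfc_real] at h1
  refine le_trans (le_of_eq ?_) h1
  rw [cfc_mul (fun t => ramp s d t * (t - s)) (ramp s d) x (by fun_prop) (by fun_prop),
    cfc_mul (ramp s d) (fun t => t - s) x (by fun_prop) (by fun_prop),
    cfc_sub (fun t => t) (fun _ => s) x (by fun_prop) (by fun_prop), cfc_id' ℝ x, cfc_const s x]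

/-- Compressing `x - s ≤ y` by a steep ramp of `x` puts an element close to `(x - s)_+` below a
conjugate of `y`. -/
theorem CuntzLE.cutDown_of_le_add {x y : PosStab A} {s : ℝ} (hs : 0 ≤ s)
    (h : x.val ≤ y.val + algebraMap ℝ _ s) : CuntzLE (x.cutDown s) y := by
  refine CuntzLE.of_forall_close fun ε hε => ?_
  have hd := half_pos hε
  have hr := continuous_ramp s (ε / 2)
  have hr0 : ramp s (ε / 2) 0 = 0 := ramp_of_le _ hs
  have hk : cfc (ramp s (ε / 2)) x.val ∈ stab A := cfc_mem_stab x.mem hr hr0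
  have hval := x.fc_val (ramp_mul_nonneg s hd) (by fun_prop) (by rw [hr0]; simp)
  refine ⟨x.fc _ (ramp_mul_nonneg s hd), (CuntzLE.of_le (b := y.conj _ hk) ?_).trans
    (CuntzLE.conj y hk), ?_⟩
  · rw [hval]
    change _ ≤ _ * _ * star _
    rw [star_cfc_real]
    exact fc_ramp_le x.isSelfAdjoint _ h
  · rw [hval, x.cutDown_val hs, ← cfc_sub _ _ _ (by fun_prop) (by fun_prop)]
    refine (norm_cfc_le hd.le fun t _ => ?_).trans_lt (half_lt_self hε)
    rcases le_total t s with h1 | h1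
    · rw [ramp_of_le _ h1, max_eq_left (by linarith)]; simp [hd.le]
    · rw [max_eq_right (by linarith)]
      rcases le_total (s + ε / 2) t with h2 | h2
      · rw [ramp_of_ge hd h2]; simp [hd.le]
      · have h3 := ramp_nonneg s hd t
        have h4 := ramp_le_one s (ε / 2) t
        have h5 : ramp s (ε / 2) t * ramp s (ε / 2) t ≤ 1 := by nlinarith
        have h6 : 0 ≤ t - s := by linarith
        rw [Real.norm_eq_abs, abs_le]
        constructor <;> nlinarith [mul_nonneg h6 (mul_nonneg h3 h3)]

theorem le_add_algebraMap_of_norm_sub_le {C : Type*} [CStarAlgebra C] [PartialOrder C]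
    [StarOrderedRing C] {x y : C} (hx : IsSelfAdjoint x) (hy : IsSelfAdjoint y) {s : ℝ}
    (h : ‖x - y‖ ≤ s) : x ≤ y + algebraMap ℝ C s := by
  have h1 : x - y ≤ algebraMap ℝ C ‖x - y‖ := (hx.sub hy).le_algebraMap_norm_self
  have h2 : algebraMap ℝ C ‖x - y‖ ≤ algebraMap ℝ C s := algebraMap_mono C h
  rw [add_comm]
  exact sub_le_iff_le_add.1 (h1.trans h2)

theorem CuntzLE.cutDown_of_norm_sub_le {x y : PosStab A} {s : ℝ} (h : ‖x.val - y.val‖ ≤ s) :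
    CuntzLE (x.cutDown s) y :=
  CuntzLE.cutDown_of_le_add ((norm_nonneg _).trans h)
    (le_add_algebraMap_of_norm_sub_le x.isSelfAdjoint y.isSelfAdjoint h)

/-- Rørdam's lemma. -/
theorem CuntzLE.exists_cutDown {a b : PosStab A} (h : CuntzLE a b) {ε : ℝ} (hε : 0 < ε) :
    ∃ δ > 0, CuntzLE (a.cutDown ε) (b.cutDown δ) := by
  obtain ⟨v, hv, h1⟩ := cuntzLE_iff.1 h (ε / 2) (half_pos hε)
  have hN : 0 < ‖v‖ * ‖v‖ + 1 := by positivity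
  -- Cutting `b` down by this much moves `v b v⋆` by at most `ε/2`, so it stays within `ε` of `a`.
  have hδ : 0 < ε / 2 / (‖v‖ * ‖v‖ + 1) := by positivity
  refine ⟨_, hδ, ?_⟩
  refine (CuntzLE.cutDown_of_norm_sub_le (y := (b.cutDown _).conj v hv) ?_).trans
    (CuntzLE.conj _ hv)
  set δ := ε / 2 / (‖v‖ * ‖v‖ + 1)
  have h2 := b.norm_cutDown_sub_le hδ.le
  have e : a.val - v * (b.cutDown δ).val * star v =
      -(v * b.val * star v - a.val) - v * ((b.cutDown δ).val - b.val) * star v := by noncomm_ring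
  change ‖a.val - v * (b.cutDown δ).val * star v‖ ≤ ε
  have h3 : ‖v * ((b.cutDown δ).val - b.val) * star v‖ ≤ ε / 2 := by
    calc _ ≤ ‖v‖ * ‖(b.cutDown δ).val - b.val‖ * ‖star v‖ :=
          (norm_mul_le _ _).trans (by gcongr; exact norm_mul_le _ _)
      _ = (‖v‖ * ‖v‖) * ‖(b.cutDown δ).val - b.val‖ := by rw [norm_star]; ring
      _ ≤ (‖v‖ * ‖v‖ + 1) * δ := by gcongr; linarith
      _ = ε / 2 := by simp only [δ]; field_simp
  rw [e]
  have h4 := norm_sub_le (-(v * b.val * star v - a.val)) (v * ((b.cutDown δ).val - b.val) * star v)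
  rw [norm_neg] at h4
  linarith

/-- If `a ≾ b`, there is a contraction `z` in the closed right ideal of `b` which is isometric on
the range of `(a - ε)_+`. -/
theorem CuntzLE.exists_isometric {a b : PosStab A} (h : CuntzLE a b) {ε : ℝ} (hε : 0 < ε) :
    ∃ z ∈ stab A, ‖z‖ ≤ 1 ∧ star z * z * (a.cutDown ε).val = (a.cutDown ε).val ∧
      z ∈ rightIdeal b.val := by
  have ha := a.isSelfAdjoint
  -- Half of `ε` is spent on the approximation `a ≤ v b v⋆ + s`, the other half on the slope of the
  -- ramp.
  obtain ⟨s, hs0, rfl⟩ : ∃ s, 0 < s ∧ s + s = ε := ⟨ε / 2, half_pos hε, add_halves ε⟩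
  obtain ⟨v, hv, h1⟩ := cuntzLE_iff.1 h s hs0
  have hr := continuous_ramp s s
  have hr0 : ramp s s 0 = 0 := ramp_of_le _ hs0.le
  set k := cfc (ramp s s) a.val with hk
  have hkm : k ∈ stab A := cfc_mem_stab a.mem hr hr0
  have hks : star k = k := star_cfc_real _ _
  set f : ℝ → ℝ := fun t => ramp s s t * (t - s) * ramp s s t with hf
  have hfc : Continuous f := by fun_prop
  have hf0 : f 0 = 0 := by simp only [hf]; rw [hr0]; simp
  set e := a.fc f (ramp_mul_nonneg s hs0) with he
  have hev : e.val = cfc f a.val := a.fc_val _ hfc hf0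
  set r := cfc Real.sqrt b.val with hrdef
  have hrs : star r = r := star_cfc_real _ _
  have hrr : r * r = b.val := cfc_sqrt_mul_cfc_sqrt b.nonneg
  have hle : a.val ≤ v * b.val * star v + algebraMap ℝ _ s :=
    le_add_algebraMap_of_norm_sub_le ha (b.conj v hv).isSelfAdjoint
      (by rw [← norm_neg, neg_sub]; exact h1.le)
  -- Here `e = k (a - s) k ≤ k v b v⋆ k`. Writing the right side as `x⋆x` with `x` beginning with
  -- `b^{1/2}` places the factor `q` of `e` in the right ideal of `b`.
  have hle2 : e.val ≤ star (r * star v * k) * (r * star v * k) := by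
    rw [hev]
    refine (fc_ramp_le ha s hle).trans_eq ?_
    rw [← hk]
    simp only [star_mul, star_star, hks, hrs]
    rw [← hrr]; noncomm_ring
  obtain ⟨q, hqm, hqq, t, -, hqt⟩ := exists_factorization
    (C := EllTwo H →L[ℂ] EllTwo H) (S := stab A) isClosed_stab e.nonneg e.mem
    (mul_mem (mul_mem (cfc_mem_stab b.mem Real.continuous_sqrt Real.sqrt_zero) (star_mem hv)) hkm)
    hle2
  -- A normalisation: `g(a) e g(a)` is a function of `a` with values in `[0, 1]` that equals 1 for
  -- `t ≥ 2s`, which makes `z = q g(a)` isometric there.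
  set g : ℝ → ℝ := fun t => ramp s s t * (Real.sqrt (max (t - s) s))⁻¹ with hg
  have hgc : Continuous g := by
    refine hr.mul (Continuous.inv₀ (by fun_prop) fun t => ?_)
    exact (Real.sqrt_pos.2 (lt_max_of_lt_right hs0)).ne'
  have hg0 : g 0 = 0 := by simp [hg, hr0]
  have hgs : star (cfc g a.val) = cfc g a.val := star_cfc_real _ _
  have hzz : star (q * cfc g a.val) * (q * cfc g a.val) =
      cfc (fun t => g t * f t * g t) a.val := by
    rw [cfc_mul (fun t => g t * f t) g a.val (by fun_prop) (by fun_prop),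
      cfc_mul g f a.val (by fun_prop) (by fun_prop), star_mul, hgs, ← hev, ← hqq]
    noncomm_ring
  have hgg : ∀ t, g t * g t = ramp s s t * ramp s s t * (max (t - s) s)⁻¹ := by
    intro t
    have h2 : 0 ≤ max (t - s) s := hs0.le.trans (le_max_right _ _)
    have h3 : (Real.sqrt (max (t - s) s))⁻¹ * (Real.sqrt (max (t - s) s))⁻¹ =
      (max (t - s) s)⁻¹ := by rw [← mul_inv, Real.mul_self_sqrt h2]
    simp only [hg]
    rw [← h3]; ring
  have hpos : ∀ t, 0 ≤ g t * f t * g t := fun t => by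
    rw [mul_right_comm]; exact mul_nonneg (mul_self_nonneg _) (ramp_mul_nonneg s hs0 t)
  refine ⟨q * cfc g a.val, mul_mem hqm (cfc_mem_stab a.mem hgc hg0), ?_, ?_, ?_⟩
  · have h2 : ‖star (q * cfc g a.val) * (q * cfc g a.val)‖ ≤ 1 := by
      rw [hzz]
      refine norm_cfc_le zero_le_one fun t _ => ?_
      rw [Real.norm_of_nonneg (hpos t), mul_right_comm, hgg]
      simp only [hf]
      have h3 := ramp_nonneg s hs0 t
      have h4 := ramp_le_one s s t
      have h5 : 0 < max (t - s) s := lt_max_of_lt_right hs0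
      rcases le_total t s with h6 | h6
      · rw [ramp_of_le _ h6]; simp
      · have h7 : (max (t - s) s)⁻¹ * (t - s) ≤ 1 := by
          rw [inv_mul_le_iff₀ h5, mul_one]; exact le_max_left _ _
        have h8 : 0 ≤ (max (t - s) s)⁻¹ * (t - s) :=
          mul_nonneg (inv_nonneg.2 h5.le) (by linarith)
        calc _ = (ramp s s t) ^ 4 * ((max (t - s) s)⁻¹ * (t - s)) := by ring
          _ ≤ 1 * 1 := by gcongr; exact pow_le_one₀ h3 h4
          _ = 1 := mul_one 1
    rw [CStarRing.norm_star_mul_self] at h2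
    nlinarith [norm_nonneg (q * cfc g a.val)]
  · rw [hzz, a.cutDown_val (by positivity), ← cfc_mul _ _ _ (by fun_prop) (by fun_prop)]
    refine cfc_congr fun t _ => ?_
    change g t * f t * g t * max 0 (t - (s + s)) = max 0 (t - (s + s))
    rcases le_total t (s + s) with h2 | h2
    · rw [max_eq_left (by linarith)]; simp
    · rw [mul_right_comm (g t), hgg]
      simp only [hf]
      rw [ramp_of_ge hs0 h2, max_eq_left (by linarith : s ≤ t - s)]
      have : t - s ≠ 0 := by have : 0 < t - s := by linarith
                             exact this.ne'
      field_simp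
  · refine rightIdeal_mul ?_ _
    refine (isClosed_rightIdeal _).mem_of_tendsto hqt (.of_forall fun n => ?_)
    simp only [mul_assoc]
    exact rightIdeal_mul (sqrt_mem_rightIdeal b.nonneg) _

/-- A positive element of the closed right ideal of `b` is Cuntz subequivalent to `b`. -/
theorem CuntzLE.of_mem_rightIdeal {a b : PosStab A} (h : a.val ∈ rightIdeal b.val) :
    CuntzLE a b := by
  have ha := a.isSelfAdjoint
  have hb := b.isSelfAdjoint
  have hsqv : ∀ c : PosStab A, (c.fc (fun t => t ^ 2) fun t => sq_nonneg t).val = c.val * c.val := by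
    intro c
    have hc := c.isSelfAdjoint
    rw [c.fc_val _ (by fun_prop) (by simp), cfc_pow_id c.val 2, sq]
  -- Passing to `a²= a a⋆` turns approximation of `a` by `b t` into approximation by `b t t⋆ b ≤ ‖t
  -- t⋆‖ b²`.
  have h1 : CuntzLE a (a.fc (fun t => t ^ 2) fun t => sq_nonneg t) := by
    refine CuntzLE.of_forall_cutDown fun ε hε => ?_
    refine a.fc_cuntzLE_fc (fun _ => le_max_left _ _) (fun t => sq_nonneg t) (by fun_prop)
      (by fun_prop) (by simpa using hε.le) (by simp)
      (inv_nonneg.2 hε.le) fun t ht => ?_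
    rw [inv_mul_eq_div, le_div_iff₀ hε]
    rcases le_total t ε with h2 | h2
    · rw [max_eq_left (by linarith)]; simpa using sq_nonneg t
    · rw [max_eq_right (by linarith)]; nlinarith
  refine h1.trans (CuntzLE.of_forall_cutDown fun ε hε => ?_)
  have hcont : Continuous fun x : EllTwo H →L[ℂ] EllTwo H => x * star x := by fun_prop
  have h2 : a.val * star a.val ∈ closure ((fun x => x * star x) '' Set.range (b.val * ·)) :=
    image_closure_subset_closure_image hcont ⟨a.val, h, rfl⟩
  obtain ⟨_, ⟨_, ⟨t, rfl⟩, rfl⟩, h3⟩ := Metric.mem_closure_iff.1 h2 ε hε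
  have h4 : b.val * t * star (b.val * t) ≤ ‖t * star t‖ • (b.val * b.val) := by
    have h5 := CStarAlgebra.star_right_conjugate_le_norm_smul (a := b.val) (b := t * star t)
      (IsSelfAdjoint.mul_star_self t)
    rw [b.star_val] at h5
    refine le_trans (le_of_eq ?_) h5
    rw [star_mul, b.star_val]; noncomm_ring
  have h6 : CuntzLE (b.fc (fun t => t ^ 2) fun t => sq_nonneg t) b := by
    refine CuntzLE.of_le_smul (K := ‖b.val‖) (norm_nonneg _) ?_
    rw [b.fc_val _ (by fun_prop) (by simp), ← cfc_const_mul_id ‖b.val‖ b.val]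
    refine cfc_mono (fun t ht => ?_) (by fun_prop) (by fun_prop)
    have ht0 : 0 ≤ t := spectrum_nonneg_of_nonneg b.nonneg ht
    have := b.le_norm_of_mem_spectrum ht
    nlinarith
  refine CuntzLE.trans ?_ h6
  set K := ‖t * star t‖
  have hKb : CuntzLE ((b.fc (fun t => K * t ^ 2) fun t => by positivity) : PosStab A)
      (b.fc (fun t => t ^ 2) fun t => sq_nonneg t) :=
    b.fc_cuntzLE_fc _ _ (by fun_prop) (by fun_prop) (by simp) (by simp) (norm_nonneg _)
      fun t _ => le_rfl
  refine CuntzLE.trans (CuntzLE.cutDown_of_le_add hε.le ?_) hKb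
  rw [hsqv, b.fc_val _ (by fun_prop) (by simp), cfc_const_mul _ _ _ (by fun_prop),
    cfc_pow_id b.val 2, sq]
  rw [a.star_val, dist_eq_norm] at h3
  refine (le_add_algebraMap_of_norm_sub_le ?_ (IsSelfAdjoint.mul_star_self _) h3.le).trans ?_
  · have := IsSelfAdjoint.mul_star_self a.val
    rwa [a.star_val] at this
  · gcongr

end Comparison

/-! ### Suprema of increasing sequences. -/

section Suprema

variable {H : Type*} [NormedAddCommGroup H] [InnerProductSpace ℂ H] [CompleteSpace H]
variable {A : NonUnitalStarSubalgebra ℂ (H →L[ℂ] H)}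

/-- Rørdam's lemma holds with every smaller δ as well; in filter form, finitely many instances share
one δ. -/
theorem CuntzLE.eventually_cutDown {a b : PosStab A} (h : CuntzLE a b) {ε : ℝ} (hε : 0 < ε) :
    ∀ᶠ δ in 𝓝[>] (0 : ℝ), CuntzLE (a.cutDown ε) (b.cutDown δ) := by
  obtain ⟨δ, hδ, hab⟩ := h.exists_cutDown hε
  filter_upwards [Ioc_mem_nhdsGT hδ] with t ht
  exact hab.trans (b.cutDown_anti ht.1.le ht.2)

theorem cuntzLE_of_le_index {a : ℕ → PosStab A} (h : ∀ n, CuntzLE (a n) (a (n + 1))) {m n : ℕ}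
    (hmn : m ≤ n) : CuntzLE (a m) (a n) :=
  monotone_nat_of_le_succ (f := a) h hmn

/-- Cutting down the terms of an increasing sequence so that it becomes rapidly increasing. -/
theorem exists_cutDown_seq {a : ℕ → PosStab A} (h : ∀ n, CuntzLE (a n) (a (n + 1))) :
    ∃ δ : ℕ → ℝ, (∀ m, 0 < δ m) ∧
      (∀ m, CuntzLE ((a m).cutDown (δ m / 4)) ((a (m + 1)).cutDown (δ (m + 1)))) ∧
      ∀ m, ∀ k ≤ m, CuntzLE ((a k).cutDown (1 / ((m : ℝ) + 1))) ((a m).cutDown (δ m)) := by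
  have hfin : ∀ m : ℕ, ∀ᶠ δ in 𝓝[>] (0 : ℝ), ∀ k ∈ Set.Iic m,
      CuntzLE ((a k).cutDown (1 / ((m : ℝ) + 1))) ((a m).cutDown δ) := fun m =>
    (eventually_all_finite (Set.finite_Iic m)).2 fun k hk =>
      (cuntzLE_of_le_index h hk).eventually_cutDown Nat.one_div_pos_of_nat
  obtain ⟨d, hd, hd0⟩ := ((hfin 0).and self_mem_nhdsWithin).exists
  -- The next δ is chosen against `δ_m / 4` rather than `δ_m`: the interval from `δ_m / 4` to `δ_m`
  -- leaves room for later functional calculus.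
  have step : ∀ (m : ℕ) (d : {d : ℝ // 0 < d}), ∃ d' : {d : ℝ // 0 < d},
      CuntzLE ((a m).cutDown (d.1 / 4)) ((a (m + 1)).cutDown d'.1) ∧
      ∀ k ∈ Set.Iic (m + 1),
        CuntzLE ((a k).cutDown (1 / (((m + 1 : ℕ) : ℝ) + 1))) ((a (m + 1)).cutDown d'.1) := by
    intro m d
    have hd4 : 0 < d.1 / 4 := by have := d.2; positivity
    obtain ⟨d', ⟨h1, h2⟩, h3⟩ := ((((h m).eventually_cutDown hd4).and (hfin (m + 1))).and
      self_mem_nhdsWithin).exists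
    exact ⟨⟨d', h3⟩, h1, h2⟩
  choose F hF using step
  let δ : ℕ → {d : ℝ // 0 < d} := fun n => Nat.rec ⟨d, hd0⟩ F n
  refine ⟨fun n => (δ n).1, fun n => (δ n).2, fun m => (hF m (δ m)).1, fun m k hk => ?_⟩
  cases m with
  | zero => exact hd k hk
  | succ m => exact (hF m (δ m)).2 k hk

variable (H) in
/-- The isometry of `H ⊗ ℓ²(ℕ)` onto the `k`-th of infinitely many infinite blocks of
coordinates. -/
def blockIso (k : ℕ) : EllTwo H →L[ℂ] EllTwo H :=
  spread (fun n => Nat.pair k n) fun _ _ h => (Nat.pair_eq_pair.1 h).2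

theorem star_blockIso_mul_self (k : ℕ) : star (blockIso H k) * blockIso H k = 1 :=
  star_spread_mul_self _ _

theorem star_blockIso_mul {j k : ℕ} (h : j ≠ k) : star (blockIso H j) * blockIso H k = 0 :=
  star_spread_mul_spread _ _ fun _ _ e => h (Nat.pair_eq_pair.1 e).1

/-- `(1 - z z⋆)^{1/2}` for a contraction `z`. -/
theorem exists_defect {z : EllTwo H →L[ℂ] EllTwo H} (hz : z ∈ stab A) (hz1 : ‖z‖ ≤ 1) :
    ∃ d : EllTwo H →L[ℂ] EllTwo H, star d = d ∧ d * d = 1 - z * star z ∧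
      ∀ x ∈ stab A, d * x ∈ stab A := by
  have hw : IsSelfAdjoint (z * star z) := IsSelfAdjoint.mul_star_self z
  have hw1 : ‖z * star z‖ ≤ 1 := by
    rw [CStarRing.norm_self_mul_star]
    nlinarith [norm_nonneg z]
  have hle : z * star z ≤ 1 :=
    (CStarAlgebra.norm_le_one_iff_of_nonneg _ (mul_star_self_nonneg z)).1 hw1
  refine ⟨cfc (fun t : ℝ => Real.sqrt (1 - t)) (z * star z), star_cfc_real _ _, ?_, ?_⟩
  · rw [← cfc_mul _ _ _ (by fun_prop) (by fun_prop)]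
    have e : (1 : EllTwo H →L[ℂ] EllTwo H) - z * star z =
        cfc (fun t : ℝ => 1 - t) (z * star z) := by
      rw [cfc_sub (fun _ => 1) (fun t => t) _ (by fun_prop) (by fun_prop), cfc_const_one ℝ _,
        cfc_id' ℝ _]
    rw [e]
    refine cfc_congr fun t ht => Real.mul_self_sqrt ?_
    have h2 : (0 : EllTwo H →L[ℂ] EllTwo H) ≤ cfc (fun t : ℝ => 1 - t) (z * star z) := by
      rw [← e]; exact sub_nonneg.2 hle
    exact (cfc_nonneg_iff _ _ (by fun_prop)).1 h2 t ht
  · intro x hx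
    -- The function `√(1 - t) - 1` vanishes at 0, so the defect differs from 1 by an element of the
    -- stabilisation and is a multiplier of it.
    have e : cfc (fun t : ℝ => Real.sqrt (1 - t)) (z * star z) =
        1 + cfc (fun t : ℝ => Real.sqrt (1 - t) - 1) (z * star z) := by
      rw [cfc_sub _ (fun _ => 1) _ (by fun_prop) (by fun_prop), cfc_const_one ℝ _]
      abel
    rw [e, add_mul, one_mul]
    exact add_mem hx (mul_mem (cfc_mem_stab (mul_mem hz (star_mem hz)) (by fun_prop) (by simp)) hx)

/-- `V` is an isometric multiplier of `A ⊗ 𝒦` with range orthogonal to the blocks beyond `n`. -/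
structure IsBlockIsometry (A : NonUnitalStarSubalgebra ℂ (H →L[ℂ] H)) (n : ℕ)
    (V : EllTwo H →L[ℂ] EllTwo H) : Prop where
  star_mul_self : star V * V = 1
  mul_mem : ∀ x ∈ stab A, V * x ∈ stab A
  star_mul_block : ∀ k, n < k → star V * blockIso H k = 0

theorem IsBlockIsometry.mul_star_mem {n : ℕ} {V : EllTwo H →L[ℂ] EllTwo H}
    (hV : IsBlockIsometry A n V) {x : EllTwo H →L[ℂ] EllTwo H} (hx : x ∈ stab A) :
    x * star V ∈ stab A := by
  have := star_mem (hV.mul_mem _ (star_mem hx))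
  rwa [star_mul, star_star] at this

theorem IsBlockIsometry.zero : IsBlockIsometry A 0 (blockIso H 0) where
  star_mul_self := star_blockIso_mul_self 0
  mul_mem _ hx := (spread_mem _ _ hx).1
  star_mul_block _ hk := star_blockIso_mul hk.ne

/-- Dilating a contraction `z` to pass from `V` to an isometry `W` with `W z = V` where `z` is
isometric. -/
theorem IsBlockIsometry.exists_succ {n : ℕ} {V : EllTwo H →L[ℂ] EllTwo H}
    (hV : IsBlockIsometry A n V) {z : EllTwo H →L[ℂ] EllTwo H} (hz : z ∈ stab A) (hz1 : ‖z‖ ≤ 1) :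
    ∃ W, IsBlockIsometry A (n + 1) W ∧ ∀ c, star z * z * c = c → W * z * c = V * c := by
  obtain ⟨d, hds, hdd, hdm⟩ := exists_defect hz hz1
  set S := blockIso H (n + 1)
  have hVS : star V * S = 0 := hV.star_mul_block _ (Nat.lt_succ_self n)
  have hSV : star S * V = 0 := by
    have := congrArg star hVS
    rwa [star_mul, star_star, star_zero] at this
  have hSS : star S * S = 1 := star_blockIso_mul_self _
  have hW : star (V * star z + S * d) = z * star V + d * star S := by
    rw [star_add, star_mul, star_mul, star_star, hds]
  -- The ranges of `V` and of the unused block isometry `S` are orthogonal, so `W⋆W = z z⋆ + d² =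
  -- 1`.
  refine ⟨V * star z + S * d, ⟨?_, ?_, ?_⟩, ?_⟩
  · rw [hW]
    calc (z * star V + d * star S) * (V * star z + S * d)
        = z * (star V * V) * star z + z * (star V * S) * d + d * (star S * V) * star z
          + d * (star S * S) * d := by noncomm_ring
      _ = 1 := by
        rw [hV.star_mul_self, hVS, hSV, hSS, mul_one, mul_one, hdd]; simp
  · intro x hx
    rw [add_mul, mul_assoc, mul_assoc]
    exact add_mem (hV.mul_mem _ (mul_mem_stab (star_mem hz) hx)) (spread_mem _ _ (hdm x hx)).1
  · intro k hk
    rw [hW, add_mul, mul_assoc, mul_assoc, hV.star_mul_block k (by omega),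
      star_blockIso_mul (by omega)]
    simp
  · intro c hc
    -- Where `z` is isometric the defect term vanishes: `(d z c)⋆ (d z c) = c⋆ z⋆ (1 - z z⋆) z c`.
    have h0 : d * z * c = 0 := by
      rw [← CStarRing.star_mul_self_eq_zero_iff, star_mul, star_mul, hds]
      calc star c * (star z * d) * (d * z * c) = star c * star z * (d * d) * z * c := by
            noncomm_ring
        _ = star c * (star z * z * c) - star c * (star z * z * (star z * z * c)) := by
            rw [hdd]; noncomm_ring
        _ = 0 := by rw [hc, hc, sub_self]
    calc (V * star z + S * d) * z * c = V * (star z * z * c) + S * (d * z * c) := by noncomm_ring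
      _ = V * c := by rw [hc, h0, mul_zero, add_zero]

theorem real_smul_mem_stab {x : EllTwo H →L[ℂ] EllTwo H} (hx : x ∈ stab A) (r : ℝ) :
    r • x ∈ stab A := by
  rw [← Complex.coe_smul]
  exact SMulMemClass.smul_mem _ hx

/-- Realising a sequence with isometric embeddings `z n` by an increasing sequence of hereditary
subalgebras. -/
theorem exists_nested {c : ℕ → PosStab A} {z : ℕ → EllTwo H →L[ℂ] EllTwo H}
    (hz : ∀ n, z n ∈ stab A) (hz1 : ∀ n, ‖z n‖ ≤ 1)
    (hzc : ∀ n, star (z n) * z n * (c n).val = (c n).val)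
    (hzr : ∀ n, z n ∈ rightIdeal (c (n + 1)).val) :
    ∃ s : ℕ → PosStab A, (∀ n, CuntzLE (s n) (c n) ∧ CuntzLE (c n) (s n)) ∧
      ∀ n, (s n).val ∈ rightIdeal (s (n + 1)).val := by
  have step : ∀ (n : ℕ) (V : {V // IsBlockIsometry A n V}),
      ∃ W : {V // IsBlockIsometry A (n + 1) V},
        ∀ c, star (z n) * z n * c = c → W.1 * z n * c = V.1 * c := fun n V => by
    obtain ⟨W, hW, h⟩ := V.2.exists_succ (hz n) (hz1 n)
    exact ⟨⟨W, hW⟩, h⟩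
  choose F hF using step
  let V : ∀ n, {V // IsBlockIsometry A n V} := fun n => Nat.rec ⟨_, IsBlockIsometry.zero⟩ F n
  let s : ℕ → PosStab A := fun n =>
    ⟨(V n).1 * (c n).val * star (V n).1, (V n).2.mul_star_mem ((V n).2.mul_mem _ (c n).mem),
      star_right_conjugate_nonneg (c n).nonneg _⟩
  refine ⟨s, fun n => cuntz_conj_unit (c n) (s n) (V n).1 (V n).2.star_mul_self
    (fun x hx => ⟨(V n).2.mul_mem x hx, (V n).2.mul_star_mem hx⟩) rfl, fun n => ?_⟩
  -- Compatibility of consecutive isometries exhibits `s_n` as `V_{n+1} z_n` times something, and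
  -- `z_n` lies in the right ideal of `c_{n+1}`.
  have h1 : (V (n + 1)).1 * z n * (c n).val = (V n).1 * (c n).val := hF n (V n) _ (hzc n)
  have h2 : (s n).val = (V (n + 1)).1 * z n * ((c n).val * star (V n).1) := by
    rw [← mul_assoc, h1]
  rw [h2]
  refine map_mem_rightIdeal (f := fun p => (V (n + 1)).1 * p * ((c n).val * star (V n).1))
    (by fun_prop) (fun t => ?_) (hzr n)
  have h3 : (V (n + 1)).1 * ((c (n + 1)).val * t) * ((c n).val * star (V n).1) =
      (s (n + 1)).val * ((V (n + 1)).1 * t * ((c n).val * star (V n).1)) := by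
    calc _ = (V (n + 1)).1 * (c (n + 1)).val * 1 * t * ((c n).val * star (V n).1) := by
          simp only [mul_assoc, one_mul]
      _ = _ := by
          rw [← (V (n + 1)).2.star_mul_self]
          simp only [s, mul_assoc]
  rw [h3]
  exact mul_mem_rightIdeal _ _

/-- A sequence of positive elements generating increasing right ideals has a supremum. -/
theorem exists_sup_of_nested {s : ℕ → PosStab A}
    (hs : ∀ n, (s n).val ∈ rightIdeal (s (n + 1)).val) :
    ∃ x : PosStab A, (∀ n, CuntzLE (s n) x) ∧ ∀ ε > 0, ∃ n, CuntzLE (x.cutDown ε) (s n) := by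
  have hmem : ∀ k n, k ≤ n → (s k).val ∈ rightIdeal (s n).val := by
    intro k n hkn
    induction n, hkn using Nat.le_induction with
    | base => exact self_mem_rightIdeal _
    | succ n _ ih => exact rightIdeal_trans ih (hs n)
  -- The weights make the series converge in norm. Every `s_n` is dominated by a multiple of the
  -- sum, and partial sums up to `N` remain in the right ideal of `s_N`.
  let l : ℕ → ℝ := fun n => (1 / 2) ^ n / (‖(s n).val‖ + 1)
  have hl : ∀ n, 0 < l n := fun n => by positivity
  have hsum : Summable fun n => l n • (s n).val := by
    refine Summable.of_norm_bounded (g := fun n : ℕ => (1 / 2 : ℝ) ^ n) summable_geometric_two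
      fun n => ?_
    rw [norm_smul, Real.norm_of_nonneg (hl n).le]
    simp only [l]
    rw [div_mul_eq_mul_div, div_le_iff₀ (by positivity)]
    gcongr
    linarith
  have hmem1 : ∀ n, l n • (s n).val ∈ stab A := fun n => real_smul_mem_stab (s n).mem _
  have hpos1 : ∀ n, 0 ≤ l n • (s n).val := fun n => smul_nonneg (hl n).le (s n).nonneg
  let p : ℕ → PosStab A := fun N => ⟨∑ n ∈ Finset.range N, l n • (s n).val,
    sum_mem fun n _ => hmem1 n, Finset.sum_nonneg fun n _ => hpos1 n⟩
  have htend : Tendsto (fun N => (p N).val) atTop (𝓝 (∑' n, l n • (s n).val)) :=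
    hsum.hasSum.tendsto_sum_nat
  let x : PosStab A := ⟨∑' n, l n • (s n).val,
    isClosed_stab.mem_of_tendsto htend (.of_forall fun N => (p N).mem),
    (CStarAlgebra.isClosed_nonneg (A := EllTwo H →L[ℂ] EllTwo H)).mem_of_tendsto htend
      (.of_forall fun N => (p N).nonneg)⟩
  refine ⟨x, fun n => ?_, fun ε hε => ?_⟩
  · refine CuntzLE.of_le_smul (K := (l n)⁻¹) (inv_nonneg.2 (hl n).le) ?_
    have hle : l n • (s n).val ≤ x.val := by
      rw [← sub_nonneg]
      refine (CStarAlgebra.isClosed_nonneg (A := EllTwo H →L[ℂ] EllTwo H)).mem_of_tendsto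
        (htend.sub_const _) (eventually_atTop.2 ⟨n + 1, fun N hN => ?_⟩)
      exact sub_nonneg.2 (Finset.single_le_sum (f := fun n => l n • (s n).val)
        (fun i _ => hpos1 i) (Finset.mem_range.2 (by omega)))
    have := smul_le_smul_of_nonneg_left hle (inv_nonneg.2 (hl n).le)
    rwa [inv_smul_smul₀ (hl n).ne'] at this
  · obtain ⟨N, hN⟩ := (Metric.tendsto_atTop.1 htend) ε hε
    refine ⟨N, ?_⟩
    have h1 : CuntzLE (x.cutDown ε) (p N) := by
      refine CuntzLE.cutDown_of_norm_sub_le ?_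
      rw [← dist_eq_norm, dist_comm]
      exact (hN N le_rfl).le
    refine h1.trans (CuntzLE.of_mem_rightIdeal ?_)
    have h2 : ∀ M ≤ N, ∑ n ∈ Finset.range M, l n • (s n).val ∈ rightIdeal (s N).val := by
      intro M hM
      induction M with
      | zero => simpa using mul_mem_rightIdeal (s N).val 0
      | succ M ih =>
        rw [Finset.sum_range_succ]
        exact rightIdeal_add (ih (by omega)) (rightIdeal_smul (hmem M N (by omega)) _)
    exact h2 N le_rfl

/-- Increasing sequences have suprema in the Cuntz semigroup. -/
theorem exists_sup {a : ℕ → PosStab A} (h : ∀ n, CuntzLE (a n) (a (n + 1))) :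
    ∃ x : PosStab A, (∀ n, CuntzLE (a n) x) ∧ ∀ ε > 0, ∃ n, CuntzLE (x.cutDown ε) (a n) := by
  obtain ⟨δ, hδ, hδ1, hδ2⟩ := exists_cutDown_seq h
  have hz : ∀ n, ∃ z ∈ stab A, ‖z‖ ≤ 1 ∧
      star z * z * ((a n).cutDown (δ n)).val = ((a n).cutDown (δ n)).val ∧
      z ∈ rightIdeal ((a (n + 1)).cutDown (δ (n + 1))).val := by
    intro n
    have hn := hδ n
    -- A further cut-down by `3δ_n/4` after `δ_n/4` is exactly the cut-down by `δ_n`, so `z_n` is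
    -- isometric on the term being embedded.
    obtain ⟨z, h1, h2, h3, h4⟩ := (hδ1 n).exists_isometric (ε := 3 * δ n / 4) (by positivity)
    rw [PosStab.cutDown_cutDown _ (by positivity) (by positivity),
      show δ n / 4 + 3 * δ n / 4 = δ n by ring] at h3
    exact ⟨z, h1, h2, h3, h4⟩
  choose z hz hz1 hzc hzr using hz
  obtain ⟨s, hsc, hs⟩ := exists_nested hz hz1 hzc hzr
  obtain ⟨x, hx, hx'⟩ := exists_sup_of_nested hs
  refine ⟨x, fun n => CuntzLE.of_forall_cutDown fun ε hε => ?_, fun ε hε => ?_⟩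
  · obtain ⟨m, hm⟩ := exists_nat_one_div_lt hε
    have hm' : 1 / (((max m n : ℕ) : ℝ) + 1) ≤ ε :=
      (Nat.one_div_le_one_div (le_max_left m n)).trans hm.le
    exact ((((a n).cutDown_anti Nat.one_div_pos_of_nat.le hm').trans
      (hδ2 (max m n) n (le_max_right _ _))).trans (hsc _).2).trans (hx _)
  · obtain ⟨n, hn⟩ := hx' ε hε
    exact ⟨n, (hn.trans (hsc n).1).trans ((a n).cutDown_cuntzLE (hδ n).le)⟩

end Suprema

/-! ### Suprema and compact containment in the Cuntz semigroup. -/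

section Cu

variable {H : Type*} [NormedAddCommGroup H] [InnerProductSpace ℂ H] [CompleteSpace H]
variable {A : NonUnitalStarSubalgebra ℂ (H →L[ℂ] H)}

theorem Cu.exists_mk_eq (x : Cu A) : ∃ a, Cu.mk a = x :=
  Cu.ind (p := fun x => ∃ a, Cu.mk a = x) (fun a => ⟨a, rfl⟩) x

/-- An upper bound of the `a_n` dominates every cut-down of `x`, hence `x` itself. -/
theorem Cu.isLUB_of_cutDown {ι : Type*} {a : ι → PosStab A} {x : PosStab A}
    (h1 : ∀ n, CuntzLE (a n) x) (h2 : ∀ ε > 0, ∃ n, CuntzLE (x.cutDown ε) (a n)) :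
    IsLUB (Set.range fun n => Cu.mk (a n)) (Cu.mk x) := by
  refine ⟨by rintro _ ⟨n, rfl⟩; exact h1 n, fun u hu => ?_⟩
  obtain ⟨b, rfl⟩ := u.exists_mk_eq
  refine CuntzLE.of_forall_cutDown fun ε hε => ?_
  obtain ⟨n, hn⟩ := h2 ε hε
  exact hn.trans (Cu.mk_le_mk.1 (hu ⟨n, rfl⟩))

theorem Cu.exists_isLUB {u : ℕ → Cu A} (hu : Monotone u) : ∃ x, IsLUB (Set.range u) x := by
  choose a ha using fun n => (u n).exists_mk_eq
  obtain ⟨x, h1, h2⟩ := exists_sup (a := a) fun n => by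
    rw [← Cu.mk_le_mk, ha, ha]; exact hu n.le_succ
  have := Cu.isLUB_of_cutDown h1 h2
  simp only [ha] at this
  exact ⟨_, this⟩

/-- If `⟨b⟩` is the supremum of an increasing sequence, its cut-downs lie below terms of the
sequence. -/
theorem Cu.cutDown_le_of_isLUB {a : ℕ → PosStab A} (ha : Monotone fun n => Cu.mk (a n))
    {b : PosStab A} (hb : IsLUB (Set.range fun n => Cu.mk (a n)) (Cu.mk b)) {ε : ℝ} (hε : 0 < ε) :
    ∃ n, CuntzLE (b.cutDown ε) (a n) := by
  obtain ⟨x, h1, h2⟩ := exists_sup (a := a) fun n => ha n.le_succ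
  have hbx : CuntzLE b x := Cu.mk_le_mk.1 (hb.unique (Cu.isLUB_of_cutDown h1 h2)).le
  obtain ⟨δ, hδ, h3⟩ := hbx.exists_cutDown hε
  obtain ⟨n, hn⟩ := h2 δ hδ
  exact ⟨n, h3.trans hn⟩

/-- One direction tests against the sequence `⟨(b - 1/(n+1))_+⟩`, whose supremum is `⟨b⟩`; the other
holds because cut-downs of a supremum lie below terms of the sequence. -/
theorem Cu.wayBelow_mk_iff {a b : PosStab A} :
    WayBelow (Cu.mk a) (Cu.mk b) ↔ ∃ ε > 0, CuntzLE a (b.cutDown ε) := by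
  constructor
  · intro h
    obtain ⟨n, hn⟩ := h (fun n : ℕ => Cu.mk (b.cutDown (1 / ((n : ℝ) + 1))))
      (fun m n hmn => b.cutDown_anti Nat.one_div_pos_of_nat.le (Nat.one_div_le_one_div hmn))
      (Cu.isLUB_of_cutDown (fun n => b.cutDown_cuntzLE Nat.one_div_pos_of_nat.le)
        fun ε hε => by
          obtain ⟨m, hm⟩ := exists_nat_one_div_lt hε
          exact ⟨m, b.cutDown_anti Nat.one_div_pos_of_nat.le hm.le⟩)
    exact ⟨_, Nat.one_div_pos_of_nat, hn⟩
  · rintro ⟨ε, hε, h⟩ u hu hub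
    choose c hc using fun n => (u n).exists_mk_eq
    obtain rfl : (fun n => Cu.mk (c n)) = u := funext hc
    obtain ⟨n, hn⟩ := Cu.cutDown_le_of_isLUB hu hub hε
    exact ⟨n, h.trans hn⟩

theorem Cu.le_of_wayBelow {x y : Cu A} (h : WayBelow x y) : x ≤ y := by
  obtain ⟨n, hn⟩ := h (fun _ => y) monotone_const (by simp [isLUB_singleton])
  exact hn

theorem Cu.wayBelow_of_le {x y z : Cu A} (h : WayBelow x y) (hyz : y ≤ z) : WayBelow x z := by
  obtain ⟨a, rfl⟩ := x.exists_mk_eq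
  obtain ⟨b, rfl⟩ := y.exists_mk_eq
  obtain ⟨c, rfl⟩ := z.exists_mk_eq
  obtain ⟨ε, hε, h1⟩ := Cu.wayBelow_mk_iff.1 h
  obtain ⟨δ, hδ, h2⟩ := CuntzLE.exists_cutDown (Cu.mk_le_mk.1 hyz) (half_pos hε)
  have hlt : WayBelow (Cu.mk a) (Cu.mk (b.cutDown (ε / 2))) := by
    refine Cu.wayBelow_mk_iff.2 ⟨ε / 2, half_pos hε, ?_⟩
    rwa [b.cutDown_cutDown (half_pos hε).le (half_pos hε).le, add_halves]
  exact Cu.wayBelow_mk_iff.2 ⟨δ, hδ, CuntzLE.trans (Cu.mk_le_mk.1 (Cu.le_of_wayBelow hlt)) h2⟩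

end Cu

/-! ### The approximate unit relation and very rapidly increasing sequences. -/

section ApproximateUnits

/-- Positivity of `w` makes `1 - w` a contraction; the resulting constant 1, instead of 2, enters
the numerical bounds on α. -/
theorem norm_mul_sub_self_le {C : Type*} [CStarAlgebra C] [PartialOrder C] [StarOrderedRing C]
    {w : C} (hw : 0 ≤ w) (hw1 : ‖w‖ ≤ 1) (x : C) : ‖w * x - x‖ ≤ ‖x‖ := by
  have h1 : w ≤ 1 := (CStarAlgebra.norm_le_one_iff_of_nonneg w hw).1 hw1
  have h2 : ‖1 - w‖ ≤ 1 := (CStarAlgebra.norm_le_one_iff_of_nonneg _ (sub_nonneg.2 h1)).2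
    (sub_le_self _ hw)
  have e : w * x - x = -((1 - w) * x) := by noncomm_ring
  rw [e, norm_neg]
  calc _ ≤ ‖1 - w‖ * ‖x‖ := norm_mul_le _ _
    _ ≤ 1 * ‖x‖ := by gcongr
    _ = _ := one_mul _

theorem norm_conj_le {C : Type*} [CStarAlgebra C] {v : C} (hv : ‖v‖ ≤ 1) (x : C) :
    ‖v * x * star v‖ ≤ ‖x‖ := by
  calc _ ≤ ‖v‖ * ‖x‖ * ‖star v‖ := (norm_mul_le _ _).trans (by gcongr; exact norm_mul_le _ _)
    _ ≤ 1 * ‖x‖ * 1 := by rw [norm_star]; gcongr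
    _ = _ := by ring

variable {H : Type*} [NormedAddCommGroup H] [InnerProductSpace ℂ H] [CompleteSpace H]
variable {A B : NonUnitalStarSubalgebra ℂ (H →L[ℂ] H)}

/-- `v c v⋆` acts as a unit for `a` up to `θ`, for some contraction `v`. -/
def UnitWithin (a c : PosStab A) (θ : ℝ) : Prop :=
  ∃ v ∈ stab A, ‖v‖ ≤ 1 ∧ ‖(v * c.val * star v) * a.val - a.val‖ < θ

theorem UnitWithin.mono {a c : PosStab A} {θ θ' : ℝ} (h : UnitWithin a c θ) (hθ : θ ≤ θ') :
    UnitWithin a c θ' := by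
  obtain ⟨v, hv, hv1, h⟩ := h
  exact ⟨v, hv, hv1, h.trans_le hθ⟩

theorem CuntzLE.exists_almost_isometric {a b : PosStab A} (h : CuntzLE a b) {ε : ℝ} (hε : 0 < ε) :
    ∃ z ∈ stab A, ‖z‖ ≤ 1 ∧ ‖star z * z * a.val - a.val‖ ≤ ε ∧ z ∈ rightIdeal b.val := by
  obtain ⟨z, hz, hz1, hza, hzb⟩ := h.exists_isometric hε
  refine ⟨z, hz, hz1, ?_, hzb⟩
  have hw1 : ‖star z * z‖ ≤ 1 := by
    rw [CStarRing.norm_star_mul_self]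
    nlinarith [norm_nonneg z]
  have e : star z * z * a.val - a.val =
      star z * z * (a.val - (a.cutDown ε).val) - (a.val - (a.cutDown ε).val) := by
    rw [mul_sub, hza]; abel
  rw [e]
  refine (norm_mul_sub_self_le (star_mul_self_nonneg z) hw1 _).trans ?_
  rw [← norm_neg, neg_sub]
  exact a.norm_cutDown_sub_le hε.le

/-- Conjugating `c ≤ (c - s)_+ + s` by a contraction gives `v c v⋆ ≤ v (c - s)_+ v⋆ + s`. -/
theorem CuntzLE.conj_cutDown (c : PosStab A) {v : EllTwo H →L[ℂ] EllTwo H} (hv : v ∈ stab A)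
    (hv1 : ‖v‖ ≤ 1) {s : ℝ} (hs : 0 ≤ s) :
    CuntzLE ((c.conj v hv).cutDown s) (c.cutDown s) := by
  refine (CuntzLE.cutDown_of_le_add hs (y := (c.cutDown s).conj v hv) ?_).trans (CuntzLE.conj _ hv)
  have h1 : c.val ≤ (c.cutDown s).val + algebraMap ℝ _ s :=
    le_add_algebraMap_of_norm_sub_le c.isSelfAdjoint (c.cutDown s).isSelfAdjoint
      (by rw [← norm_neg, neg_sub]; exact c.norm_cutDown_sub_le hs)
  have h2 := star_right_conjugate_le_conjugate h1 v
  refine h2.trans ?_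
  have e : v * ((c.cutDown s).val + algebraMap ℝ _ s) * star v =
      v * (c.cutDown s).val * star v + s • (v * star v) := by
    rw [Algebra.algebraMap_eq_smul_one, mul_add, add_mul, mul_smul_comm, mul_one, smul_mul_assoc]
  rw [e, Algebra.algebraMap_eq_smul_one]
  have hvv : ‖v * star v‖ ≤ 1 := by
    rw [CStarRing.norm_self_mul_star]
    nlinarith [norm_nonneg v]
  have h3 : v * star v ≤ 1 :=
    (CStarAlgebra.norm_le_one_iff_of_nonneg _ (mul_star_self_nonneg v)).1 hvv
  exact add_le_add le_rfl (smul_le_smul_of_nonneg_left h3 hs)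

/-- Put `w = v c v⋆`. Sandwiching a scalar inequality in `w` between two copies of `a` gives `(1 -
s)²/2 · a² ≤ a (w - s)_+ a + ‖w a - a‖²/2`. Cutting the left side down by `θ²/2` leaves a function
of `a` that dominates a multiple of `(a - t)_+`. -/
theorem UnitWithin.cutDown_cuntzLE {a c : PosStab A} {θ s t : ℝ} (h : UnitWithin a c θ)
    (hc : ‖c.val‖ ≤ 1) (ht : 0 < t) (hs : 0 ≤ s) (hs1 : s < 1) (hθ : θ ≤ t * (1 - s)) :
    CuntzLE (a.cutDown t) (c.cutDown s) := by
  obtain ⟨v, hv, hv1, h⟩ := h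
  have hθ0 : 0 ≤ θ := (norm_nonneg _).trans h.le
  have ha := a.isSelfAdjoint
  set w := c.conj v hv with hw
  have hws := w.isSelfAdjoint
  have hwv : w.val = v * c.val * star v := rfl
  rw [← hwv] at h
  have hw1 : ‖w.val‖ ≤ 1 := (norm_conj_le hv1 _).trans hc
  have hx0 : ∀ u : ℝ, 0 ≤ (1 - s) ^ 2 / 2 * u ^ 2 := fun u => by positivity
  set x := a.fc (fun u => (1 - s) ^ 2 / 2 * u ^ 2) hx0 with hx
  have hxv : x.val = a.val * (algebraMap ℝ _ ((1 - s) ^ 2 / 2)) * a.val := by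
    rw [hx, a.fc_val _ (by fun_prop) (by simp), cfc_const_mul _ _ _ (by fun_prop),
      cfc_pow_id a.val 2, Algebra.algebraMap_eq_smul_one, mul_smul_comm, mul_one, smul_mul_assoc,
      sq a.val]
  -- Below `s` the square alone suffices; for `s ≤ u ≤ 1`, `(1-s)² - (1-u)² ≤ 2(u - s)`.
  have hkey : algebraMap ℝ (EllTwo H →L[ℂ] EllTwo H) ((1 - s) ^ 2 / 2) ≤
      (1 / 2 : ℝ) • ((w.val - 1) * (w.val - 1)) + (w.cutDown s).val := by
    have e : (1 / 2 : ℝ) • ((w.val - 1) * (w.val - 1)) + (w.cutDown s).val =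
        cfc (fun u : ℝ => (1 / 2) * ((u - 1) * (u - 1)) + max 0 (u - s)) w.val := by
      rw [cfc_add w.val (fun u : ℝ => (1 / 2) * ((u - 1) * (u - 1))) (fun u => max 0 (u - s))
        (by fun_prop) (by fun_prop), cfc_const_mul _ _ _ (by fun_prop),
        cfc_mul (fun u => u - 1) (fun u => u - 1) w.val (by fun_prop) (by fun_prop),
        cfc_sub (fun u => u) (fun _ => 1) w.val (by fun_prop) (by fun_prop), cfc_id' ℝ w.val,
        cfc_const_one ℝ w.val, w.cutDown_val hs]
    rw [e, ← cfc_const ((1 - s) ^ 2 / 2) w.val]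
    refine cfc_mono (fun u hu => ?_) (by fun_prop) (by fun_prop)
    have hu1 : u ≤ 1 := (w.le_norm_of_mem_spectrum hu).trans hw1
    rcases le_total u s with h1 | h1
    · rw [max_eq_left (by linarith)]; nlinarith
    · rw [max_eq_right (by linarith)]; nlinarith
  have hle : x.val ≤ ((w.cutDown s).conj a.val a.mem).val + algebraMap ℝ _ (θ ^ 2 / 2) := by
    have h1 := star_right_conjugate_le_conjugate hkey a.val
    rw [a.star_val, ← hxv] at h1
    refine h1.trans ?_
    have e : a.val * ((1 / 2 : ℝ) • ((w.val - 1) * (w.val - 1)) + (w.cutDown s).val) * a.val =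
        a.val * (w.cutDown s).val * a.val +
          (1 / 2 : ℝ) • (star (w.val * a.val - a.val) * (w.val * a.val - a.val)) := by
      rw [star_sub, star_mul, a.star_val, w.star_val, mul_add, add_mul, mul_smul_comm,
        smul_mul_assoc, add_comm]
      congr 2
      noncomm_ring
    rw [e]
    change _ ≤ a.val * (w.cutDown s).val * star a.val + _
    rw [a.star_val]
    refine add_le_add le_rfl ?_
    have h2 : star (w.val * a.val - a.val) * (w.val * a.val - a.val) ≤ algebraMap ℝ _ (θ ^ 2) :=
      CStarAlgebra.star_mul_le_algebraMap_norm_sq.trans (algebraMap_mono _ (by gcongr))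
    have h3 := smul_le_smul_of_nonneg_left h2 (by norm_num : (0 : ℝ) ≤ 1 / 2)
    refine h3.trans_eq ?_
    rw [Algebra.algebraMap_eq_smul_one, Algebra.algebraMap_eq_smul_one, smul_smul]
    congr 1
    ring
  have hcomp : x.cutDown (θ ^ 2 / 2) =
      a.fc (fun u => max 0 ((1 - s) ^ 2 / 2 * u ^ 2 - θ ^ 2 / 2)) fun _ => le_max_left _ _ := by
    refine PosStab.ext ?_
    rw [x.cutDown_val (by positivity), hx, a.fc_val _ (by fun_prop) (by simp),
      a.fc_val _ (by fun_prop) (by simpa using by positivity),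
      ← cfc_comp' (fun u => max 0 (u - θ ^ 2 / 2)) (fun u => (1 - s) ^ 2 / 2 * u ^ 2) a.val]
  have h1s : 0 < 1 - s := by linarith
  -- For `u ≥ t`, the bound on θ gives `(1-s)² u² - θ² ≥ (1-s)² (u² - t²) ≥ (1-s)² t (u - t)`.
  have hfirst : CuntzLE (a.cutDown t) (x.cutDown (θ ^ 2 / 2)) := by
    rw [hcomp]
    refine a.fc_cuntzLE_fc (fun _ => le_max_left _ _) (fun _ => le_max_left _ _) (by fun_prop)
      (by fun_prop) (by simpa using ht.le) (by simpa using by positivity)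
      (K := ((1 - s) ^ 2 / 2 * t)⁻¹) (by positivity) fun u hu => ?_
    rw [inv_mul_eq_div, le_div_iff₀ (by positivity)]
    rcases le_total u t with h2 | h2
    · rw [max_eq_left (by linarith : u - t ≤ 0), zero_mul]; exact le_max_left _ _
    · rw [max_eq_right (by linarith : 0 ≤ u - t)]
      refine le_trans ?_ (le_max_right _ _)
      have h3 : θ ^ 2 ≤ t ^ 2 * (1 - s) ^ 2 := by
        rw [← mul_pow]; gcongr
      have h4 : 0 ≤ (1 - s) ^ 2 * ((u - t) * u) := by
        have : 0 ≤ u - t := by linarith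
        positivity
      nlinarith
  exact ((hfirst.trans (CuntzLE.cutDown_of_le_add (by positivity) hle)).trans
    (CuntzLE.conj _ a.mem)).trans (CuntzLE.conj_cutDown c hv hv1 hs)

/-- Take `z` almost isometric on `a` in the right ideal of `(c - σ)_+`, and `k = 1 / max(c, σ)`.
Then `z = c k z`, so the error of `v d v⋆` on `z` is `(v d v⋆ c - c) k z`, of norm at most `θ/σ`;
the new contraction is `z⋆ v`. -/
theorem UnitWithin.extend {a c d : PosStab A} {θ σ ε : ℝ} (h : UnitWithin c d θ) (hσ : 0 < σ)
    (hε : 0 < ε) (ha : ‖a.val‖ ≤ 1) (hac : CuntzLE a (c.cutDown σ)) :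
    UnitWithin a d (θ / σ + ε) := by
  obtain ⟨v, hv, hv1, h⟩ := h
  obtain ⟨z, hz, hz1, hza, hzc⟩ := hac.exists_almost_isometric (half_pos hε)
  have hc := c.isSelfAdjoint
  have hkc : Continuous fun u : ℝ => (max u σ)⁻¹ :=
    (continuous_id.max continuous_const).inv₀ fun u => (lt_max_of_lt_right hσ).ne'
  set k := cfc (fun u : ℝ => (max u σ)⁻¹) c.val with hk
  have hk1 : ‖k‖ ≤ σ⁻¹ := by
    refine norm_cfc_le (inv_nonneg.2 hσ.le) fun u _ => ?_
    have h0 : 0 < max u σ := lt_max_of_lt_right hσ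
    rw [Real.norm_of_nonneg (inv_nonneg.2 h0.le)]
    exact inv_anti₀ hσ (le_max_right _ _)
  have hck : c.val * k * z = z := by
    refine rightIdeal_eq_of_mul_eq hzc ?_
    have e : c.val * k = cfc (fun u : ℝ => u * (max u σ)⁻¹) c.val := by
      rw [cfc_mul (fun u => u) (fun u : ℝ => (max u σ)⁻¹) c.val (by fun_prop) hkc.continuousOn,
        cfc_id' ℝ c.val]
    rw [e, c.cutDown_val hσ.le, ← cfc_mul _ _ _ (by fun_prop) (by fun_prop)]
    refine cfc_congr fun u _ => ?_
    change u * (max u σ)⁻¹ * max 0 (u - σ) = max 0 (u - σ)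
    rcases le_total u σ with h1 | h1
    · rw [max_eq_left (by linarith : u - σ ≤ 0), mul_zero]
    · rw [max_eq_left h1, mul_inv_cancel₀ (hσ.trans_le h1).ne', one_mul]
  set w := v * d.val * star v with hw
  refine ⟨star z * v, mul_mem (star_mem hz) hv, ?_, ?_⟩
  · calc _ ≤ ‖star z‖ * ‖v‖ := norm_mul_le _ _
      _ ≤ 1 * 1 := by rw [norm_star]; gcongr
      _ = 1 := one_mul 1
  have e : star z * v * d.val * star (star z * v) * a.val - a.val =
      (star z * z * a.val - a.val) + star z * (w * c.val - c.val) * k * z * a.val := by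
    have h1 : star z * (w * c.val - c.val) * k * z * a.val =
        star z * w * (c.val * k * z) * a.val - star z * (c.val * k * z) * a.val := by noncomm_ring
    rw [h1, hck, hw, star_mul, star_star]
    noncomm_ring
  rw [e]
  have hn : ‖star z * (w * c.val - c.val) * k * z * a.val‖ ≤ θ / σ := by
    calc _ ≤ ‖star z‖ * ‖w * c.val - c.val‖ * ‖k‖ * ‖z‖ * ‖a.val‖ := by
          refine (norm_mul_le _ _).trans ?_
          gcongr
          refine (norm_mul_le _ _).trans ?_
          gcongr
          refine (norm_mul_le _ _).trans ?_
          gcongr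
          exact norm_mul_le _ _
      _ ≤ 1 * θ * σ⁻¹ * 1 * 1 := by
          have : 0 ≤ θ := (norm_nonneg _).trans h.le
          rw [norm_star]; gcongr
      _ = θ / σ := by rw [div_eq_mul_inv]; ring
  linarith [norm_add_le (star z * z * a.val - a.val)
    (star z * (w * c.val - c.val) * k * z * a.val)]

theorem VeryRapidlyIncreasing.monotone {a : ℕ → PosStab A} (h : VeryRapidlyIncreasing a) :
    Monotone fun n => Cu.mk (a n) :=
  monotone_nat_of_le_succ fun n => Cu.le_of_wayBelow (h.wayBelow n)

/-- By ≪, `e ≾ (a_{n+1} - σ)_+` for some σ. Asking for error `σ ε/2` on `a_{n+1}` compensates the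
factor `1/σ` lost in `UnitWithin.extend`. -/
theorem VeryRapidlyIncreasing.eventually_unitWithin {a : ℕ → PosStab A}
    (h : VeryRapidlyIncreasing a) {e : PosStab A} (he : ‖e.val‖ ≤ 1) {n : ℕ}
    (hen : CuntzLE e (a n)) {ε : ℝ} (hε : 0 < ε) : ∀ᶠ m in atTop, UnitWithin e (a m) ε := by
  obtain ⟨σ, hσ, h1⟩ := Cu.wayBelow_mk_iff.1 (h.wayBelow n)
  obtain ⟨m₀, hm₀⟩ := h.almost_unit (σ * (ε / 2)) (by positivity) (n + 1)
  refine eventually_atTop.2 ⟨m₀, fun m hm => ?_⟩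
  have h2 : UnitWithin (a (n + 1)) (a m) (σ * (ε / 2)) := hm₀ m hm
  refine (h2.extend hσ (half_pos hε) he (hen.trans h1)).mono (le_of_eq ?_)
  field_simp
  ring

/-- Replacing `v` on each side costs α and replacing `c` costs 2α. Passing from `a` to `b` costs
only η, since `1 - w d w⋆` is a contraction. -/
theorem UnitWithin.transfer {α : ℝ} (hAB : CloseLT (stab A) (stab B) α) {a c : PosStab A}
    {b d : PosStab B} (ha : ‖a.val‖ ≤ 1) (hc : ‖c.val‖ ≤ 1) (hd : ‖d.val‖ ≤ 1) {η θ : ℝ}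
    (hab : ‖a.val - b.val‖ ≤ η) (hcd : ‖c.val - d.val‖ < 2 * α) (h : UnitWithin a c θ) :
    UnitWithin b d (θ + 4 * α + η) := by
  obtain ⟨v, hv, hv1, h⟩ := h
  obtain ⟨w, hw, hw1, hvw⟩ := hAB.1 v hv hv1
  refine ⟨w, hw, hw1, ?_⟩
  have hd' : ‖w * d.val * star w‖ ≤ 1 := (norm_conj_le hw1 _).trans hd
  have e : w * d.val * star w * b.val - b.val =
      (v * c.val * star v * a.val - a.val)
      - ((v - w) * c.val * star v + w * (c.val - d.val) * star v
          + w * d.val * star (v - w)) * a.val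
      - (w * d.val * star w * (a.val - b.val) - (a.val - b.val)) := by
    rw [star_sub]; noncomm_ring
  have n1 : ‖(v - w) * c.val * star v‖ ≤ α := by
    calc _ ≤ ‖v - w‖ * ‖c.val‖ * ‖star v‖ :=
          (norm_mul_le _ _).trans (by gcongr; exact norm_mul_le _ _)
      _ ≤ α * 1 * 1 := by
          have : 0 ≤ α := (norm_nonneg _).trans hvw.le
          rw [norm_star]; gcongr
      _ = α := by ring
  have n2 : ‖w * (c.val - d.val) * star v‖ ≤ 2 * α := by
    calc _ ≤ ‖w‖ * ‖c.val - d.val‖ * ‖star v‖ :=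
          (norm_mul_le _ _).trans (by gcongr; exact norm_mul_le _ _)
      _ ≤ 1 * (2 * α) * 1 := by
          have : 0 ≤ 2 * α := (norm_nonneg _).trans hcd.le
          rw [norm_star]; gcongr
      _ = 2 * α := by ring
  have n3 : ‖w * d.val * star (v - w)‖ ≤ α := by
    calc _ ≤ ‖w‖ * ‖d.val‖ * ‖star (v - w)‖ :=
          (norm_mul_le _ _).trans (by gcongr; exact norm_mul_le _ _)
      _ ≤ 1 * 1 * α := by rw [norm_star]; gcongr
      _ = α := by ring
  have n4 : ‖((v - w) * c.val * star v + w * (c.val - d.val) * star v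
          + w * d.val * star (v - w)) * a.val‖ ≤ 4 * α := by
    calc _ ≤ ‖(v - w) * c.val * star v + w * (c.val - d.val) * star v
          + w * d.val * star (v - w)‖ * ‖a.val‖ := norm_mul_le _ _
      _ ≤ (α + 2 * α + α) * 1 := by
          gcongr
          · have := (norm_nonneg _).trans n1
            positivity
          · exact norm_add₃_le.trans (by gcongr)
      _ = 4 * α := by ring
  have n5 := norm_mul_sub_self_le (star_right_conjugate_nonneg d.nonneg w) hd' (a.val - b.val)
  rw [e]
  have n6 := norm_sub_le ((v * c.val * star v * a.val - a.val)
      - ((v - w) * c.val * star v + w * (c.val - d.val) * star v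
          + w * d.val * star (v - w)) * a.val)
      (w * d.val * star w * (a.val - b.val) - (a.val - b.val))
  have n7 := norm_sub_le (v * c.val * star v * a.val - a.val)
    (((v - w) * c.val * star v + w * (c.val - d.val) * star v
          + w * d.val * star (v - w)) * a.val)
  linarith

/-- An increasing sequence can be replaced by a very rapidly increasing one, obtained by
functional calculus, with the same supremum. -/
theorem exists_veryRapidlyIncreasing {a : ℕ → PosStab A} (h : ∀ n, CuntzLE (a n) (a (n + 1))) :
    ∃ (δ : ℕ → ℝ) (hδ : ∀ n, 0 < δ n),
      VeryRapidlyIncreasing (fun n => (a n).fc (ramp (δ n) (δ n)) (ramp_nonneg _ (hδ n))) ∧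
      (∀ n, CuntzLE ((a n).fc (ramp (δ n) (δ n)) (ramp_nonneg _ (hδ n))) (a n)) ∧
      ∀ k, ∀ ε > 0, ∃ n, CuntzLE ((a k).cutDown ε)
        ((a n).fc (ramp (δ n) (δ n)) (ramp_nonneg _ (hδ n))) := by
  obtain ⟨d, hd, hd1, hd2⟩ := exists_cutDown_seq h
  have hδ : ∀ n, 0 < d n / 2 := fun n => half_pos (hd n)
  have hr0 : ∀ n, ramp (d n / 2) (d n / 2) 0 = 0 := fun n => ramp_of_le _ (hδ n).le
  have hrc : ∀ n, Continuous (ramp (d n / 2) (d n / 2)) := fun n => continuous_ramp _ _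
  -- This ramp vanishes up to `d_n/2`, so `c_n ≾ (a_n - d_n/4)_+`, and equals 1 from `d_n` on, so
  -- `c_n` is a unit for `(a_n - d_n)_+`.
  set c : ℕ → PosStab A := fun n =>
    (a n).fc (ramp (d n / 2) (d n / 2)) (ramp_nonneg _ (hδ n)) with hc
  have hcv : ∀ n, (c n).val = cfc (ramp (d n / 2) (d n / 2)) (a n).val := fun n =>
    (a n).fc_val _ (hrc n) (hr0 n)
  have hca : ∀ n, CuntzLE (c n) ((a n).cutDown (d n / 4)) := by
    intro n
    have hn := hd n
    refine (a n).fc_cuntzLE_fc (ramp_nonneg _ (hδ n)) (fun _ => le_max_left _ _) (hrc n)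
      (by fun_prop) (hr0 n) (by simpa using by positivity) (K := 4 / d n) (by positivity)
      fun t _ => ?_
    rcases le_total t (d n / 2) with h1 | h1
    · rw [ramp_of_le _ h1]
      exact mul_nonneg (by positivity) (le_max_left _ _)
    · refine (ramp_le_one _ _ _).trans ?_
      rw [max_eq_right (by linarith), div_mul_eq_mul_div, le_div_iff₀ hn]
      linarith
  -- Where `(a_n - d_n)_+` is nonzero, `(c_n - 1/2)_+` takes the value 1/2. The cut-down by 1/2 is
  -- the gap that yields `⟨c_n⟩ ≪ ⟨c_{n+1}⟩`.
  have hac : ∀ n, CuntzLE ((a n).cutDown (d n)) ((c n).cutDown (1 / 2)) := by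
    intro n
    have hn := hd n
    have hcomp : (c n).cutDown (1 / 2) = (a n).fc
        (fun t => max 0 (ramp (d n / 2) (d n / 2) t - 1 / 2)) fun _ => le_max_left _ _ := by
      refine PosStab.ext ?_
      have := (a n).isSelfAdjoint
      have := hrc n
      rw [(c n).cutDown_val (by norm_num), hcv, (a n).fc_val _ (by fun_prop) (by rw [hr0]; norm_num),
        ← cfc_comp' (fun t => max 0 (t - 1 / 2)) (ramp (d n / 2) (d n / 2)) (a n).val]
    have := hrc n
    rw [hcomp]
    refine (a n).fc_cuntzLE_fc_of_le_norm (fun _ => le_max_left _ _) (fun _ => le_max_left _ _)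
      (by fun_prop) (by fun_prop) (by simpa using hn.le) (by rw [hr0]; norm_num)
      (K := 2 * ‖(a n).val‖) (by positivity) fun t ht hta => ?_
    rcases le_total t (d n) with h1 | h1
    · rw [max_eq_left (by linarith : t - d n ≤ 0)]
      exact mul_nonneg (by positivity) (le_max_left _ _)
    · rw [ramp_of_ge (hδ n) (by linarith), max_eq_right (by linarith : 0 ≤ t - d n),
        max_eq_right (by norm_num)]
      linarith
  have hcc : ∀ n m, n < m → CuntzLE (c n) ((a m).cutDown (d m)) := by
    intro n m hnm
    induction m, hnm using Nat.le_induction with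
    | base => exact (hca n).trans (hd1 n)
    | succ m _ ih =>
      refine (ih.trans ((a m).cutDown_anti ?_ ?_)).trans (hd1 m)
      · have := hd m; positivity
      · have := hd m; linarith
  refine ⟨fun n => d n / 2, hδ, ⟨fun n => ?_, fun n => ?_, fun ε hε n => ⟨n + 1, fun m hm => ?_⟩⟩,
    fun n => (hca n).trans ((a n).cutDown_cuntzLE (by have := hd n; positivity)), fun k ε hε => ?_⟩
  · change ‖(c n).val‖ ≤ 1
    rw [hcv]
    refine norm_cfc_le zero_le_one fun t _ => ?_
    rw [Real.norm_of_nonneg (ramp_nonneg _ (hδ n) t)]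
    exact ramp_le_one _ _ _
  · exact Cu.wayBelow_mk_iff.2 ⟨1 / 2, by norm_num, (hcc n (n + 1) n.lt_succ_self).trans (hac _)⟩
  · change ∃ v ∈ stab A, ‖v‖ ≤ 1 ∧ ‖(v * (c m).val * star v) * (c n).val - (c n).val‖ < ε
    -- Because `c_m` fixes the right ideal containing `z`, `z⋆ c_m z = z⋆ z`, which almost fixes
    -- `c_n`.
    obtain ⟨z, hz, hz1, hzn, hzr⟩ := (hcc n m hm).exists_almost_isometric (half_pos hε)
    refine ⟨star z, star_mem hz, by rwa [norm_star], ?_⟩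
    have hcz : (c m).val * z = z := by
      refine rightIdeal_eq_of_mul_eq hzr ?_
      have := hrc m
      rw [hcv, (a m).cutDown_val (hd m).le, ← cfc_mul _ _ _ (by fun_prop) (by fun_prop)]
      refine cfc_congr fun t _ => ?_
      change ramp (d m / 2) (d m / 2) t * max 0 (t - d m) = max 0 (t - d m)
      rcases le_total t (d m) with h1 | h1
      · rw [max_eq_left (by linarith : t - d m ≤ 0), mul_zero]
      · rw [ramp_of_ge (hδ m) (by linarith), one_mul]
    rw [star_star, mul_assoc (star z), hcz]
    linarith
  · obtain ⟨m, hm⟩ := exists_nat_one_div_lt hε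
    have hm' : 1 / (((max m k : ℕ) : ℝ) + 1) ≤ ε :=
      (Nat.one_div_le_one_div (le_max_left m k)).trans hm.le
    exact ⟨max m k, (((a k).cutDown_anti Nat.one_div_pos_of_nat.le hm').trans
      (hd2 (max m k) k (le_max_right _ _))).trans ((hac _).trans
        ((c _).cutDown_cuntzLE (by norm_num)))⟩

end ApproximateUnits

/-! ### Sequences whose terms are eventually dominated by later ones. -/

section EventuallyIncreasing

variable {S : Type*} [PartialOrder S]

/-- Needed because the classes `⟨(b_n - 18α)_+⟩` need not increase. Each new index dominates all
terms up to the previous one, which makes the subsequence cofinal. -/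
theorem exists_monotone_subseq {u : ℕ → S} (hu : ∀ n, ∀ᶠ m in atTop, u n ≤ u m) :
    ∃ φ : ℕ → ℕ, Monotone (u ∘ φ) ∧ ∀ n, ∃ k, u n ≤ u (φ k) := by
  have h : ∀ N, ∃ M, N < M ∧ ∀ i ∈ Set.Iic N, u i ≤ u M := fun N =>
    ((eventually_gt_atTop N).and
      ((eventually_all_finite (Set.finite_Iic N)).2 fun i _ => hu i)).exists
  choose g hg1 hg2 using h
  let φ : ℕ → ℕ := fun n => Nat.rec 0 (fun _ N => g N) n
  have hφ : ∀ n, φ (n + 1) = g (φ n) := fun _ => rfl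
  have hle : ∀ n, n ≤ φ n := by
    intro n
    induction n with
    | zero => exact Nat.zero_le _
    | succ n ih => rw [hφ]; exact ih.trans_lt (hg1 _)
  refine ⟨φ, monotone_nat_of_le_succ fun n => ?_, fun n => ⟨n + 1, ?_⟩⟩
  · change u (φ n) ≤ u (φ (n + 1))
    rw [hφ]; exact hg2 _ _ (Set.mem_Iic.2 le_rfl)
  · rw [hφ]; exact hg2 _ _ (hle n)

theorem upperBounds_range_subseq {u : ℕ → S} {φ : ℕ → ℕ} (h : ∀ n, ∃ k, u n ≤ u (φ k)) :
    upperBounds (Set.range (u ∘ φ)) = upperBounds (Set.range u) := by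
  ext y
  constructor
  · rintro hy _ ⟨n, rfl⟩
    obtain ⟨k, hk⟩ := h n
    exact hk.trans (hy ⟨k, rfl⟩)
  · rintro hy _ ⟨n, rfl⟩
    exact hy ⟨φ n, rfl⟩

theorem isLUB_range_subseq_iff {u : ℕ → S} {φ : ℕ → ℕ} (h : ∀ n, ∃ k, u n ≤ u (φ k)) {y : S} :
    IsLUB (Set.range (u ∘ φ)) y ↔ IsLUB (Set.range u) y := by
  unfold IsLUB
  rw [upperBounds_range_subseq h]

theorem WayBelow.exists_le {u : ℕ → S} (hu : ∀ n, ∀ᶠ m in atTop, u n ≤ u m) {x y : S}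
    (hy : IsLUB (Set.range u) y) (hxy : WayBelow x y) : ∃ n, x ≤ u n := by
  obtain ⟨φ, h1, h2⟩ := exists_monotone_subseq hu
  obtain ⟨n, hn⟩ := hxy _ h1 ((isLUB_range_subseq_iff h2).2 hy)
  exact ⟨φ n, hn⟩

end EventuallyIncreasing

/-! ### The order isomorphism between the two Cuntz semigroups. -/

section Correspondence

variable {H : Type*} [NormedAddCommGroup H] [InnerProductSpace ℂ H] [CompleteSpace H]
variable {A B : NonUnitalStarSubalgebra ℂ (H →L[ℂ] H)}

theorem Cu.exists_isLUB_of_eventually_le {u : ℕ → Cu A} (hu : ∀ n, ∀ᶠ m in atTop, u n ≤ u m) :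
    ∃ x, IsLUB (Set.range u) x := by
  obtain ⟨φ, h1, h2⟩ := exists_monotone_subseq hu
  obtain ⟨x, hx⟩ := Cu.exists_isLUB h1
  exact ⟨x, (isLUB_range_subseq_iff h2).1 hx⟩

theorem CloseLT.symm {C : Type*} [NormedRing C] [StarRing C] [NormedAlgebra ℂ C]
    {S T : NonUnitalStarSubalgebra ℂ C} {γ : ℝ} (h : CloseLT S T γ) : CloseLT T S γ :=
  ⟨h.2, h.1⟩

theorem CloseLT.pos {C : Type*} [NormedRing C] [StarRing C] [NormedAlgebra ℂ C]
    {S T : NonUnitalStarSubalgebra ℂ C} {γ : ℝ} (h : CloseLT S T γ) : 0 < γ := by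
  obtain ⟨y, -, -, hy⟩ := h.1 0 (zero_mem S) (by simp)
  exact (norm_nonneg _).trans_lt hy

theorem norm_sq_sub_mul_star_lt {C : Type*} [CStarAlgebra C] {s y : C} {γ : ℝ} (hs : star s = s)
    (hs1 : ‖s‖ ≤ 1) (hy1 : ‖y‖ ≤ 1) (h : ‖s - y‖ < γ) : ‖s * s - y * star y‖ < 2 * γ := by
  have e : s * s - y * star y = s * star (s - y) + (s - y) * star y := by
    rw [star_sub, hs]; noncomm_ring
  have h1 : ‖s * star (s - y)‖ ≤ 1 * ‖s - y‖ :=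
    (norm_mul_le _ _).trans (by rw [norm_star]; gcongr)
  have h2 : ‖(s - y) * star y‖ ≤ ‖s - y‖ * 1 :=
    (norm_mul_le _ _).trans (by rw [norm_star]; gcongr)
  rw [e]
  linarith [norm_add_le (s * star (s - y)) ((s - y) * star y)]

theorem norm_mul_star_le_one {C : Type*} [CStarAlgebra C] {y : C} (hy : ‖y‖ ≤ 1) :
    ‖y * star y‖ ≤ 1 := by
  rw [CStarRing.norm_self_mul_star]
  nlinarith [norm_nonneg y]

theorem norm_cfc_sqrt_le_one {C : Type*} [CStarAlgebra C] [PartialOrder C] [StarOrderedRing C]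
    {a : C} (ha : 0 ≤ a) (ha1 : ‖a‖ ≤ 1) : ‖cfc Real.sqrt a‖ ≤ 1 := by
  have h : ‖star (cfc Real.sqrt a) * cfc Real.sqrt a‖ ≤ 1 := by
    rwa [star_cfc_real, cfc_sqrt_mul_cfc_sqrt ha]
  rw [CStarRing.norm_star_mul_self] at h
  nlinarith [norm_nonneg (cfc Real.sqrt a)]

/-- An approximant of `a` itself need not be positive. Approximating `a^{1/2}` by `y` and taking `y
y⋆` gives positivity and accounts for the factor 2. -/
theorem CloseLT.exists_posStab {α : ℝ} (hAB : CloseLT (stab A) (stab B) α) (a : PosStab A)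
    (ha : ‖a.val‖ ≤ 1) : ∃ b : PosStab B, ‖b.val‖ ≤ 1 ∧ ‖a.val - b.val‖ < 2 * α := by
  obtain ⟨y, hy, hy1, h⟩ := hAB.1 (cfc Real.sqrt a.val)
    (cfc_mem_stab a.mem Real.continuous_sqrt Real.sqrt_zero) (norm_cfc_sqrt_le_one a.nonneg ha)
  refine ⟨⟨y * star y, mul_mem hy (star_mem hy), mul_star_self_nonneg y⟩,
    norm_mul_star_le_one hy1, ?_⟩
  have := norm_sq_sub_mul_star_lt (star_cfc_real _ _) (norm_cfc_sqrt_le_one a.nonneg ha) hy1 h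
  rwa [cfc_sqrt_mul_cfc_sqrt a.nonneg] at this

/-- If `a ≾ a' k` with `a'` very rapidly increasing, then nearby elements `b`, `b' m` of the other
algebra are comparable after cutting down. -/
theorem eventually_cutDown_cuntzLE {α : ℝ} (hAB : CloseLT (stab A) (stab B) α) {a : PosStab A}
    {b : PosStab B} (ha : ‖a.val‖ ≤ 1) (hab : ‖a.val - b.val‖ < 2 * α) {a' : ℕ → PosStab A}
    {b' : ℕ → PosStab B} (ha' : VeryRapidlyIncreasing a') (hb' : ∀ n, ‖(b' n).val‖ ≤ 1)
    (hab' : ∀ n, ‖(a' n).val - (b' n).val‖ < 2 * α) {k : ℕ} (hk : CuntzLE a (a' k)) :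
    ∀ᶠ m in atTop, CuntzLE (b.cutDown (18 * α)) ((b' m).cutDown (1 / 2)) := by
  have hα := hAB.pos
  -- The unit error α becomes `α + 4α + 2α = 7α` after transfer, below the allowance `18α (1 - 1/2)
  -- = 9α`.
  filter_upwards [ha'.eventually_unitWithin ha hk hα] with m hm
  refine (hm.transfer hAB ha (ha'.norm_le_one m) (hb' m) hab.le (hab' m)).cutDown_cuntzLE (hb' m)
    (by positivity) (by norm_num) (by norm_num) ?_
  linarith

/-- The graph of the isomorphism `Cu(A) → Cu(B)`. -/
def Corresponds (α : ℝ) (x : Cu A) (y : Cu B) : Prop :=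
  ∃ (a : ℕ → PosStab A) (b : ℕ → PosStab B), VeryRapidlyIncreasing a ∧ (∀ n, ‖(b n).val‖ ≤ 1) ∧
    (∀ n, ‖(a n).val - (b n).val‖ < 2 * α) ∧ IsLUB (Set.range fun n => Cu.mk (a n)) x ∧
    IsLUB (Set.range fun n => Cu.mk ((b n).cutDown (18 * α))) y

theorem eventually_cutDown_le {α : ℝ} (hα : α < 1 / 42) (hAB : CloseLT (stab A) (stab B) α)
    {a : ℕ → PosStab A} {b : ℕ → PosStab B} (ha : VeryRapidlyIncreasing a)
    (hb : ∀ n, ‖(b n).val‖ ≤ 1) (hab : ∀ n, ‖(a n).val - (b n).val‖ < 2 * α) (n : ℕ) :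
    ∀ᶠ m in atTop, Cu.mk ((b n).cutDown (18 * α)) ≤ Cu.mk ((b m).cutDown (18 * α)) := by
  have hα0 := hAB.pos
  filter_upwards [eventually_cutDown_cuntzLE hAB (ha.norm_le_one n) (hab n) ha hb hab
    (CuntzLE.refl _)] with m hm
  exact hm.trans ((b m).cutDown_anti (by positivity) (by linarith))

theorem exists_isLUB_cutDown {α : ℝ} (hα : α < 1 / 42) (hAB : CloseLT (stab A) (stab B) α)
    {a : ℕ → PosStab A} {b : ℕ → PosStab B} (ha : VeryRapidlyIncreasing a)
    (hb : ∀ n, ‖(b n).val‖ ≤ 1) (hab : ∀ n, ‖(a n).val - (b n).val‖ < 2 * α) :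
    ∃ y, IsLUB (Set.range fun n => Cu.mk ((b n).cutDown (18 * α))) y :=
  Cu.exists_isLUB_of_eventually_le (eventually_cutDown_le hα hAB ha hb hab)

theorem VeryRapidlyIncreasing.exists_close {α : ℝ} (hAB : CloseLT (stab A) (stab B) α)
    {a : ℕ → PosStab A} (ha : VeryRapidlyIncreasing a) :
    ∃ b : ℕ → PosStab B, ∀ n, ‖(b n).val‖ ≤ 1 ∧ ‖(a n).val - (b n).val‖ < 2 * α := by
  choose b hb using fun n => hAB.exists_posStab (a n) (ha.norm_le_one n)
  exact ⟨b, hb⟩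

theorem Cu.exists_veryRapidlyIncreasing (x : Cu A) :
    ∃ a : ℕ → PosStab A, VeryRapidlyIncreasing a ∧ IsLUB (Set.range fun n => Cu.mk (a n)) x := by
  obtain ⟨a, rfl⟩ := x.exists_mk_eq
  obtain ⟨δ, hδ, h1, h2, h3⟩ :=
    CuntzStab.exists_veryRapidlyIncreasing (a := fun _ => a) fun _ => CuntzLE.refl a
  exact ⟨_, h1, Cu.isLUB_of_cutDown h2 (h3 0)⟩

theorem Corresponds.exists {α : ℝ} (hα : α < 1 / 42) (hAB : CloseLT (stab A) (stab B) α)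
    (x : Cu A) : ∃ y : Cu B, Corresponds α x y := by
  obtain ⟨a, ha, hx⟩ := x.exists_veryRapidlyIncreasing
  obtain ⟨b, hb⟩ := ha.exists_close hAB
  obtain ⟨y, hy⟩ := exists_isLUB_cutDown hα hAB ha (fun n => (hb n).1) fun n => (hb n).2
  exact ⟨y, a, b, ha, fun n => (hb n).1, fun n => (hb n).2, hx, hy⟩

theorem VeryRapidlyIncreasing.exists_le {a : ℕ → PosStab A} (ha : VeryRapidlyIncreasing a)
    {x y : Cu A} (hx : IsLUB (Set.range fun n => Cu.mk (a n)) x) (h : WayBelow y x) :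
    ∃ n, y ≤ Cu.mk (a n) :=
  h _ ha.monotone hx

theorem VeryRapidlyIncreasing.wayBelow_sup {a : ℕ → PosStab A} (ha : VeryRapidlyIncreasing a)
    {x : Cu A} (hx : IsLUB (Set.range fun n => Cu.mk (a n)) x) (n : ℕ) :
    WayBelow (Cu.mk (a n)) x :=
  Cu.wayBelow_of_le (ha.wayBelow n) (hx.1 ⟨n + 1, rfl⟩)

/-- Each `⟨a_n⟩` is ≪ `x'`, hence below some `⟨a'_k⟩`, and this comparison transfers to the
cut-downs, using `18α < 1/2`. With `x = x'` it says that the image does not depend on the choices.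
-/
theorem Corresponds.le {α : ℝ} (hα : α < 1 / 42) (hAB : CloseLT (stab A) (stab B) α)
    {x x' : Cu A} {y y' : Cu B} (h : Corresponds α x y) (h' : Corresponds α x' y')
    (hx : x ≤ x') : y ≤ y' := by
  have hα0 := hAB.pos
  obtain ⟨a, b, ha, hb, hab, hax, hby⟩ := h
  obtain ⟨a', b', ha', hb', hab', hax', hby'⟩ := h'
  refine hby.2 ?_
  rintro _ ⟨n, rfl⟩
  obtain ⟨k, hk⟩ := ha'.exists_le hax' (Cu.wayBelow_of_le (ha.wayBelow_sup hax n) hx)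
  obtain ⟨m, hm⟩ := (eventually_cutDown_cuntzLE hAB (ha.norm_le_one n) (hab n) ha' hb' hab'
    (Cu.mk_le_mk.1 hk)).exists
  have h1 : CuntzLE ((b n).cutDown (18 * α)) ((b' m).cutDown (18 * α)) :=
    hm.trans ((b' m).cutDown_anti (by positivity) (by linarith))
  exact le_trans (Cu.mk_le_mk.2 h1) (hby'.1 ⟨m, rfl⟩)

/-- Both inequalities carry a unit relation along the round trip through the other algebra. The
total error must stay small enough for a final comparison, and each inequality is calibrated to `α <
1/42`. -/
theorem Corresponds.inverse {α : ℝ} (hα : α < 1 / 42) (hAB : CloseLT (stab A) (stab B) α)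
    {x x' : Cu A} {y : Cu B} (h : Corresponds α x y) (h' : Corresponds α y x') : x = x' := by
  have hα0 := hAB.pos
  have hBA := hAB.symm
  obtain ⟨a, b, ha, hb, hab, hax, hby⟩ := h
  obtain ⟨b', a', hb', ha', hba', hby', hax'⟩ := h'
  have hba : ∀ n, ‖(b n).val - (a n).val‖ < 2 * α := fun n => by rw [norm_sub_rev]; exact hab n
  have hab' : ∀ n, ‖(a' n).val - (b' n).val‖ < 2 * α := fun n => by
    rw [norm_sub_rev]; exact hba' n
  apply le_antisymm
  · refine hax.2 ?_
    rintro _ ⟨n, rfl⟩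
    obtain ⟨s, rfl⟩ := x'.exists_mk_eq
    refine CuntzLE.of_forall_cutDown fun ε hε => ?_
    have hpos : 0 < 1 - 18 * α := by linarith
    -- The transferred error is `4α + (18α + 2α) + ε' = 24α + ε'`. A cut-down level `l < 1` on the
    -- left against `18α` on the right needs `24α + ε' ≤ l (1 - 18α)`, possible exactly when `42α +
    -- ε' < 1`.
    set ε' := (1 - 42 * α) / 2 with hε'
    have hε'0 : 0 < ε' := by rw [hε']; linarith
    set l := (24 * α + ε') / (1 - 18 * α) with hl
    have hl0 : 0 < l := by positivity
    have hl1 : l < 1 := by rw [hl, div_lt_one hpos, hε']; linarith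
    -- Moving on to a late index `m` absorbs the large cut-down `l`: `(a_n - ε)_+ ≾ (a_m - l)_+`.
    have hθ : 0 < ε * (1 - l) := mul_pos hε (by linarith)
    obtain ⟨m, hm⟩ := (ha.eventually_unitWithin (ha.norm_le_one n) (CuntzLE.refl _) hθ).exists
    have h1 : CuntzLE ((a n).cutDown ε) ((a m).cutDown l) :=
      hm.cutDown_cuntzLE (ha.norm_le_one m) hε hl0.le hl1 le_rfl
    obtain ⟨i, hi⟩ := (eventually_cutDown_cuntzLE hAB (ha.norm_le_one m) (hab m) ha hb hab
      (CuntzLE.refl _)).exists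
    have h2 : WayBelow (Cu.mk ((b m).cutDown (18 * α))) y := by
      refine Cu.wayBelow_of_le (Cu.wayBelow_mk_iff.2 ⟨1 / 2 - 18 * α, by linarith, ?_⟩)
        (hby.1 ⟨i, rfl⟩)
      rwa [(b i).cutDown_cutDown (by positivity) (by linarith), add_sub_cancel]
    obtain ⟨k, hk⟩ := hb'.exists_le hby' h2
    have he1 : ‖((b m).cutDown (18 * α)).val‖ ≤ 1 :=
      ((b m).norm_cutDown_le (by positivity)).trans (hb m)
    obtain ⟨j, hj⟩ := (hb'.eventually_unitWithin he1 (Cu.mk_le_mk.1 hk) hε'0).exists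
    have hclose : ‖((b m).cutDown (18 * α)).val - (a m).val‖ ≤ 18 * α + 2 * α := by
      have h3 := (b m).norm_cutDown_sub_le (t := 18 * α) (by positivity)
      have h4 := norm_add_le (((b m).cutDown (18 * α)).val - (b m).val) ((b m).val - (a m).val)
      rw [sub_add_sub_cancel] at h4
      linarith [hba m]
    have h3 : UnitWithin (a m) (a' j) (ε' + 4 * α + (18 * α + 2 * α)) :=
      hj.transfer hBA he1 (hb'.norm_le_one j) (ha' j) hclose (hba' j)
    have h4 : CuntzLE ((a m).cutDown l) ((a' j).cutDown (18 * α)) := by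
      refine h3.cutDown_cuntzLE (ha' j) hl0 (by positivity) (by linarith) ?_
      rw [hl, div_mul_cancel₀ _ hpos.ne']
      linarith
    exact (h1.trans h4).trans (Cu.mk_le_mk.1 (hax'.1 ⟨j, rfl⟩))
  · refine hax'.2 ?_
    rintro _ ⟨n, rfl⟩
    obtain ⟨l, hl⟩ := (eventually_cutDown_cuntzLE hBA (hb'.norm_le_one n) (hba' n) hb' ha' hba'
      (CuntzLE.refl _)).exists
    obtain ⟨k, hk⟩ := WayBelow.exists_le (eventually_cutDown_le hα hAB ha hb hab) hby
      (hb'.wayBelow_sup hby' l)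
    -- After transfer the error on `b_k` is `18α/84 + 6α`. Dividing by `σ = 18α` and adding 1/84
    -- gives `1/3 + 1/42` on `b'_l`; transferring back adds `6α < 1/7`. The total is below `1/3 +
    -- 1/42 + 1/7 = 1/2`.
    obtain ⟨j, hj⟩ := (ha.eventually_unitWithin (ha.norm_le_one k) (CuntzLE.refl _)
      (show 0 < 18 * α / 84 by positivity)).exists
    have h1 := hj.transfer hAB (ha.norm_le_one k) (ha.norm_le_one j) (hb j) (hab k).le (hab j)
    have h2 := h1.extend (show 0 < 18 * α by positivity) (show (0 : ℝ) < 1 / 84 by norm_num)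
      (hb'.norm_le_one l) (Cu.mk_le_mk.1 hk)
    have h3 := h2.transfer hBA (hb'.norm_le_one l) (hb j) (ha.norm_le_one j) (hba' l).le (hba j)
    have h4 : CuntzLE ((a' l).cutDown (1 / 2)) ((a j).cutDown 0) := by
      refine h3.cutDown_cuntzLE (ha.norm_le_one j) (by norm_num) le_rfl one_pos ?_
      have : (18 * α / 84 + 4 * α + 2 * α) / (18 * α) = 1 / 84 + 1 / 3 := by
        field_simp
        norm_num
      rw [this]
      linarith
    rw [PosStab.cutDown_zero] at h4
    exact le_trans (Cu.mk_le_mk.2 (hl.trans h4)) (hax.1 ⟨j, rfl⟩)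

theorem exists_equiv {α : ℝ} (hα : α < 1 / 42) (hAB : CloseLT (stab A) (stab B) α) :
    ∃ Φ : Cu A ≃o Cu B, (∀ x y, Corresponds α x y ↔ y = Φ x) ∧
      ∀ y x, Corresponds α y x ↔ x = Φ.symm y := by
  have hBA := hAB.symm
  choose f hf using Corresponds.exists hα hAB
  choose g hg using Corresponds.exists hα hBA
  have hgf : ∀ x, g (f x) = x := fun x => ((hf x).inverse hα hAB (hg _)).symm
  have hfg : ∀ y, f (g y) = y := fun y => ((hg y).inverse hα hBA (hf _)).symm
  have hmono : Monotone f := fun x x' h => (hf x).le hα hAB (hf x') h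
  have hmono' : Monotone g := fun x x' h => (hg x).le hα hBA (hg x') h
  let e : Cu A ≃ Cu B := ⟨f, g, hgf, hfg⟩
  refine ⟨e.toOrderIso hmono hmono', fun x y => ⟨fun h => ?_, ?_⟩, fun y x => ⟨fun h => ?_, ?_⟩⟩
  · exact le_antisymm (h.le hα hAB (hf x) le_rfl) ((hf x).le hα hAB h le_rfl)
  · rintro rfl; exact hf x
  · exact le_antisymm (h.le hα hBA (hg y) le_rfl) ((hg y).le hα hBA h le_rfl)
  · rintro rfl; exact hg y

end Correspondence

/-! ### Order isomorphisms as morphisms in the category Cu. -/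

section OrderIso

variable {S T : Type*} [PartialOrder S] [AddCommMonoid S] [PartialOrder T] [AddCommMonoid T]

/-- Zero is the least element, and suprema and ≪ are defined from the order, so only addition
carries information. -/
theorem isCuMorphism_of_orderIso (e : S ≃o T) (hS : ∀ x : S, 0 ≤ x) (hT : ∀ y : T, 0 ≤ y)
    (hadd : ∀ x y, e (x + y) = e x + e y) : IsCuMorphism e where
  monotone := e.monotone
  map_add := hadd
  map_zero := le_antisymm ((e.le_symm_apply).1 (hS _)) (hT _)
  map_sup u x _ hx := by
    have := e.isLUB_image'.2 hx
    rwa [← Set.range_comp] at this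
  map_wayBelow x y h u hu huy := by
    have h1 : IsLUB (Set.range fun n => e.symm (u n)) y := by
      have := e.symm.isLUB_image'.2 huy
      rwa [← Set.range_comp, e.symm_apply_apply] at this
    obtain ⟨n, hn⟩ := h (fun n => e.symm (u n)) (e.symm.monotone.comp hu) h1
    exact ⟨n, (e.le_symm_apply).1 hn⟩

end OrderIso

/-! ### Compatibility with direct sums. -/

section Additivity

variable {H : Type*} [NormedAddCommGroup H] [InnerProductSpace ℂ H] [CompleteSpace H]
variable {A B : NonUnitalStarSubalgebra ℂ (H →L[ℂ] H)}

theorem mul_dsum (x y z w : EllTwo H →L[ℂ] EllTwo H) :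
    (evenIso H * x * star (evenIso H) + oddIso H * y * star (oddIso H)) *
      (evenIso H * z * star (evenIso H) + oddIso H * w * star (oddIso H)) =
      evenIso H * (x * z) * star (evenIso H) + oddIso H * (y * w) * star (oddIso H) := by
  have h := mul_even_odd (evenIso H * x) (oddIso H * y) (z * star (evenIso H))
    (w * star (oddIso H))
  simp only [mul_assoc] at h ⊢
  exact h

variable (H) in
/-- The direct sum `(x, y) ↦ x ⊕ y` on the even and odd coordinates. -/
def dsum : (EllTwo H →L[ℂ] EllTwo H) × (EllTwo H →L[ℂ] EllTwo H) →⋆ₙₐ[ℂ]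
    (EllTwo H →L[ℂ] EllTwo H) where
  toFun p := evenIso H * p.1 * star (evenIso H) + oddIso H * p.2 * star (oddIso H)
  map_smul' c p := by
    simp only [Prod.smul_fst, Prod.smul_snd, mul_smul_comm, smul_mul_assoc, smul_add,
      MonoidHom.id_apply]
  map_zero' := by simp
  map_add' p q := by
    simp only [Prod.fst_add, Prod.snd_add]; noncomm_ring
  map_mul' p q := (mul_dsum _ _ _ _).symm
  map_star' p := by
    simp only [Prod.fst_star, Prod.snd_star, star_add, star_mul, star_star, mul_assoc]

theorem norm_dsum_le (x y : EllTwo H →L[ℂ] EllTwo H) : ‖dsum H (x, y)‖ ≤ max ‖x‖ ‖y‖ :=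
  NonUnitalStarAlgHom.norm_apply_le (dsum H) (x, y)

theorem dsum_mem {x y : EllTwo H →L[ℂ] EllTwo H} (hx : x ∈ stab A) (hy : y ∈ stab A) :
    dsum H (x, y) ∈ stab A :=
  add_mem (even_mem (even_mem hx).1).2 (odd_mem (odd_mem hy).1).2

theorem PosStab.oplus_val (a b : PosStab A) : (a.oplus b).val = dsum H (a.val, b.val) := rfl

/-- Functional calculus acts coordinatewise on the product algebra and commutes with the
⋆-homomorphism `dsum`. -/
theorem PosStab.cutDown_oplus (a b : PosStab A) {ε : ℝ} (hε : 0 ≤ ε) :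
    (a.oplus b).cutDown ε = (a.cutDown ε).oplus (b.cutDown ε) := by
  refine PosStab.ext ?_
  have hc : Continuous fun t : ℝ => max 0 (t - ε) := by fun_prop
  have h0 : (fun t : ℝ => max 0 (t - ε)) 0 = 0 := by simpa using hε
  have hcont : Continuous (dsum H) := by
    change Continuous fun p : (EllTwo H →L[ℂ] EllTwo H) × (EllTwo H →L[ℂ] EllTwo H) =>
      evenIso H * p.1 * star (evenIso H) + oddIso H * p.2 * star (oddIso H)
    fun_prop
  have hab : IsSelfAdjoint (a.val, b.val) := Prod.ext a.star_val b.star_val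
  change cfcₙ (fun t : ℝ => max 0 (t - ε)) (dsum H (a.val, b.val)) =
    dsum H (cfcₙ (fun t : ℝ => max 0 (t - ε)) a.val, cfcₙ (fun t : ℝ => max 0 (t - ε)) b.val)
  rw [← cfcₙ_map_prod (S := ℂ) (fun t : ℝ => max 0 (t - ε)) a.val b.val hc.continuousOn hab
    a.isSelfAdjoint b.isSelfAdjoint]
  exact (NonUnitalStarAlgHomClass.map_cfcₙ (S := ℂ) (dsum H) _ _ hc.continuousOn h0 hcont hab
    (a.oplus b).isSelfAdjoint).symm

theorem VeryRapidlyIncreasing.oplus {a a' : ℕ → PosStab A} (h : VeryRapidlyIncreasing a)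
    (h' : VeryRapidlyIncreasing a') : VeryRapidlyIncreasing fun n => (a n).oplus (a' n) where
  norm_le_one n := (norm_dsum_le _ _).trans (max_le (h.norm_le_one n) (h'.norm_le_one n))
  wayBelow n := by
    obtain ⟨ε, hε, h1⟩ := Cu.wayBelow_mk_iff.1 (h.wayBelow n)
    obtain ⟨ε', hε', h2⟩ := Cu.wayBelow_mk_iff.1 (h'.wayBelow n)
    have hm : 0 < min ε ε' := lt_min hε hε'
    refine Cu.wayBelow_mk_iff.2 ⟨min ε ε', hm, ?_⟩
    rw [PosStab.cutDown_oplus _ _ hm.le]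
    exact oplus_mono (h1.trans ((a (n + 1)).cutDown_anti hm.le (min_le_left _ _)))
      (h2.trans ((a' (n + 1)).cutDown_anti hm.le (min_le_right _ _)))
  almost_unit ε hε n := by
    obtain ⟨m₀, hm₀⟩ := h.almost_unit ε hε n
    obtain ⟨m₁, hm₁⟩ := h'.almost_unit ε hε n
    refine ⟨max m₀ m₁, fun m hm => ?_⟩
    obtain ⟨v, hv, hv1, h1⟩ := hm₀ m ((le_max_left _ _).trans hm)
    obtain ⟨w, hw, hw1, h2⟩ := hm₁ m ((le_max_right _ _).trans hm)
    refine ⟨dsum H (v, w), dsum_mem hv hw, (norm_dsum_le _ _).trans (max_le hv1 hw1), ?_⟩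
    simp only [PosStab.oplus_val, ← map_mul, ← map_star, ← map_sub]
    exact (norm_dsum_le _ _).trans_lt (max_lt h1 h2)

theorem Cu.isLUB_oplus {a a' : ℕ → PosStab A} {x x' : Cu A}
    (ha : ∀ n, ∀ᶠ m in atTop, Cu.mk (a n) ≤ Cu.mk (a m))
    (ha' : ∀ n, ∀ᶠ m in atTop, Cu.mk (a' n) ≤ Cu.mk (a' m))
    (hx : IsLUB (Set.range fun n => Cu.mk (a n)) x)
    (hx' : IsLUB (Set.range fun n => Cu.mk (a' n)) x') :
    IsLUB (Set.range fun n => Cu.mk ((a n).oplus (a' n))) (x + x') := by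
  obtain ⟨s, rfl⟩ := x.exists_mk_eq
  obtain ⟨s', rfl⟩ := x'.exists_mk_eq
  rw [Cu.mk_add_mk]
  refine Cu.isLUB_of_cutDown (fun n => oplus_mono (hx.1 ⟨n, rfl⟩) (hx'.1 ⟨n, rfl⟩))
    fun ε hε => ?_
  obtain ⟨n, hn⟩ := WayBelow.exists_le ha hx
    (Cu.wayBelow_mk_iff.2 ⟨ε, hε, CuntzLE.refl (s.cutDown ε)⟩)
  obtain ⟨n', hn'⟩ := WayBelow.exists_le ha' hx'
    (Cu.wayBelow_mk_iff.2 ⟨ε, hε, CuntzLE.refl (s'.cutDown ε)⟩)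
  obtain ⟨m, hm, hm'⟩ := ((ha n).and (ha' n')).exists
  refine ⟨m, ?_⟩
  rw [PosStab.cutDown_oplus _ _ hε.le]
  exact oplus_mono (Cu.mk_le_mk.1 (hn.trans hm)) (Cu.mk_le_mk.1 (hn'.trans hm'))

/-- Direct sums of witnesses are again witnesses: the norm of a direct sum is at most the larger of
the two norms, so no constant deteriorates. -/
theorem Corresponds.add {α : ℝ} (hα : α < 1 / 42) (hAB : CloseLT (stab A) (stab B) α)
    {x x' : Cu A} {y y' : Cu B} (h : Corresponds α x y) (h' : Corresponds α x' y') :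
    Corresponds α (x + x') (y + y') := by
  have hα0 := hAB.pos
  obtain ⟨a, b, ha, hb, hab, hax, hby⟩ := h
  obtain ⟨a', b', ha', hb', hab', hax', hby'⟩ := h'
  refine ⟨fun n => (a n).oplus (a' n), fun n => (b n).oplus (b' n), ha.oplus ha',
    fun n => (norm_dsum_le _ _).trans (max_le (hb n) (hb' n)), fun n => ?_, ?_, ?_⟩
  · simp only [PosStab.oplus_val, ← map_sub]
    exact (norm_dsum_le _ _).trans_lt (max_lt (hab n) (hab' n))
  · exact Cu.isLUB_oplus (fun n => eventually_atTop.2 ⟨n, fun m hm => ha.monotone hm⟩)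
      (fun n => eventually_atTop.2 ⟨n, fun m hm => ha'.monotone hm⟩) hax hax'
  · have := Cu.isLUB_oplus (eventually_cutDown_le hα hAB ha hb hab)
      (eventually_cutDown_le hα hAB ha' hb' hab') hby hby'
    simpa only [PosStab.cutDown_oplus _ _ (show 0 ≤ 18 * α by positivity)] using this

theorem Cu.zero_le (x : Cu A) : 0 ≤ x := by
  obtain ⟨a, rfl⟩ := x.exists_mk_eq
  exact CuntzLE.of_le (a := ⟨0, zero_mem _, le_rfl⟩) a.nonneg

end Additivity

/-! ### The corner and the scale. -/

section Corner

variable {H : Type*} [NormedAddCommGroup H] [InnerProductSpace ℂ H] [CompleteSpace H]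
variable {A B : NonUnitalStarSubalgebra ℂ (H →L[ℂ] H)}

theorem adjoint_coord_coord (i j : ℕ) :
    ContinuousLinearMap.adjoint (coord i : H →ₗᵢ[ℂ] EllTwo H).toContinuousLinearMap ∘L
      (coord j : H →ₗᵢ[ℂ] EllTwo H).toContinuousLinearMap = if i = j then 1 else 0 := by
  refine ContinuousLinearMap.ext fun x => ext_inner_left ℂ fun y => ?_
  change inner ℂ y (ContinuousLinearMap.adjoint
    (coord i : H →ₗᵢ[ℂ] EllTwo H).toContinuousLinearMap (coord j x)) = _
  rw [ContinuousLinearMap.adjoint_inner_right]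
  split_ifs with h
  · subst h
    exact (coord i : H →ₗᵢ[ℂ] EllTwo H).inner_map_map y x
  · simpa using orthogonalFamily_coord (H := H) id Function.injective_id h y x

theorem tensorUnit_mul (i j k l : ℕ) (a b : H →L[ℂ] H) :
    tensorUnit i j a * tensorUnit k l b = if j = k then tensorUnit i l (a * b) else 0 := by
  have e : tensorUnit i j a * tensorUnit k l b =
      (coord i).toContinuousLinearMap ∘L a ∘L
      (ContinuousLinearMap.adjoint (coord j : H →ₗᵢ[ℂ] EllTwo H).toContinuousLinearMap ∘L
        (coord k : H →ₗᵢ[ℂ] EllTwo H).toContinuousLinearMap) ∘L b ∘L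
      ContinuousLinearMap.adjoint (coord l).toContinuousLinearMap := rfl
  rw [e, adjoint_coord_coord]
  split_ifs with h
  · rfl
  · simp

theorem star_tensorUnit (i j : ℕ) (a : H →L[ℂ] H) :
    star (tensorUnit i j a) = tensorUnit j i (star a) := by
  simp only [tensorUnit, ContinuousLinearMap.star_eq_adjoint, ContinuousLinearMap.adjoint_comp,
    ContinuousLinearMap.adjoint_adjoint]
  rfl

variable (H) in
/-- The embedding `a ↦ a ⊗ e₀₀`. -/
def cornerHom : (H →L[ℂ] H) →⋆ₙₐ[ℂ] (EllTwo H →L[ℂ] EllTwo H) where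
  toFun a := tensorUnit 0 0 a
  map_smul' c a := by ext1 x; simp [tensorUnit]
  map_zero' := by ext1 x; simp [tensorUnit]
  map_add' a b := by ext1 x; simp [tensorUnit]
  map_mul' a b := by rw [tensorUnit_mul, if_pos rfl]
  map_star' a := (star_tensorUnit 0 0 a).symm

theorem norm_cornerHom_le (a : H →L[ℂ] H) : ‖cornerHom H a‖ ≤ ‖a‖ :=
  NonUnitalStarAlgHom.norm_apply_le (cornerHom H) a

theorem cornerHom_mem {a : H →L[ℂ] H} (ha : a ∈ A) : cornerHom H a ∈ stab A :=
  NonUnitalStarSubalgebra.le_topologicalClosure _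
    (NonUnitalStarAlgebra.subset_adjoin ℂ _ ⟨0, 0, a, ha, rfl⟩)

/-- The compression of an operator to the first coordinate. -/
def compress (x : EllTwo H →L[ℂ] EllTwo H) : H →L[ℂ] H :=
  ContinuousLinearMap.adjoint (coord 0 : H →ₗᵢ[ℂ] EllTwo H).toContinuousLinearMap ∘L x ∘L
    (coord 0 : H →ₗᵢ[ℂ] EllTwo H).toContinuousLinearMap

theorem norm_compress_le (x : EllTwo H →L[ℂ] EllTwo H) : ‖compress x‖ ≤ ‖x‖ := by
  have h1 : ‖(coord 0 : H →ₗᵢ[ℂ] EllTwo H).toContinuousLinearMap‖ ≤ 1 :=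
    LinearIsometry.norm_toContinuousLinearMap_le _
  have h2 : ‖ContinuousLinearMap.adjoint
      (coord 0 : H →ₗᵢ[ℂ] EllTwo H).toContinuousLinearMap‖ ≤ 1 := by
    rwa [LinearIsometryEquiv.norm_map]
  calc _ ≤ _ * (‖x‖ * _) := (ContinuousLinearMap.opNorm_comp_le _ _).trans
        (by gcongr; exact ContinuousLinearMap.opNorm_comp_le _ _)
    _ ≤ 1 * (‖x‖ * 1) := by gcongr
    _ = ‖x‖ := by ring

theorem compress_sub (x y : EllTwo H →L[ℂ] EllTwo H) :
    compress (x - y) = compress x - compress y := by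
  ext1 v; simp [compress]

theorem continuous_compress :
    Continuous (compress : (EllTwo H →L[ℂ] EllTwo H) → (H →L[ℂ] H)) :=
  (LipschitzWith.of_dist_le_mul (K := 1) fun x y => by
    rw [dist_eq_norm, dist_eq_norm, ← compress_sub, NNReal.coe_one, one_mul]
    exact norm_compress_le _).continuous

theorem compress_tensorUnit (i j : ℕ) (a : H →L[ℂ] H) :
    compress (tensorUnit i j a) = if 0 = i ∧ j = 0 then a else 0 := by
  have e : compress (tensorUnit i j a) =
      (ContinuousLinearMap.adjoint (coord 0 : H →ₗᵢ[ℂ] EllTwo H).toContinuousLinearMap ∘L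
        (coord i : H →ₗᵢ[ℂ] EllTwo H).toContinuousLinearMap) ∘L a ∘L
      (ContinuousLinearMap.adjoint (coord j : H →ₗᵢ[ℂ] EllTwo H).toContinuousLinearMap ∘L
        (coord 0 : H →ₗᵢ[ℂ] EllTwo H).toContinuousLinearMap) := rfl
  rw [e, adjoint_coord_coord, adjoint_coord_coord]
  by_cases h1 : 0 = i
  · by_cases h2 : j = 0
    · rw [if_pos h1, if_pos h2, if_pos ⟨h1, h2⟩]; rfl
    · rw [if_neg h2]; simp [h2]
  · rw [if_neg h1]; simp [h1]

theorem compress_cornerHom (a : H →L[ℂ] H) : compress (cornerHom H a) = a := by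
  change compress (tensorUnit 0 0 a) = a
  rw [compress_tensorUnit, if_pos ⟨rfl, rfl⟩]

-- Matrix units multiply to matrix units or zero, so the linear span is already a ⋆-subalgebra.
-- Compression is linear but not multiplicative, so this is the description on which it can be
-- evaluated.
open scoped Pointwise in
theorem mem_span_tensorUnit {x : EllTwo H →L[ℂ] EllTwo H}
    (hx : x ∈ NonUnitalStarAlgebra.adjoin ℂ {x | ∃ i j : ℕ, ∃ a ∈ A, x = tensorUnit i j a}) :
    x ∈ Submodule.span ℂ {x | ∃ i j : ℕ, ∃ a ∈ A, x = tensorUnit i j a} := by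
  set T : Set (EllTwo H →L[ℂ] EllTwo H) := {x | ∃ i j : ℕ, ∃ a ∈ A, x = tensorUnit i j a}
  have hTT : T * T ⊆ (Submodule.span ℂ T : Set (EllTwo H →L[ℂ] EllTwo H)) := by
    rintro _ ⟨_, ⟨i, j, a, ha, rfl⟩, _, ⟨k, l, b, hb, rfl⟩, rfl⟩
    change tensorUnit i j a * tensorUnit k l b ∈ Submodule.span ℂ T
    rw [tensorUnit_mul]
    split_ifs
    · exact Submodule.subset_span ⟨i, l, a * b, mul_mem ha hb, rfl⟩
    · exact zero_mem _
  induction hx using NonUnitalStarAlgebra.adjoin_induction with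
  | mem x hx => exact Submodule.subset_span hx
  | add x y _ _ hx hy => exact add_mem hx hy
  | zero => exact zero_mem _
  | mul x y _ _ hx hy =>
    have h1 := Submodule.mul_mem_mul hx hy
    rw [Submodule.span_mul_span] at h1
    exact Submodule.span_le.2 hTT h1
  | smul r x _ hx => exact Submodule.smul_mem _ r hx
  | star x hmem hx =>
    clear hmem
    induction hx using Submodule.span_induction with
    | mem x hx =>
      obtain ⟨i, j, a, ha, rfl⟩ := hx
      rw [star_tensorUnit]
      exact Submodule.subset_span ⟨j, i, star a, star_mem ha, rfl⟩
    | zero => rw [star_zero]; exact zero_mem _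
    | add x y _ _ hx hy => rw [star_add]; exact add_mem hx hy
    | smul r x _ hx => rw [star_smul]; exact Submodule.smul_mem _ _ hx

theorem compress_mem (hA : IsClosed (A : Set (H →L[ℂ] H))) {x : EllTwo H →L[ℂ] EllTwo H}
    (hx : x ∈ stab A) : compress x ∈ A := by
  refine closure_minimal (fun x hx => ?_) (hA.preimage continuous_compress) hx
  have h := mem_span_tensorUnit hx
  change compress x ∈ A
  clear hx
  induction h using Submodule.span_induction with
  | mem x hx =>
    obtain ⟨i, j, a, ha, rfl⟩ := hx
    rw [compress_tensorUnit]
    split_ifs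
    · exact ha
    · exact zero_mem _
  | zero =>
    have : compress (0 : EllTwo H →L[ℂ] EllTwo H) = 0 := by ext1 v; simp [compress]
    rw [this]; exact zero_mem _
  | add x y _ _ hx hy =>
    have : compress (x + y) = compress x + compress y := by ext1 v; simp [compress]
    rw [this]; exact add_mem hx hy
  | smul r x _ hx =>
    have : compress (r • x) = r • compress x := by ext1 v; simp [compress]
    rw [this]; exact SMulMemClass.smul_mem r hx

/-- `a` belongs to the corner `A ⊗ e₀₀`. -/
def PosStab.IsCorner (a : PosStab A) : Prop := ∃ c ∈ A, 0 ≤ c ∧ a.val = tensorUnit 0 0 c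

theorem PosStab.IsCorner.fc (hA : IsClosed (A : Set (H →L[ℂ] H))) {a : PosStab A}
    (ha : a.IsCorner) {f : ℝ → ℝ} (hf : ∀ t, 0 ≤ f t) (hfc : Continuous f) (hf0 : f 0 = 0) :
    (a.fc f hf).IsCorner := by
  obtain ⟨c, hc, hc0, hac⟩ := ha
  refine ⟨cfcₙ f c, cfcₙ_mem (hs := hA) _ hc, cfcₙ_nonneg fun _ _ => hf _, ?_⟩
  have hcont : Continuous (cornerHom H) :=
    AddMonoidHomClass.continuous_of_bound (cornerHom H) 1
      fun x => by rw [one_mul]; exact norm_cornerHom_le x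
  have hsa : IsSelfAdjoint (cornerHom H c) := by
    have := a.isSelfAdjoint
    rwa [hac] at this
  change cfcₙ f a.val = _
  rw [hac]
  exact (NonUnitalStarAlgHomClass.map_cfcₙ (S := ℂ) (cornerHom H) f c hfc.continuousOn hf0 hcont
    (.of_nonneg hc0) hsa).symm

/-- An approximant of the square root need not lie in the corner, but compressing it to the corner
is contractive and fixes the square root; squaring afterwards gives positivity. -/
theorem PosStab.IsCorner.exists_close (hA : IsClosed (A : Set (H →L[ℂ] H)))
    (hB : IsClosed (B : Set (H →L[ℂ] H))) {α : ℝ} (hAB : CloseLT (stab A) (stab B) α)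
    {a : PosStab A} (ha : a.IsCorner) (ha1 : ‖a.val‖ ≤ 1) :
    ∃ b : PosStab B, b.IsCorner ∧ ‖b.val‖ ≤ 1 ∧ ‖a.val - b.val‖ < 2 * α := by
  obtain ⟨c, hc, hc0, hac⟩ := ha
  have hac' : a.val = cornerHom H c := hac
  have hc1 : ‖c‖ ≤ 1 := by
    rw [← compress_cornerHom c, ← hac']
    exact (norm_compress_le _).trans ha1
  have hs1 := norm_cfc_sqrt_le_one hc0 hc1
  obtain ⟨y, hy, hy1, h⟩ := hAB.1 (cornerHom H (cfc Real.sqrt c))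
    (cornerHom_mem (cfc_mem_of_map_zero hA hc Real.continuous_sqrt Real.sqrt_zero))
    ((norm_cornerHom_le _).trans hs1)
  have hp := compress_mem hB hy
  have hp1 : ‖compress y‖ ≤ 1 := (norm_compress_le y).trans hy1
  have hsp : ‖cfc Real.sqrt c - compress y‖ < α := by
    refine lt_of_le_of_lt ?_ h
    conv_lhs => rw [← compress_cornerHom (cfc Real.sqrt c), ← compress_sub]
    exact norm_compress_le _
  have hlt := norm_sq_sub_mul_star_lt (star_cfc_real _ _) hs1 hp1 hsp
  rw [cfc_sqrt_mul_cfc_sqrt hc0] at hlt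
  have hpos : 0 ≤ cornerHom H (compress y * star (compress y)) := by
    rw [map_mul, map_star]
    exact mul_star_self_nonneg _
  refine ⟨⟨cornerHom H (compress y * star (compress y)), cornerHom_mem (mul_mem hp (star_mem hp)),
    hpos⟩, ⟨_, mul_mem hp (star_mem hp), mul_star_self_nonneg _, rfl⟩,
    (norm_cornerHom_le _).trans (norm_mul_star_le_one hp1), ?_⟩
  change ‖a.val - cornerHom H _‖ < _
  rw [hac', ← map_sub]
  exact (norm_cornerHom_le _).trans_lt hlt

/-- Every modification made to the sequence (ramps, approximants, cut-downs) can be carried out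
inside the corner, so witnesses for the scale go to witnesses for the scale. -/
theorem exists_corresponds_scale (hA : IsClosed (A : Set (H →L[ℂ] H)))
    (hB : IsClosed (B : Set (H →L[ℂ] H))) {α : ℝ} (hα : α < 1 / 42)
    (hAB : CloseLT (stab A) (stab B) α) {x : Cu A} (hx : x ∈ scale A) :
    ∃ y ∈ scale B, Corresponds α x y := by
  have hα0 := hAB.pos
  obtain ⟨a, hac, ha, hax⟩ := hx
  obtain ⟨δ, hδ, h1, h2, h3⟩ :=
    exists_veryRapidlyIncreasing (a := a) fun n => ha n.le_succ
  have hcorner : ∀ n, ((a n).fc (ramp (δ n) (δ n)) (ramp_nonneg _ (hδ n))).IsCorner := fun n =>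
    PosStab.IsCorner.fc hA (hac n) _ (continuous_ramp _ _) (ramp_of_le _ (hδ n).le)
  have hlub : IsLUB (Set.range fun n =>
      Cu.mk ((a n).fc (ramp (δ n) (δ n)) (ramp_nonneg _ (hδ n)))) x := by
    obtain ⟨s, rfl⟩ := x.exists_mk_eq
    refine Cu.isLUB_of_cutDown (fun n => (h2 n).trans (hax.1 ⟨n, rfl⟩)) fun ε hε => ?_
    obtain ⟨k, hk⟩ := Cu.cutDown_le_of_isLUB ha hax (half_pos hε)
    obtain ⟨η, hη, h4⟩ := hk.exists_cutDown (half_pos hε)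
    obtain ⟨n, hn⟩ := h3 k η hη
    rw [PosStab.cutDown_cutDown _ (half_pos hε).le (half_pos hε).le, add_halves] at h4
    exact ⟨n, h4.trans hn⟩
  choose b hbc hb1 hab using fun n => (hcorner n).exists_close hA hB hAB (h1.norm_le_one n)
  obtain ⟨y, hy⟩ := exists_isLUB_cutDown hα hAB h1 hb1 hab
  refine ⟨y, ?_, _, b, h1, hb1, hab, hlub, hy⟩
  obtain ⟨φ, hφ, hφ'⟩ := exists_monotone_subseq (eventually_cutDown_le hα hAB h1 hb1 hab)
  exact ⟨fun n => (b (φ n)).cutDown (18 * α), fun n =>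
    (hbc (φ n)).fc hB (fun _ => le_max_left _ _) (by fun_prop) (by simpa using hα0.le), hφ,
    (isLUB_range_subseq_iff hφ').2 hy⟩

end Corner
end CuntzStab

end

/-! ### Assembly of the isomorphism. -/

theorem mainTheorem1 {H : Type*} [NormedAddCommGroup H] [InnerProductSpace ℂ H] [CompleteSpace H]
    (A B : NonUnitalStarSubalgebra ℂ (H →L[ℂ] H))
    (hA : IsClosed (A : Set (H →L[ℂ] H))) (hB : IsClosed (B : Set (H →L[ℂ] H)))
    (α : ℝ) (hα : α < 1 / 42) (hAB : CuntzStab.CBCloseLT A B α) :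
    ∃ Φ : CuntzStab.Cu A ≃ CuntzStab.Cu B,
      -- `Φ` is an isomorphism in the category **Cu**, carrying the scale onto the scale
      CuntzStab.IsCuMorphism Φ ∧ CuntzStab.IsCuMorphism Φ.symm ∧
      Φ '' CuntzStab.scale A = CuntzStab.scale B ∧
      -- `Φ(sup ⟨a_n⟩) = sup ⟨(b_n - 18α)_+⟩`, both suprema existing
      (∀ (a : ℕ → CuntzStab.PosStab A) (b : ℕ → CuntzStab.PosStab B),
        CuntzStab.VeryRapidlyIncreasing a → (∀ n, ‖(b n).val‖ ≤ 1) →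
        (∀ n, ‖(a n).val - (b n).val‖ < 2 * α) →
        ∃ x : CuntzStab.Cu A,
          IsLUB (Set.range fun n => CuntzStab.Cu.mk (a n)) x ∧
          IsLUB (Set.range fun n => CuntzStab.Cu.mk ((b n).cutDown (18 * α))) (Φ x)) ∧
      -- the formula applies to every element of `Cu(A)`, so that it determines `Φ`
      (∀ x : CuntzStab.Cu A, ∃ a : ℕ → CuntzStab.PosStab A, CuntzStab.VeryRapidlyIncreasing a ∧
        IsLUB (Set.range fun n => CuntzStab.Cu.mk (a n)) x) ∧
      (∀ a : ℕ → CuntzStab.PosStab A, CuntzStab.VeryRapidlyIncreasing a →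
        ∃ b : ℕ → CuntzStab.PosStab B, ∀ n, ‖(b n).val‖ ≤ 1 ∧
          ‖(a n).val - (b n).val‖ < 2 * α) := by
  have hBA : CuntzStab.CloseLT (CuntzStab.stab B) (CuntzStab.stab A) α :=
    CuntzStab.CloseLT.symm hAB
  obtain ⟨Φ, hΦ, hΨ⟩ := CuntzStab.exists_equiv hα hAB
  have hadd : ∀ x y, Φ (x + y) = Φ x + Φ y := fun x y =>
    ((hΦ _ _).1 (((hΦ x _).2 rfl).add hα hAB ((hΦ y _).2 rfl))).symm
  have hadd' : ∀ x y, Φ.symm (x + y) = Φ.symm x + Φ.symm y := fun x y =>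
    ((hΨ _ _).1 (((hΨ x _).2 rfl).add hα hBA ((hΨ y _).2 rfl))).symm
  refine ⟨Φ.toEquiv,
    CuntzStab.isCuMorphism_of_orderIso Φ CuntzStab.Cu.zero_le CuntzStab.Cu.zero_le hadd,
    CuntzStab.isCuMorphism_of_orderIso Φ.symm CuntzStab.Cu.zero_le CuntzStab.Cu.zero_le hadd',
    ?_, ?_, CuntzStab.Cu.exists_veryRapidlyIncreasing, fun a ha => ha.exists_close hAB⟩
  · ext y
    constructor
    · rintro ⟨x, hx, rfl⟩
      obtain ⟨y, hy, hxy⟩ := CuntzStab.exists_corresponds_scale hA hB hα hAB hx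
      rw [(hΦ x y).1 hxy] at hy
      exact hy
    · intro hy
      obtain ⟨x, hx, hyx⟩ := CuntzStab.exists_corresponds_scale hB hA hα hBA hy
      refine ⟨x, hx, ?_⟩
      rw [(hΨ y x).1 hyx]
      exact Φ.apply_symm_apply y
  · intro a b ha hb hab
    obtain ⟨x, hx⟩ := CuntzStab.Cu.exists_isLUB ha.monotone
    obtain ⟨y, hy⟩ := CuntzStab.exists_isLUB_cutDown hα hAB ha hb hab
    refine ⟨x, hx, ?_⟩
    -- The given sequences are themselves witnesses for the graph, so single-valuedness identifies
    -- `y` with the image of `x`.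
    have h := (hΦ x y).1 ⟨a, b, ha, hb, hab, hx, hy⟩
    rw [h] at hy
    exact hy
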